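/- **Setting.** Let $d\in\{2,3\}$, let $\Omega\subset\mathbb R^d$ be nonempty, open and bounded, let $\nu,\tau,T>0$, and let $\mu:\mathbb R^d\to\mathbb R$ be measurable with $0\le\mu\le\mu_{\max}$ on $\Omega$ (for instance a constant). $(\cdot,\cdot)$ and $\|\cdot\|$ are the inner product and norm of $L^2(\Omega)$. Let $W=H^1_0(\Omega)^d$ (closure of $C_c^\infty(\Omega)^d$ in $H^1$), $Q=L^2_0(\Omega)$, $V=\{u\in W:(\nabla\cdot u,p)=0\ \forall p\in Q\}$, $\|g\|_{-1}=\sup\{(g,w):w\in W,\ \|\nabla w\|\le1\}$, and $$b(u,v,w)=\tfrac12((u\cdot\nabla)v,w)-\tfrac12((u\cdot\nabla)w,v).$$ Let $f\in L^2(0,T;H^{-1}(\Omega)^d)$, $v_0\in W$ and $k_0\ge0$. A *smooth solution of the 1/2-equation model* is a triple $(v,q,k)$ with $v\in H^1(0,T;W)$, $v(t)\in V$ for all $t\in[0,T]$, $q\in L^2(0,T;Q)$, $k$ absolutely continuous on $[0,T]$, $v(0)=v_0$, $k(0)=k_0$, and, for almost every $t\in(0,T)$, $$(v_t,w)+((\nu+\mu\tau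 k(t))\nabla v,\nabla w)+b(v,v,w)-(\nabla\cdot w,q)=(f,w)\qquad\forall w\in W,$$ $$\frac{dk}{dt}+\frac{\sqrt2}{2}\tau^{-1}k=\frac1{|\Omega|}\int_\Omega\mu\tau k\,|\nabla v|^2\,dx .$$ Let $W_h\subset W$ and $Q_h\subset Q$ be finite-dimensional subspaces (for example, conforming finite element spaces) and $V_h=\{u_h\in W_h:(\nabla\cdot u_h,p_h)=0\ \forall p_h\in Q_h\}$. A *semi-discrete solution* is a triple $(v_h,q_h,k_h)$ with $v_h:[0,T]\to W_h$ and $k_h:[0,T]\to\mathbb R$ absolutely continuous and $q_h:[0,T]\to Q_h$, such that $(\nabla\cdot v_h(t),p_h)=0$ for all $p_h\in Q_h$ and $t\in[0,T]$, and, for almost every $t\in(0,T)$, $$(v_{h,t},w_h)+((\nu+\mu\tau k_h(t))\nabla v_h,\nabla w_h)+b(v_h,v_h,w_h)-(\nabla\cdot w_h,q_h)=(f,w_h)\qquad\forall w_h\in W_h,$$ $$\frac{dk_h}{dt}+\frac{\sqrt2}{2}\tau^{-1}k_h=\frac1{|\Omega|}\int_\Omega\mu\tau k_h\,|\nabla v_h|^2\,dx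 .$$ **Theorem 4.2.** For all real $M,R$ there is a constant $C>0$, depending only on $d,\Omega,\nu,\tau,\mu,T,f,v_0,k_0,M$ and $R$ (in particular not on $W_h,Q_h$), such that for every smooth solution $(v,q,k)$ of the 1/2-equation model with $\int_0^T\|\nabla v\|^4dt\le M$, all $W_h,Q_h$ as above, and every semi-discrete solution $(v_h,q_h,k_h)$ with $\|v_h(0)\|\le R$ and $0\le k_h(0)\le R$, $$\begin{aligned} &\sup_{t\in[0,T]}\|v-v_h\|^2+\sup_{t\in[0,T]}(k-k_h)^2+\nu\int_0^T\|\nabla v-\nabla v_h\|^2dt\\ &\quad\le C\left(\|v_0-v_h(0)\|^2+(k(0)-k_h(0))^2\right) +C\inf_{w_h}\int_0^T\|\nabla(v-w_h)\|^2dt+C\inf_{w_h}\sup_{t\in[0,T]}\|v-w_h\|^2\\ &\qquad+C\inf_{\tilde w_h,\;p_h}\int_0^T\left(\|q-p_h\|^2+\|(v-\tilde w_h)_t\|_{-1}^2+\|\nabla v-\nabla\tilde w_h\|^2\right)dt . \end{aligned}$$ The three infima are taken independently; $w_h$ ranges over the absolutely continuous paths $[0,T]\to W_h$, $\tilde w_h$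 over the absolutely continuous paths $[0,T]\to V_h$, and $p_h$ over the measurable paths $[0,T]\to Q_h$ (infinite values are allowed on the right-hand side). -/

import Mathlib

open MeasureTheory Set
open scoped ENNReal ContDiff InnerProductSpace

noncomputable section

namespace HalfEq

/-- Points of `ℝ^d`, and velocity values, with the Euclidean norm. -/
abbrev Vec (d : ℕ) : Type := EuclideanSpace ℝ (Fin d)

/-- Velocity gradients with the Frobenius norm; the entry `(i, j)` is `∂ᵢ uⱼ`. -/
abbrev Mat (d : ℕ) : Type := EuclideanSpace ℝ (Fin d × Fin d)

/-- The Lebesgue space `L²(Ω; F)`. -/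
abbrev L2 {d : ℕ} (Ω : Set (Vec d)) (F : Type) [NormedAddCommGroup F] : Type :=
  Lp F 2 (volume.restrict Ω)

/-- The classical gradient of a vector field. -/
def classicalGrad {d : ℕ} (φ : Vec d → Vec d) (x : Vec d) : Mat d :=
  WithLp.toLp 2 fun ij => fderiv ℝ φ x (EuclideanSpace.single ij.1 1) ij.2

/-- The pairs `(φ, ∇φ)` in `L² × L²`, for `φ` a smooth vector field with compact support in `Ω`. -/
def testPairs {d : ℕ} (Ω : Set (Vec d)) : Set (WithLp 2 (L2 Ω (Vec d) × L2 Ω (Mat d))) :=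
  {h | ∃ φ : Vec d → Vec d, ContDiff ℝ ∞ φ ∧ HasCompactSupport φ ∧ tsupport φ ⊆ Ω ∧
    h.fst =ᵐ[volume.restrict Ω] φ ∧ h.snd =ᵐ[volume.restrict Ω] classicalGrad φ}

/-- The Sobolev space `H¹₀(Ω)^d`, the closure of the smooth compactly supported fields in the norm
`(‖u‖² + ‖∇u‖²)^{1/2}`. An element is stored as the pair `(u, ∇u)`. -/
def H10 {d : ℕ} (Ω : Set (Vec d)) : Submodule ℝ (WithLp 2 (L2 Ω (Vec d) × L2 Ω (Mat d))) :=
  (Submodule.span ℝ (testPairs Ω)).topologicalClosure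

/-- The field `u ∈ L²(Ω)^d` underlying an element of `H¹₀(Ω)^d`. -/
def val {d : ℕ} {Ω : Set (Vec d)} (u : H10 Ω) : L2 Ω (Vec d) :=
  (u : WithLp 2 (L2 Ω (Vec d) × L2 Ω (Mat d))).fst

/-- The (weak) gradient `∇u ∈ L²(Ω)^{d×d}` of an element of `H¹₀(Ω)^d`. -/
def grad {d : ℕ} {Ω : Set (Vec d)} (u : H10 Ω) : L2 Ω (Mat d) :=
  (u : WithLp 2 (L2 Ω (Vec d) × L2 Ω (Mat d))).snd

/-- The weighted form `∫_Ω c ∇u : ∇w`. -/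
def gradForm {d : ℕ} {Ω : Set (Vec d)} (c : Vec d → ℝ) (u w : H10 Ω) : ℝ :=
  ∫ x in Ω, c x * ⟪grad u x, grad w x⟫_ℝ

/-- The pairing `(∇·u, p)`. -/
def divForm {d : ℕ} {Ω : Set (Vec d)} (u : H10 Ω) (p : L2 Ω ℝ) : ℝ :=
  ∫ x in Ω, (∑ i, grad u x (i, i)) * p x

/-- The convective form `((u·∇)v, w)`. -/
def conv {d : ℕ} {Ω : Set (Vec d)} (u v w : H10 Ω) : ℝ :=
  ∫ x in Ω, ∑ i, ∑ j, val u x i * grad v x (i, j) * val w x j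

/-- The skew-symmetric trilinear form `b(u, v, w)`. -/
def triForm {d : ℕ} {Ω : Set (Vec d)} (u v w : H10 Ω) : ℝ :=
  1 / 2 * conv u v w - 1 / 2 * conv u w v

/-- The norm `‖g‖₋₁ = sup {(g, w) : w ∈ H¹₀(Ω)^d, ‖∇w‖ ≤ 1}`. -/
def negNorm {d : ℕ} {Ω : Set (Vec d)} (g : L2 Ω (Vec d)) : ℝ≥0∞ :=
  ⨆ (w : H10 Ω) (_ : ‖grad w‖ ≤ 1), ENNReal.ofReal ⟪g, val w⟫_ℝ

/-- Membership in the pressure space `L²₀(Ω)`. -/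
def MeanZero {d : ℕ} {Ω : Set (Vec d)} (p : L2 Ω ℝ) : Prop :=
  ∫ x in Ω, p x = 0

/-- The divergence-free space `V`. -/
def divFree {d : ℕ} (Ω : Set (Vec d)) : Set (H10 Ω) :=
  {u | ∀ p : L2 Ω ℝ, MeanZero p → divForm u p = 0}

/-- The discretely divergence-free space `V_h` of a pair `(W_h, Q_h)`. -/
def discDivFree {d : ℕ} {Ω : Set (Vec d)} (Wh : Submodule ℝ (H10 Ω)) (Qh : Submodule ℝ (L2 Ω ℝ)) :
    Set (H10 Ω) :=
  {u | u ∈ Wh ∧ ∀ p ∈ Qh, divForm u p = 0}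

/-- `u` is absolutely continuous on `[0, T]` with (integrable, almost everywhere defined) time
derivative `u'`. -/
def HasTimeDeriv {X : Type*} [NormedAddCommGroup X] [NormedSpace ℝ X] (T : ℝ) (u u' : ℝ → X) :
    Prop :=
  IntervalIntegrable u' volume 0 T ∧ ∀ t ∈ Icc 0 T, u t = u 0 + ∫ s in (0 : ℝ)..t, u' s

/-- `w` is an absolutely continuous path in `X`, with time derivative `w'`. -/
def IsPath {d : ℕ} {Ω : Set (Vec d)} (T : ℝ) (X : Set (H10 Ω)) (w w' : ℝ → H10 Ω) : Prop :=
  HasTimeDeriv T w w' ∧ ∀ t ∈ Icc 0 T, w t ∈ X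

/-- `p` is a measurable path in `Q_h`. -/
def IsPressurePath {d : ℕ} {Ω : Set (Vec d)} (T : ℝ) (Qh : Submodule ℝ (L2 Ω ℝ))
    (p : ℝ → L2 Ω ℝ) : Prop :=
  AEStronglyMeasurable p (volume.restrict (Icc 0 T)) ∧ ∀ t ∈ Icc 0 T, p t ∈ Qh

/-- `(v, q, k)` is a smooth (`v ∈ H¹(0,T; H¹₀)`, `q ∈ L²(0,T; L²₀)`, `k` absolutely continuous)
solution on `[0, T]` of the 1/2-equation model with no-slip boundary conditions; `v'` and `k'` are
the time derivatives. -/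
structure IsModelSolution {d : ℕ} (Ω : Set (Vec d)) (ν τ : ℝ) (μ : Vec d → ℝ) (T : ℝ)
    (f : ℝ → StrongDual ℝ (H10 Ω)) (v v' : ℝ → H10 Ω) (q : ℝ → L2 Ω ℝ) (k k' : ℝ → ℝ) :
    Prop where
  hasDeriv_v : HasTimeDeriv T v v'
  memLp_v' : MemLp v' 2 (volume.restrict (Icc 0 T))
  memLp_q : MemLp q 2 (volume.restrict (Icc 0 T))
  meanZero_q : ∀ t ∈ Icc 0 T, MeanZero (q t)
  hasDeriv_k : HasTimeDeriv T k k'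
  divFree_v : ∀ t ∈ Icc 0 T, v t ∈ divFree Ω
  momentum : ∀ᵐ t ∂(volume.restrict (Icc 0 T)), ∀ w : H10 Ω,
    ⟪val (v' t), val w⟫_ℝ + gradForm (fun x => ν + μ x * τ * k t) (v t) w
      + triForm (v t) (v t) w - divForm w (q t) = f t w
  kEquation : ∀ᵐ t ∂(volume.restrict (Icc 0 T)),
    k' t + √2 / 2 * τ⁻¹ * k t
      = 1 / volume.real Ω * gradForm (fun x => μ x * τ * k t) (v t) (v t)

/-- `(v_h, q_h, k_h)` is a solution on `[0, T]` of the semi-discrete scheme on `(W_h, Q_h)`; `vh'`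
and `kh'` are the time derivatives. -/
structure IsSemidiscreteSolution {d : ℕ} (Ω : Set (Vec d)) (ν τ : ℝ) (μ : Vec d → ℝ) (T : ℝ)
    (f : ℝ → StrongDual ℝ (H10 Ω)) (Wh : Submodule ℝ (H10 Ω)) (Qh : Submodule ℝ (L2 Ω ℝ))
    (vh vh' : ℝ → H10 Ω) (qh : ℝ → L2 Ω ℝ) (kh kh' : ℝ → ℝ) : Prop where
  path_vh : IsPath T Wh vh vh'
  qh_mem : ∀ t ∈ Icc 0 T, qh t ∈ Qh
  hasDeriv_kh : HasTimeDeriv T kh kh'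
  continuity : ∀ t ∈ Icc 0 T, ∀ p ∈ Qh, divForm (vh t) p = 0
  momentum : ∀ᵐ t ∂(volume.restrict (Icc 0 T)), ∀ w ∈ Wh,
    ⟪val (vh' t), val w⟫_ℝ + gradForm (fun x => ν + μ x * τ * kh t) (vh t) w
      + triForm (vh t) (vh t) w - divForm w (qh t) = f t w
  kEquation : ∀ᵐ t ∂(volume.restrict (Icc 0 T)),
    kh' t + √2 / 2 * τ⁻¹ * kh t
      = 1 / volume.real Ω * gradForm (fun x => μ x * τ * kh t) (vh t) (vh t)

end HalfEq

end

open HalfEq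

/-! The error is measured against a comparison path `w` in `V_h`. Put `φ = v_h - w` and `κ = k -
k_h`. Test the difference of the momentum equations with `φ` and the difference of the `k`-equations
with `κ`, then apply Gronwall to `‖φ‖² + κ²`. The two equations are coupled through `k_h ∇v_h` and
`k_h |∇v_h|²`, so both errors are estimated together. Three facts close the argument. With the
velocity given, the `k`-equation is linear and homogeneous in `k`, so `k_h` is an explicit
exponential: it is nonnegative, and the energy estimate bounds it by the data. The convective
difference splits so that only `∇v` and `∇w` act as coefficients, and a Ladyzhenskaya inequality
absorbs `b(φ, w, φ)`. The production difference involves `∇v_h`, which is only square integrable in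
time; that suffices, because `1 + ‖∇v_h‖²` can be the Gronwall rate (`exists_error_constant`).

This requires `‖∇w(t)‖` to be bounded uniformly in time and in the spaces, which an arbitrary
discrete path `z` does not provide. So `z` is replaced by the solution `w` of the Galerkin scheme
for the linear parabolic problem solved by `v` (`exists_parabolic_projection`). Testing with `w'`
bounds `∇(v - w)` uniformly in time through `∫‖v'‖²` and the initial gradient, and testing with `w -
z` shows that `w` is as accurate as `z` up to constants. The initial value has to be accurate and to
have a bounded gradient as well. It is taken from `z` at an early time where `∇(v - z)` is moderate
(`exists_initial_value`); the time window has the length of the squared error, so the motion of `v`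
in it is harmless. The orthogonality of `w` also removes the time derivative of `v - w` from the
error equation.

The constants so obtained depend on `sup ‖∇v‖` and `∫‖v'‖²`. These are nevertheless data: the same
error estimate, applied on the full space, shows that the velocity is unique for given data
(`IsSolution.eqOn`), so the bounds of one reference solution serve for all.

The argument runs on abstract forms (`FlowForms`). The analytic input is the embedding of `H¹₀` into
`L⁶`, from which the Poincaré, `L⁴` and interpolation inequalities follow. -/

namespace HalfEq

/-! ### Calculus of absolutely continuous paths and Gronwall's inequality. -/

section TimeCalculus

variable {X Y : Type*} [NormedAddCommGroup X] [NormedSpace ℝ X]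
  [NormedAddCommGroup Y] [NormedSpace ℝ Y] {T : ℝ} {u u' : ℝ → X} {w w' : ℝ → Y}

theorem HasTimeDeriv.intervalIntegrable (hu : HasTimeDeriv T u u') {s t : ℝ}
    (hs : s ∈ Icc 0 T) (ht : t ∈ Icc 0 T) : IntervalIntegrable u' volume s t := by
  refine hu.1.mono_set ?_
  have hT : (0 : ℝ) ≤ T := hs.1.trans hs.2
  rw [uIcc_of_le hT]
  exact uIcc_subset_Icc hs ht

theorem HasTimeDeriv.sub_eq_integral (hu : HasTimeDeriv T u u') {s t : ℝ}
    (hs : s ∈ Icc 0 T) (ht : t ∈ Icc 0 T) : u t - u s = ∫ r in s..t, u' r := by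
  have hT : (0 : ℝ) ≤ T := hs.1.trans hs.2
  have h0 : (0 : ℝ) ∈ Icc 0 T := ⟨le_rfl, hT⟩
  rw [hu.2 t ht, hu.2 s hs, add_sub_add_left_eq_sub]
  exact intervalIntegral.integral_interval_sub_left (hu.intervalIntegrable h0 ht)
    (hu.intervalIntegrable h0 hs)

theorem HasTimeDeriv.continuousOn (hu : HasTimeDeriv T u u') (hT : 0 ≤ T) :
    ContinuousOn u (Icc 0 T) := by
  have h1 : ContinuousOn (fun t => ∫ s in (0 : ℝ)..t, u' s) (uIcc 0 T) :=
    intervalIntegral.continuousOn_primitive_interval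
      ((intervalIntegrable_iff' (by simp)).1 hu.1)
  rw [uIcc_of_le hT] at h1
  exact (continuousOn_const.add h1).congr fun t ht => hu.2 t ht

theorem HasTimeDeriv.map [CompleteSpace X] [CompleteSpace Y] (A : X →L[ℝ] Y)
    (hu : HasTimeDeriv T u u') : HasTimeDeriv T (fun t => A (u t)) (fun t => A (u' t)) := by
  refine ⟨intervalIntegrable_iff.2 (A.integrable_comp (intervalIntegrable_iff.1 hu.1)), fun t ht => ?_⟩
  have hT : (0 : ℝ) ≤ T := ht.1.trans ht.2
  dsimp only
  rw [hu.2 t ht, map_add, A.intervalIntegral_comp_comm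
    (hu.intervalIntegrable ⟨le_rfl, hT⟩ ht)]

theorem HasTimeDeriv.add {w w' : ℝ → X} (hu : HasTimeDeriv T u u') (hw : HasTimeDeriv T w w') :
    HasTimeDeriv T (fun t => u t + w t) (fun t => u' t + w' t) := by
  refine ⟨hu.1.add hw.1, fun t ht => ?_⟩
  have h0 : (0 : ℝ) ∈ Icc 0 T := ⟨le_rfl, ht.1.trans ht.2⟩
  dsimp only
  rw [hu.2 t ht, hw.2 t ht, intervalIntegral.integral_add (hu.intervalIntegrable h0 ht)
    (hw.intervalIntegrable h0 ht)]
  abel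

theorem HasTimeDeriv.sub {w w' : ℝ → X} (hu : HasTimeDeriv T u u') (hw : HasTimeDeriv T w w') :
    HasTimeDeriv T (fun t => u t - w t) (fun t => u' t - w' t) := by
  refine ⟨hu.1.sub hw.1, fun t ht => ?_⟩
  have h0 : (0 : ℝ) ∈ Icc 0 T := ⟨le_rfl, ht.1.trans ht.2⟩
  dsimp only
  rw [hu.2 t ht, hw.2 t ht, intervalIntegral.integral_sub (hu.intervalIntegrable h0 ht)
    (hw.intervalIntegrable h0 ht)]
  abel

theorem HasTimeDeriv.ae_hasDerivAt [CompleteSpace X] (hT : 0 ≤ T) (hu : HasTimeDeriv T u u') :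
    ∀ᵐ t, t ∈ Ioo 0 T → HasDerivAt u (u' t) t := by
  filter_upwards [hu.1.ae_hasDerivAt_integral] with t ht htm
  rw [uIcc_of_le hT] at ht
  have h := (ht (Ioo_subset_Icc_self htm) 0 ⟨le_rfl, hT⟩).const_add (u 0)
  refine h.congr_of_eventuallyEq ?_
  filter_upwards [Ioo_mem_nhds htm.1 htm.2] with s hs
  exact hu.2 s (Ioo_subset_Icc_self hs)

/-- This scalar primitive dominates the increments of the Banach-valued path `u`, so real functions
of the path can inherit absolute continuity from it. -/
theorem HasTimeDeriv.absolutelyContinuous_variation (hu : HasTimeDeriv T u u') :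
    AbsolutelyContinuousOnInterval (fun t => ∫ s in (0 : ℝ)..t, ‖u' s‖) 0 T :=
  hu.1.norm.absolutelyContinuousOnInterval_intervalIntegral (by simp)

theorem HasTimeDeriv.norm_sub_le (hu : HasTimeDeriv T u u') {s t : ℝ}
    (hs : s ∈ Icc 0 T) (ht : t ∈ Icc 0 T) :
    ‖u s - u t‖ ≤ |(∫ r in (0 : ℝ)..s, ‖u' r‖) - ∫ r in (0 : ℝ)..t, ‖u' r‖| := by
  have h0 : (0 : ℝ) ∈ Icc 0 T := ⟨le_rfl, ht.1.trans ht.2⟩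
  rw [hu.sub_eq_integral ht hs, intervalIntegral.integral_interval_sub_left
    (hu.intervalIntegrable h0 hs).norm (hu.intervalIntegrable h0 ht).norm]
  exact intervalIntegral.norm_integral_le_abs_integral_norm

/-- A bounded bilinear form of two absolutely continuous paths satisfies the product rule. -/
theorem HasTimeDeriv.bilin [CompleteSpace X] [CompleteSpace Y] (B : X →L[ℝ] Y →L[ℝ] ℝ)
    (hT : 0 ≤ T) (hu : HasTimeDeriv T u u') (hw : HasTimeDeriv T w w') :
    HasTimeDeriv T (fun t => B (u t) (w t)) (fun t => B (u' t) (w t) + B (u t) (w' t)) := by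
  obtain ⟨a, ha⟩ := isCompact_Icc.exists_bound_of_continuousOn (hu.continuousOn hT)
  obtain ⟨b, hb⟩ := isCompact_Icc.exists_bound_of_continuousOn (hw.continuousOn hT)
  have h0 : (0 : ℝ) ∈ Icc 0 T := ⟨le_rfl, hT⟩
  have ha0 : 0 ≤ a := (norm_nonneg _).trans (ha 0 h0)
  have hb0 : 0 ≤ b := (norm_nonneg _).trans (hb 0 h0)
  set U : ℝ → ℝ := fun t => ∫ s in (0 : ℝ)..t, ‖u' s‖
  set W : ℝ → ℝ := fun t => ∫ s in (0 : ℝ)..t, ‖w' s‖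
  have hmono : ∀ s ∈ Icc 0 T, ∀ t ∈ Icc 0 T, |B (u s) (w s) - B (u t) (w t)| ≤
      ‖B‖ * b * |U s - U t| + ‖B‖ * a * |W s - W t| := by
    intro s hs t ht
    have e : B (u s) (w s) - B (u t) (w t) = B (u s - u t) (w s) + B (u t) (w s - w t) := by
      simp
    have h1 : ‖B (u s - u t) (w s)‖ ≤ ‖B‖ * b * |U s - U t| := by
      calc _ ≤ ‖B‖ * ‖u s - u t‖ * ‖w s‖ := B.le_opNorm₂ _ _
        _ ≤ ‖B‖ * |U s - U t| * b := by
          gcongr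
          · exact hu.norm_sub_le hs ht
          · exact hb s hs
        _ = _ := by ring
    have h2 : ‖B (u t) (w s - w t)‖ ≤ ‖B‖ * a * |W s - W t| := by
      calc _ ≤ ‖B‖ * ‖u t‖ * ‖w s - w t‖ := B.le_opNorm₂ _ _
        _ ≤ ‖B‖ * a * |W s - W t| := by
          gcongr
          · exact ha t ht
          · exact hw.norm_sub_le hs ht
    rw [e]
    exact (abs_add_le _ _).trans (add_le_add h1 h2)
  -- The increments of the pairing are at most fixed multiples of those of `U` and `W`. Absolute
  -- continuity follows by squeezing, and the fundamental theorem for real absolutely continuous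
  -- functions becomes available.
  have hAC : AbsolutelyContinuousOnInterval (fun t => B (u t) (w t)) 0 T := by
    have hU := (hu.absolutelyContinuous_variation).const_mul (‖B‖ * b)
    have hW := (hw.absolutelyContinuous_variation).const_mul (‖B‖ * a)
    rw [AbsolutelyContinuousOnInterval] at hU hW ⊢
    refine squeeze_zero' (Filter.Eventually.of_forall fun E => ?_) ?_ (by simpa using hU.add hW)
    · exact Finset.sum_nonneg fun i _ => dist_nonneg
    · rw [Filter.eventually_inf_principal]
      refine Filter.Eventually.of_forall fun E hE => ?_
      rw [← Finset.sum_add_distrib]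
      refine Finset.sum_le_sum fun i hi => ?_
      have hi' := hE.1 i hi
      rw [uIcc_of_le hT] at hi'
      simp only [Real.dist_eq, ← mul_sub, abs_mul, abs_of_nonneg ha0, abs_of_nonneg hb0,
        abs_of_nonneg (norm_nonneg B)]
      exact hmono _ hi'.1 _ hi'.2
  have hderiv : ∀ᵐ t, t ∈ Ioo 0 T →
      HasDerivAt (fun t => B (u t) (w t)) (B (u' t) (w t) + B (u t) (w' t)) t := by
    filter_upwards [hu.ae_hasDerivAt hT, hw.ae_hasDerivAt hT] with t h1 h2 ht
    have h := B.hasFDerivAt_of_bilinear (h1 ht).hasFDerivAt (h2 ht).hasFDerivAt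
    have := h.hasDerivAt
    simpa [add_comm] using this
  have hae : ∀ᵐ t, t ∈ uIoc 0 T →
      deriv (fun t => B (u t) (w t)) t = B (u' t) (w t) + B (u t) (w' t) := by
    have hne : ∀ᵐ t : ℝ, t ≠ T := by simp [ae_iff, measure_singleton]
    filter_upwards [hderiv, hne] with t ht hne htm
    rw [uIoc_of_le hT] at htm
    exact (ht ⟨htm.1, lt_of_le_of_ne htm.2 hne⟩).deriv
  refine ⟨hAC.intervalIntegrable_deriv.congr_ae ?_, fun t ht => ?_⟩
  · rw [Filter.EventuallyEq, ae_restrict_iff' measurableSet_uIoc]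
    exact hae
  · have hsub : uIcc 0 t ⊆ uIcc 0 T := by
      rw [uIcc_of_le ht.1, uIcc_of_le hT]; exact Icc_subset_Icc_right ht.2
    have h := (hAC.mono hsub).integral_deriv_eq_sub
    rw [intervalIntegral.integral_congr_ae (g := fun t => B (u' t) (w t) + B (u t) (w' t))] at h
    · linarith
    · filter_upwards [hae] with r hr hrm
      refine hr ?_
      rw [uIoc_of_le ht.1] at hrm
      rw [uIoc_of_le hT]
      exact ⟨hrm.1, hrm.2.trans ht.2⟩

theorem HasTimeDeriv.mul {u u' w w' : ℝ → ℝ} (hT : 0 ≤ T) (hu : HasTimeDeriv T u u')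
    (hw : HasTimeDeriv T w w') :
    HasTimeDeriv T (fun t => u t * w t) (fun t => u' t * w t + u t * w' t) := by
  simpa using HasTimeDeriv.bilin (ContinuousLinearMap.mul ℝ ℝ) hT hu hw

theorem HasTimeDeriv.norm_sq {Z : Type*} [NormedAddCommGroup Z] [InnerProductSpace ℝ Z]
    [CompleteSpace Z] {u u' : ℝ → Z} (hT : 0 ≤ T) (hu : HasTimeDeriv T u u') :
    HasTimeDeriv T (fun t => ‖u t‖ ^ 2) (fun t => 2 * ⟪u' t, u t⟫_ℝ) := by
  have h := HasTimeDeriv.bilin (innerSL ℝ) hT hu hu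
  convert h using 2 with t t
  · rw [innerSL_apply_apply, real_inner_self_eq_norm_sq]
  · rw [innerSL_apply_apply, innerSL_apply_apply, real_inner_comm (u' t)]; ring

theorem HasTimeDeriv.congr_path {w : ℝ → X} (hT : 0 ≤ T) (hu : HasTimeDeriv T u u')
    (h : ∀ t ∈ Icc 0 T, w t = u t) : HasTimeDeriv T w u' :=
  ⟨hu.1, fun t ht => by rw [h t ht, h 0 ⟨le_rfl, hT⟩, hu.2 t ht]⟩

/-- The time derivative of a path is determined almost everywhere. -/
theorem HasTimeDeriv.ae_eq [CompleteSpace X] {w w' : ℝ → X} (hT : 0 ≤ T)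
    (hu : HasTimeDeriv T u u') (hw : HasTimeDeriv T w w') (h : ∀ t ∈ Icc 0 T, u t = w t) :
    ∀ᵐ t ∂(volume.restrict (Icc 0 T)), u' t = w' t := by
  rw [restrict_Ioo_eq_restrict_Icc.symm, ae_restrict_iff' measurableSet_Ioo]
  filter_upwards [hu.ae_hasDerivAt hT, (hw.congr_path hT h).ae_hasDerivAt hT] with t h1 h2 ht
  exact (h1 ht).unique (h2 ht)

/-- The exponential of the primitive of a continuous function. -/
theorem hasTimeDeriv_exp {a : ℝ → ℝ} (ha : Continuous a) (T : ℝ) :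
    HasTimeDeriv T (fun t => Real.exp (∫ s in (0 : ℝ)..t, a s))
      (fun t => a t * Real.exp (∫ s in (0 : ℝ)..t, a s)) := by
  have hd : ∀ t, HasDerivAt (fun t => Real.exp (∫ s in (0 : ℝ)..t, a s))
      (a t * Real.exp (∫ s in (0 : ℝ)..t, a s)) t := fun t => by
    have := (intervalIntegral.integral_hasDerivAt_right (ha.intervalIntegrable 0 t)
      ha.stronglyMeasurable.stronglyMeasurableAtFilter ha.continuousAt).exp
    rwa [mul_comm] at this
  have hc : Continuous (fun t => a t * Real.exp (∫ s in (0 : ℝ)..t, a s)) := by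
    have : Continuous (fun t => ∫ s in (0 : ℝ)..t, a s) :=
      intervalIntegral.continuous_primitive (fun a b => ha.intervalIntegrable a b) 0
    fun_prop
  refine ⟨hc.intervalIntegrable _ _, fun t _ => ?_⟩
  rw [intervalIntegral.integral_eq_sub_of_hasDerivAt (fun x _ => hd x) (hc.intervalIntegrable _ _)]
  ring

/-- Gronwall's inequality for absolutely continuous functions, with a dissipative term `g`. -/
theorem HasTimeDeriv.gronwall {y y' a g F : ℝ → ℝ} (hT : 0 ≤ T) (hy : HasTimeDeriv T y y')
    (ha : ContinuousOn a (Icc 0 T)) (ha0 : ∀ t ∈ Icc 0 T, 0 ≤ a t)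
    (hg : IntegrableOn g (Icc 0 T)) (hg0 : ∀ t ∈ Icc 0 T, 0 ≤ g t)
    (hF : IntegrableOn F (Icc 0 T)) (hF0 : ∀ t ∈ Icc 0 T, 0 ≤ F t)
    (hy0 : ∀ t ∈ Icc 0 T, 0 ≤ y t)
    (h : ∀ᵐ t ∂(volume.restrict (Icc 0 T)), y' t + g t ≤ a t * y t + F t) :
    ∀ t ∈ Icc 0 T, y t + ∫ s in (0 : ℝ)..t, g s ≤
      Real.exp (∫ s in (0 : ℝ)..T, a s) * (y 0 + ∫ s in (0 : ℝ)..T, F s) := by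
  intro t ht
  -- Extending `a` by its endpoint values makes it continuous on the line, so the integrating factor
  -- is differentiable everywhere.
  set b : ℝ → ℝ := IccExtend hT ((Icc 0 T).domRestrict a) with hb
  have hbc : Continuous b := ha.domRestrict.Icc_extend'
  have hba : ∀ s ∈ Icc 0 T, b s = a s := fun s hs => by
    rw [hb, IccExtend_of_mem _ _ hs]; rfl
  have hb0 : ∀ s, 0 ≤ b s := fun s => ha0 _ (projIcc 0 T hT s).2
  have hE := hasTimeDeriv_exp (a := fun s => - b s) (by fun_prop) T
  set E : ℝ → ℝ := fun t => Real.exp (∫ s in (0 : ℝ)..t, - b s) with hEdef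
  have hE0 : ∀ s, 0 < E s := fun s => Real.exp_pos _
  have hI : ∀ s ∈ Icc 0 T, ∫ r in (0 : ℝ)..s, b r ≤ ∫ r in (0 : ℝ)..T, b r := fun s hs =>
    intervalIntegral.integral_mono_interval le_rfl hs.1 hs.2
      (Filter.Eventually.of_forall hb0) (hbc.intervalIntegrable _ _)
  -- This bound drops the integrating factor from `F`; the reverse bound `1 ≤ Λ * E` later restores
  -- `y` and `g`.
  have hE1 : ∀ s ∈ Icc 0 T, E s ≤ 1 := fun s hs => by
    rw [hEdef]
    simp only [intervalIntegral.integral_neg]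
    rw [Real.exp_le_one_iff]
    have := intervalIntegral.integral_nonneg (μ := volume) hs.1 (fun r (_ : r ∈ Icc 0 s) => hb0 r)
    linarith
  set Λ := Real.exp (∫ s in (0 : ℝ)..T, a s) with hΛ
  have hΛb : Λ = Real.exp (∫ s in (0 : ℝ)..T, b s) := by
    rw [hΛ]; congr 1
    refine intervalIntegral.integral_congr fun s hs => ?_
    rw [uIcc_of_le hT] at hs
    exact (hba s hs).symm
  have hΛE : ∀ s ∈ Icc 0 T, 1 ≤ Λ * E s := fun s hs => by
    rw [hΛb, hEdef]
    simp only [intervalIntegral.integral_neg, ← Real.exp_add]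
    rw [Real.one_le_exp_iff]
    linarith [hI s hs]
  have hyE := HasTimeDeriv.mul hT hy hE
  have hEcont : Continuous E := by
    have : Continuous (fun t => ∫ s in (0 : ℝ)..t, - b s) :=
      intervalIntegral.continuous_primitive
        (fun a b => (hbc.neg).intervalIntegrable a b) 0
    exact Real.continuous_exp.comp this
  have h0 : (0 : ℝ) ∈ Icc 0 T := ⟨le_rfl, hT⟩
  have hgi : ∀ s ∈ Icc 0 T, IntervalIntegrable g volume 0 s := fun s hs => by
    rw [intervalIntegrable_iff_integrableOn_Icc_of_le hs.1]
    exact hg.mono_set (Icc_subset_Icc_right hs.2)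
  have hFi : ∀ s ∈ Icc 0 T, IntervalIntegrable F volume 0 s := fun s hs => by
    rw [intervalIntegrable_iff_integrableOn_Icc_of_le hs.1]
    exact hF.mono_set (Icc_subset_Icc_right hs.2)
  have key : (y t * E t - y 0) + ∫ s in (0 : ℝ)..t, g s * E s ≤ ∫ s in (0 : ℝ)..t, F s := by
    have e := hyE.2 t ht
    have hE00 : E 0 = 1 := by simp [hEdef]
    have e' : y t * E t - y 0 = ∫ s in (0 : ℝ)..t, (y' s * E s + y s * (-b s * E s)) := by
      have : y t * E t = y 0 * E 0 + _ := e
      rw [this, hE00, mul_one, add_sub_cancel_left]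
    rw [e', ← intervalIntegral.integral_add (hyE.intervalIntegrable h0 ht)
      ((hgi t ht).mul_continuousOn hEcont.continuousOn)]
    refine intervalIntegral.integral_mono_ae_restrict ht.1 ?_ (hFi t ht) ?_
    · exact (hyE.intervalIntegrable h0 ht).add ((hgi t ht).mul_continuousOn hEcont.continuousOn)
    · have h' := ae_restrict_of_ae_restrict_of_subset (Icc_subset_Icc_right ht.2) h
      filter_upwards [h', ae_restrict_mem measurableSet_Icc] with s hs hsm
      have hsT : s ∈ Icc 0 T := ⟨hsm.1, hsm.2.trans ht.2⟩
      have := hba s hsT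
      calc y' s * E s + y s * (-b s * E s) + g s * E s = (y' s + g s - a s * y s) * E s := by
            rw [this]; ring
        _ ≤ F s * E s := by
            apply mul_le_mul_of_nonneg_right _ (hE0 s).le
            linarith
        _ ≤ F s * 1 := mul_le_mul_of_nonneg_left (hE1 s hsT) (hF0 s hsT)
        _ = F s := mul_one _
  have hFle : ∫ s in (0 : ℝ)..t, F s ≤ ∫ s in (0 : ℝ)..T, F s := by
    refine intervalIntegral.integral_mono_interval le_rfl ht.1 ht.2 ?_ (hFi T ⟨hT, le_rfl⟩)
    filter_upwards [ae_restrict_mem measurableSet_Ioc] with s hs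
    exact hF0 s (Ioc_subset_Icc_self hs)
  have hgle : ∫ s in (0 : ℝ)..t, g s ≤ Λ * ∫ s in (0 : ℝ)..t, g s * E s := by
    rw [← intervalIntegral.integral_const_mul]
    refine intervalIntegral.integral_mono_on ht.1 (hgi t ht)
      (((hgi t ht).mul_continuousOn hEcont.continuousOn).const_mul _) fun s hs => ?_
    have hsT : s ∈ Icc 0 T := ⟨hs.1, hs.2.trans ht.2⟩
    nlinarith [hΛE s hsT, hg0 s hsT]
  have hyle : y t ≤ Λ * (y t * E t) := by nlinarith [hΛE t ht, hy0 t ht]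
  have hΛ0 : 0 < Λ := Real.exp_pos _
  nlinarith

/-- A solution of a homogeneous linear scalar equation is an exponential. -/
theorem HasTimeDeriv.eq_mul_exp {y y' a : ℝ → ℝ} (hT : 0 ≤ T) (hy : HasTimeDeriv T y y')
    (ha : ContinuousOn a (Icc 0 T))
    (h : ∀ᵐ t ∂(volume.restrict (Icc 0 T)), y' t = a t * y t) :
    ∀ t ∈ Icc 0 T, y t = y 0 * Real.exp (∫ s in (0 : ℝ)..t, a s) := by
  intro t ht
  set b : ℝ → ℝ := IccExtend hT ((Icc 0 T).domRestrict a) with hb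
  have hbc : Continuous b := ha.domRestrict.Icc_extend'
  have hba : ∀ s ∈ Icc 0 T, b s = a s := fun s hs => by
    rw [hb, IccExtend_of_mem _ _ hs]; rfl
  have hE := hasTimeDeriv_exp (a := fun s => - b s) (by fun_prop) T
  have hyE := (HasTimeDeriv.mul hT hy hE).2 t ht
  -- The product of `y` with the inverse exponential has zero derivative almost everywhere, hence is
  -- constant.
  have hz : ∫ s in (0 : ℝ)..t, (y' s * Real.exp (∫ r in (0 : ℝ)..s, -b r)
      + y s * (-b s * Real.exp (∫ r in (0 : ℝ)..s, -b r))) = ∫ s in (0 : ℝ)..t, (0 : ℝ) := by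
    refine intervalIntegral.integral_congr_ae_restrict ?_
    rw [uIoc_of_le ht.1]
    have h' := ae_restrict_of_ae_restrict_of_subset
      ((Ioc_subset_Icc_self).trans (Icc_subset_Icc_right ht.2)) h
    filter_upwards [h', ae_restrict_mem measurableSet_Ioc] with s hs hsm
    rw [hs, hba s ⟨hsm.1.le, hsm.2.trans ht.2⟩]
    ring
  dsimp only at hyE
  rw [hz] at hyE
  simp only [intervalIntegral.integral_same, Real.exp_zero, mul_one,
    intervalIntegral.integral_zero, add_zero, intervalIntegral.integral_neg] at hyE
  have e : ∫ s in (0 : ℝ)..t, a s = ∫ s in (0 : ℝ)..t, b s := by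
    refine intervalIntegral.integral_congr fun s hs => ?_
    rw [uIcc_of_le ht.1] at hs
    exact (hba s ⟨hs.1, hs.2.trans ht.2⟩).symm
  rw [e, ← hyE, mul_assoc, ← Real.exp_add]
  simp

end TimeCalculus

/-! ### Abstract flow problem, energy estimate and a priori bounds. -/

/-- The bilinear and trilinear forms of an incompressible flow problem with a turbulent viscosity,
together with the inequalities used in energy estimates: `val` and `grad` are the embedding into
the pivot space and the gradient, `visc` is the weighted gradient form, `conv` the skew-symmetric
convective form, and `div` the pairing of the divergence with a pressure. -/
structure FlowForms (H L G P : Type*) [NormedAddCommGroup H] [InnerProductSpace ℝ H]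
    [NormedAddCommGroup L] [InnerProductSpace ℝ L] [NormedAddCommGroup G] [InnerProductSpace ℝ G]
    [NormedAddCommGroup P] [NormedSpace ℝ P] where
  val : H →L[ℝ] L
  grad : H →L[ℝ] G
  visc : H →L[ℝ] H →L[ℝ] ℝ
  conv : H →ₗ[ℝ] H →ₗ[ℝ] H →ₗ[ℝ] ℝ
  div : H →ₗ[ℝ] P →ₗ[ℝ] ℝ
  poincare : ℝ
  viscBound : ℝ
  convBound : ℝ
  divBound : ℝ
  poincare_nonneg : 0 ≤ poincare
  viscBound_nonneg : 0 ≤ viscBound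
  convBound_nonneg : 0 ≤ convBound
  norm_sq_eq : ∀ u, ‖u‖ ^ 2 = ‖val u‖ ^ 2 + ‖grad u‖ ^ 2
  norm_val_le : ∀ u, ‖val u‖ ≤ poincare * ‖grad u‖
  val_injective : Function.Injective val
  visc_symm : ∀ u w, visc u w = visc w u
  visc_nonneg : ∀ u, 0 ≤ visc u u
  abs_visc_le : ∀ u w, |visc u w| ≤ viscBound * ‖grad u‖ * ‖grad w‖
  conv_self : ∀ u w, conv u w w = 0
  abs_conv_le : ∀ u w z, |conv u w z| ≤ convBound * ‖grad u‖ * ‖grad w‖ * ‖grad z‖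
  abs_conv_self_le : ∀ ε > 0, ∃ C, 0 ≤ C ∧ ∀ u w,
    |conv u w u| ≤ ‖grad w‖ * (ε * ‖grad u‖ ^ 2 + C * ‖val u‖ ^ 2)
  abs_div_le : ∀ u p, |div u p| ≤ divBound * ‖grad u‖ * ‖p‖

variable {H L G P : Type*} [NormedAddCommGroup H] [InnerProductSpace ℝ H]
    [NormedAddCommGroup L] [InnerProductSpace ℝ L] [NormedAddCommGroup G] [InnerProductSpace ℝ G]
    [NormedAddCommGroup P] [NormedSpace ℝ P]

namespace FlowForms

variable (𝓕 : FlowForms H L G P)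

/-- The turbulence-model system tested on a subspace `W`, with viscosity `ν`, relaxation rate `c`
and production coefficient `γ`. -/
structure IsSolution (ν c γ T : ℝ) (f : ℝ → StrongDual ℝ H) (W : Submodule ℝ H)
    (v v' : ℝ → H) (q : ℝ → P) (k k' : ℝ → ℝ) : Prop where
  deriv_v : HasTimeDeriv T v v'
  deriv_k : HasTimeDeriv T k k'
  mem : ∀ t ∈ Icc 0 T, v t ∈ W
  momentum : ∀ᵐ t ∂(volume.restrict (Icc 0 T)), ∀ w ∈ W,
    ⟪𝓕.val (v' t), 𝓕.val w⟫_ℝ + ν * ⟪𝓕.grad (v t), 𝓕.grad w⟫_ℝ + k t * 𝓕.visc (v t) w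
      + 𝓕.conv (v t) (v t) w - 𝓕.div w (q t) = f t w
  kEquation : ∀ᵐ t ∂(volume.restrict (Icc 0 T)),
    k' t + c * k t = γ * (k t * 𝓕.visc (v t) (v t))

variable {𝓕} {ν c γ T : ℝ} {f : ℝ → StrongDual ℝ H} {W : Submodule ℝ H}
    {v v' : ℝ → H} {q : ℝ → P} {k k' : ℝ → ℝ}

theorem norm_le (u : H) : ‖u‖ ≤ (1 + 𝓕.poincare) * ‖𝓕.grad u‖ := by
  refine abs_le_of_sq_le_sq' ?_ (mul_nonneg (by linarith [𝓕.poincare_nonneg]) (norm_nonneg _)) |>.2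
  have h1 := 𝓕.norm_val_le u
  have h2 := 𝓕.norm_sq_eq u
  have h3 := pow_le_pow_left₀ (norm_nonneg _) h1 2
  have : 0 ≤ 𝓕.poincare * ‖𝓕.grad u‖ ^ 2 := mul_nonneg 𝓕.poincare_nonneg (sq_nonneg _)
  nlinarith

theorem IsSolution.continuousOn_visc (h : 𝓕.IsSolution ν c γ T f W v v' q k k') (hT : 0 ≤ T) :
    ContinuousOn (fun t => 𝓕.visc (v t) (v t)) (Icc 0 T) := by
  have := h.deriv_v.continuousOn hT
  exact (𝓕.visc.continuous.comp_continuousOn this).clm_apply this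

theorem IsSolution.continuousOn_grad (h : 𝓕.IsSolution ν c γ T f W v v' q k k') (hT : 0 ≤ T) :
    ContinuousOn (fun t => 𝓕.grad (v t)) (Icc 0 T) := by
  exact 𝓕.grad.continuous.comp_continuousOn (h.deriv_v.continuousOn hT)

/-- With the velocity given, the `k`-equation is the scalar linear equation `k' = (γ * visc v v - c)
* k`. The formula preserves the sign of `k` and reduces an upper bound to a bound for `∫‖∇v‖²`. -/
theorem IsSolution.k_eq (h : 𝓕.IsSolution ν c γ T f W v v' q k k') (hT : 0 ≤ T) :
    ∀ t ∈ Icc 0 T, k t = k 0 * Real.exp (∫ s in (0 : ℝ)..t, (γ * 𝓕.visc (v s) (v s) - c)) := by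
  refine h.deriv_k.eq_mul_exp hT ?_ ?_
  · exact ((h.continuousOn_visc hT).const_mul γ |>.sub continuousOn_const)
  · filter_upwards [h.kEquation] with t ht
    linarith

theorem IsSolution.k_nonneg (h : 𝓕.IsSolution ν c γ T f W v v' q k k') (hT : 0 ≤ T)
    (hk : 0 ≤ k 0) : ∀ t ∈ Icc 0 T, 0 ≤ k t := fun t ht => by
  rw [h.k_eq hT t ht]
  exact mul_nonneg hk (Real.exp_pos _).le

theorem integrableOn_norm_sq {E : Type*} [NormedAddCommGroup E] {g : ℝ → E} {s : Set ℝ}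
    (hg : MemLp g 2 (volume.restrict s)) : IntegrableOn (fun t => ‖g t‖ ^ 2) s :=
  (memLp_two_iff_integrable_sq_norm hg.1).1 hg

/-- The energy estimate. -/
theorem IsSolution.energy [CompleteSpace H] [CompleteSpace L]
    (h : 𝓕.IsSolution ν c γ T f W v v' q k k') (hν : 0 < ν)
    (hT : 0 ≤ T) (hk : 0 ≤ k 0) (hf : MemLp f 2 (volume.restrict (Icc 0 T)))
    (hdiv : ∀ t ∈ Icc 0 T, 𝓕.div (v t) (q t) = 0) :
    ∀ t ∈ Icc 0 T, ‖𝓕.val (v t)‖ ^ 2 + ∫ s in (0 : ℝ)..t, ν * ‖𝓕.grad (v s)‖ ^ 2 ≤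
      ‖𝓕.val (v 0)‖ ^ 2 + ν⁻¹ * (1 + 𝓕.poincare) ^ 2 * ∫ s in (0 : ℝ)..T, ‖f s‖ ^ 2 := by
  intro t ht
  have hy := (h.deriv_v.map 𝓕.val).norm_sq hT
  have hg := h.continuousOn_grad hT
  -- Gronwall with zero rate is integration in time, with exponential factor one.
  have key := hy.gronwall (a := fun _ => 0) (g := fun s => ν * ‖𝓕.grad (v s)‖ ^ 2)
    (F := fun s => ν⁻¹ * (1 + 𝓕.poincare) ^ 2 * ‖f s‖ ^ 2) hT continuousOn_const
    (fun _ _ => le_rfl) ((hg.norm.pow 2).const_mul ν).integrableOn_Icc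
    (fun _ _ => by positivity) ((integrableOn_norm_sq hf).const_mul _)
    (fun _ _ => by positivity) (fun _ _ => by positivity) ?_ t ht
  · simpa using key
  · filter_upwards [h.momentum, ae_restrict_mem measurableSet_Icc] with s hs hsm
    -- Tested with the velocity itself, convection vanishes by skew-symmetry and the pressure by
    -- `hdiv`. The turbulent viscosity has a good sign and is dropped.
    have e := hs (v s) (h.mem s hsm)
    rw [𝓕.conv_self, hdiv s hsm, real_inner_self_eq_norm_sq] at e
    have h1 : 0 ≤ k s * 𝓕.visc (v s) (v s) :=
      mul_nonneg (h.k_nonneg hT hk s hsm) (𝓕.visc_nonneg _)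
    have h2 : f s (v s) ≤ ‖f s‖ * ((1 + 𝓕.poincare) * ‖𝓕.grad (v s)‖) :=
      ((le_abs_self _).trans ((f s).le_opNorm _)).trans
        (mul_le_mul_of_nonneg_left (norm_le _) (norm_nonneg _))
    have h3 : 2 * (‖f s‖ * ((1 + 𝓕.poincare) * ‖𝓕.grad (v s)‖)) ≤
        ν * ‖𝓕.grad (v s)‖ ^ 2 + ν⁻¹ * (1 + 𝓕.poincare) ^ 2 * ‖f s‖ ^ 2 := by
      have : 0 ≤ ν⁻¹ * (ν * ‖𝓕.grad (v s)‖ - (1 + 𝓕.poincare) * ‖f s‖) ^ 2 := by positivity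
      have e : ν⁻¹ * (ν * ‖𝓕.grad (v s)‖ - (1 + 𝓕.poincare) * ‖f s‖) ^ 2 =
        ν * ‖𝓕.grad (v s)‖ ^ 2 + ν⁻¹ * (1 + 𝓕.poincare) ^ 2 * ‖f s‖ ^ 2
        - 2 * (‖f s‖ * ((1 + 𝓕.poincare) * ‖𝓕.grad (v s)‖)) := by
        field_simp; ring
      linarith
    nlinarith

/-- A priori bounds for the gradient and the turbulent kinetic energy, depending only on bounds
for the data. -/
theorem IsSolution.a_priori [CompleteSpace H] [CompleteSpace L]
    (h : 𝓕.IsSolution ν c γ T f W v v' q k k') (hν : 0 < ν) (hc : 0 ≤ c) (hγ : 0 ≤ γ)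
    (hT : 0 ≤ T) (hk : 0 ≤ k 0) (hf : MemLp f 2 (volume.restrict (Icc 0 T)))
    (hdiv : ∀ t ∈ Icc 0 T, 𝓕.div (v t) (q t) = 0) {R E : ℝ} (hv0 : ‖𝓕.val (v 0)‖ ≤ R)
    (hk0 : k 0 ≤ R)
    (hE : ν⁻¹ * (R ^ 2 + ν⁻¹ * (1 + 𝓕.poincare) ^ 2 * ∫ s in (0 : ℝ)..T, ‖f s‖ ^ 2) ≤ E) :
    (∫ s in (0 : ℝ)..T, ‖𝓕.grad (v s)‖ ^ 2 ≤ E) ∧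
      ∀ t ∈ Icc 0 T, k t ≤ R * Real.exp (γ * 𝓕.viscBound * E) := by
  have hg := h.continuousOn_grad hT
  have hgT : ∫ s in (0 : ℝ)..T, ‖𝓕.grad (v s)‖ ^ 2 ≤ E := by
    have h1 := h.energy hν hT hk hf hdiv T ⟨hT, le_rfl⟩
    rw [intervalIntegral.integral_const_mul] at h1
    have h2 : ‖𝓕.val (v 0)‖ ^ 2 ≤ R ^ 2 := pow_le_pow_left₀ (norm_nonneg _) hv0 2
    refine le_trans ?_ hE
    rw [le_inv_mul_iff₀ hν]
    nlinarith [sq_nonneg ‖𝓕.val (v T)‖]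
  refine ⟨hgT, fun t ht => ?_⟩
  rw [h.k_eq hT t ht]
  have hR : 0 ≤ R := hk.trans hk0
  refine mul_le_mul hk0 (Real.exp_le_exp.2 ?_) (Real.exp_pos _).le hR
  have hgt : IntervalIntegrable (fun s => ‖𝓕.grad (v s)‖ ^ 2) volume 0 t := by
    refine ContinuousOn.intervalIntegrable ?_
    rw [uIcc_of_le ht.1]
    exact (hg.norm.pow 2).mono (Icc_subset_Icc_right ht.2)
  have hgT' : IntervalIntegrable (fun s => ‖𝓕.grad (v s)‖ ^ 2) volume 0 T := by
    refine ContinuousOn.intervalIntegrable ?_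
    rw [uIcc_of_le hT]
    exact hg.norm.pow 2
  calc ∫ s in (0 : ℝ)..t, (γ * 𝓕.visc (v s) (v s) - c)
      ≤ ∫ s in (0 : ℝ)..t, γ * 𝓕.viscBound * ‖𝓕.grad (v s)‖ ^ 2 := by
        refine intervalIntegral.integral_mono_on ht.1 ?_ (hgt.const_mul _) fun s _ => ?_
        · refine ContinuousOn.intervalIntegrable ?_
          rw [uIcc_of_le ht.1]
          exact (((h.continuousOn_visc hT).const_mul γ).sub continuousOn_const).mono
            (Icc_subset_Icc_right ht.2)
        · have := (le_abs_self _).trans (𝓕.abs_visc_le (v s) (v s))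
          nlinarith
    _ = γ * 𝓕.viscBound * ∫ s in (0 : ℝ)..t, ‖𝓕.grad (v s)‖ ^ 2 :=
        intervalIntegral.integral_const_mul _ _
    _ ≤ γ * 𝓕.viscBound * ∫ s in (0 : ℝ)..T, ‖𝓕.grad (v s)‖ ^ 2 := by
        refine mul_le_mul_of_nonneg_left ?_ (mul_nonneg hγ 𝓕.viscBound_nonneg)
        exact intervalIntegral.integral_mono_interval le_rfl ht.1 ht.2
          (Filter.Eventually.of_forall fun s => sq_nonneg _) hgT'
    _ ≤ γ * 𝓕.viscBound * E :=
        mul_le_mul_of_nonneg_left hgT (mul_nonneg hγ 𝓕.viscBound_nonneg)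

end FlowForms

/-! ### Error estimate against a comparison path with bounded gradient. -/

theorem two_mul_le_add_sq_div {ν : ℝ} (hν : 0 < ν) (a x : ℝ) :
    2 * (a * x) ≤ ν / 8 * x ^ 2 + 8 / ν * a ^ 2 := by
  have : 0 ≤ 8 / ν * (ν / 8 * x - a) ^ 2 := by positivity
  have e : 8 / ν * (ν / 8 * x - a) ^ 2 = ν / 8 * x ^ 2 + 8 / ν * a ^ 2 - 2 * (a * x) := by
    field_simp; ring
  linarith

/-- The absorption of the error terms by the dissipation. -/
theorem exists_absorption_constant {ν : ℝ} (hν : 0 < ν) {m N B K d γ A : ℝ} (hm : 0 ≤ m)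
    (hB : 0 ≤ B) (hγ : 0 ≤ γ) (hA : 0 ≤ A) :
    ∃ C, 0 ≤ C ∧ ∀ x z r κ y l : ℝ, 0 ≤ x → 0 ≤ z → 0 ≤ r → 0 ≤ κ → 0 ≤ y → 0 ≤ l →
      2 * (m * B * κ * x + K * m * z * x + 2 * (N * B * z * x)
          + B * (ν / (16 * (B + 1)) * x ^ 2 + A * y ^ 2) + d * x * r
          + γ * (m * B ^ 2 * κ ^ 2 + K * m * κ * (z + x) * (B + l)))
        ≤ ν * x ^ 2 + C * (1 + l ^ 2) * (y ^ 2 + κ ^ 2) + C * (z ^ 2 + r ^ 2) := by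
  -- In the application `x = ‖∇(v_h - w)‖`, `z = ‖∇(v - w)‖`, `r = ‖q - p‖`, `κ = |k - k_h|`, `y =
  -- ‖v_h - w‖` and `l = ‖∇v_h‖`. The constant `c₁` collects the coefficients of the Gronwall
  -- quantity and `c₂` those of the approximation errors. Five terms are each charged `ν / 8` of the
  -- dissipation, which stays below `ν`.
  obtain ⟨c₁, hc₁⟩ : ∃ c₁, c₁ = 8 / ν * (m * B) ^ 2 + 2 * γ * m * B ^ 2 +
    (8 / ν + 1) * (γ * K * m) ^ 2 * (2 * (B ^ 2 + 1)) + 2 * B * A := ⟨_, rfl⟩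
  obtain ⟨c₂, hc₂⟩ : ∃ c₂, c₂ = 8 / ν * (K * m + 2 * N * B) ^ 2 + 1 + 8 / ν * d ^ 2 := ⟨_, rfl⟩
  have hc₁0 : 0 ≤ c₁ := by rw [hc₁]; positivity
  have hc₂0 : 0 ≤ c₂ := by rw [hc₂]; positivity
  refine ⟨c₁ + c₂, by positivity, fun x z r κ y l hx hz hr hκ hy hl => ?_⟩
  have t1 := two_mul_le_add_sq_div hν (m * B * κ) x
  have t2 := two_mul_le_add_sq_div hν ((K * m + 2 * N * B) * z) x
  have t4 := two_mul_le_add_sq_div hν (d * r) x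
  have t6 := two_mul_le_add_sq_div hν (γ * K * m * κ * (B + l)) x
  have t7 : 2 * (γ * K * m * κ * (B + l) * z) ≤ z ^ 2 + (γ * K * m * κ * (B + l)) ^ 2 := by
    have := two_mul_le_add_sq (γ * K * m * κ * (B + l)) z
    linarith
  have t3 : 2 * (B * (ν / (16 * (B + 1)) * x ^ 2)) ≤ ν / 8 * x ^ 2 := by
    have : 2 * (B * (ν / (16 * (B + 1)) * x ^ 2)) = ν / 8 * x ^ 2 * (B / (B + 1)) := by
      field_simp; ring
    rw [this]
    refine mul_le_of_le_one_right (by positivity) ?_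
    rw [div_le_one (by positivity)]; linarith
  -- This is the origin of the weight `1 + l ^ 2`: `l` is bounded only in the square mean over time,
  -- so it has to go into the Gronwall rate.
  have hl2 : (B + l) ^ 2 ≤ 2 * (B ^ 2 + 1) * (1 + l ^ 2) := by
    have h1 := sq_nonneg (B - l)
    have h2 := mul_nonneg (sq_nonneg B) (sq_nonneg l)
    have e : 2 * (B ^ 2 + 1) * (1 + l ^ 2) = (B + l) ^ 2 + (B - l) ^ 2 + 2 * (B ^ 2 * l ^ 2) + 2 := by
      ring
    rw [e]
    linarith
  have t8 : (8 / ν + 1) * (γ * K * m * κ * (B + l)) ^ 2 ≤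
      (8 / ν + 1) * (γ * K * m) ^ 2 * (2 * (B ^ 2 + 1)) * (1 + l ^ 2) * κ ^ 2 := by
    calc (8 / ν + 1) * (γ * K * m * κ * (B + l)) ^ 2
        = (8 / ν + 1) * (γ * K * m) ^ 2 * κ ^ 2 * (B + l) ^ 2 := by ring
      _ ≤ (8 / ν + 1) * (γ * K * m) ^ 2 * κ ^ 2 * (2 * (B ^ 2 + 1) * (1 + l ^ 2)) := by gcongr
      _ = _ := by ring
  have hone : ∀ a : ℝ, 0 ≤ a → a ≤ a * (1 + l ^ 2) := fun a ha =>
    le_mul_of_one_le_right ha (le_add_of_nonneg_right (sq_nonneg l))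
  have t9 : 8 / ν * (m * B * κ) ^ 2 + 2 * γ * m * B ^ 2 * κ ^ 2 + 2 * B * A * y ^ 2
      + (8 / ν + 1) * (γ * K * m * κ * (B + l)) ^ 2 ≤ c₁ * (1 + l ^ 2) * (y ^ 2 + κ ^ 2) := by
    have e : c₁ * (1 + l ^ 2) * (y ^ 2 + κ ^ 2) =
        (8 / ν * (m * B * κ) ^ 2) * (1 + l ^ 2) + (2 * γ * m * B ^ 2 * κ ^ 2) * (1 + l ^ 2)
        + (2 * B * A * y ^ 2) * (1 + l ^ 2)
        + (8 / ν + 1) * (γ * K * m) ^ 2 * (2 * (B ^ 2 + 1)) * (1 + l ^ 2) * κ ^ 2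
        + (8 / ν * (m * B) ^ 2 + 2 * γ * m * B ^ 2 +
          (8 / ν + 1) * (γ * K * m) ^ 2 * (2 * (B ^ 2 + 1))) * (1 + l ^ 2) * y ^ 2
        + 2 * B * A * (1 + l ^ 2) * κ ^ 2 := by rw [hc₁]; ring
    have u4 : 0 ≤ (8 / ν * (m * B) ^ 2 + 2 * γ * m * B ^ 2 +
      (8 / ν + 1) * (γ * K * m) ^ 2 * (2 * (B ^ 2 + 1))) * (1 + l ^ 2) * y ^ 2 := by positivity
    have u5 : 0 ≤ 2 * B * A * (1 + l ^ 2) * κ ^ 2 := by positivity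
    rw [e]
    have h := add_le_add (add_le_add (add_le_add (hone (8 / ν * (m * B * κ) ^ 2) (by positivity))
      (hone (2 * γ * m * B ^ 2 * κ ^ 2) (by positivity)))
      (hone (2 * B * A * y ^ 2) (by positivity))) t8
    exact h.trans ((le_add_of_nonneg_right u4).trans (le_add_of_nonneg_right u5))
  have t10 : 0 ≤ c₂ * (1 + l ^ 2) * (y ^ 2 + κ ^ 2) := by positivity
  have t11 : 0 ≤ c₁ * (z ^ 2 + r ^ 2) := by positivity
  have t12 : 8 / ν * ((K * m + 2 * N * B) * z) ^ 2 + z ^ 2 + 8 / ν * (d * r) ^ 2 ≤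
      c₂ * (z ^ 2 + r ^ 2) := by
    have u1 : 0 ≤ (8 / ν * (K * m + 2 * N * B) ^ 2 + 1) * r ^ 2 := by positivity
    have u2 : 0 ≤ 8 / ν * d ^ 2 * z ^ 2 := by positivity
    have e : c₂ * (z ^ 2 + r ^ 2) =
        (8 / ν * ((K * m + 2 * N * B) * z) ^ 2 + z ^ 2 + 8 / ν * (d * r) ^ 2)
        + ((8 / ν * (K * m + 2 * N * B) ^ 2 + 1) * r ^ 2 + 8 / ν * d ^ 2 * z ^ 2) := by
      rw [hc₂]; ring
    rw [e]
    exact le_add_of_nonneg_right (add_nonneg u1 u2)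
  have hx2 : 0 ≤ ν * x ^ 2 := by positivity
  have e : 2 * (m * B * κ * x + K * m * z * x + 2 * (N * B * z * x)
          + B * (ν / (16 * (B + 1)) * x ^ 2 + A * y ^ 2) + d * x * r
          + γ * (m * B ^ 2 * κ ^ 2 + K * m * κ * (z + x) * (B + l)))
      = 2 * (m * B * κ * x) + 2 * ((K * m + 2 * N * B) * z * x)
        + 2 * (B * (ν / (16 * (B + 1)) * x ^ 2)) + 2 * B * A * y ^ 2 + 2 * (d * r * x)
        + 2 * γ * m * B ^ 2 * κ ^ 2 + 2 * (γ * K * m * κ * (B + l) * z)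
        + 2 * (γ * K * m * κ * (B + l) * x) := by ring
  have e2 : (c₁ + c₂) * (1 + l ^ 2) * (y ^ 2 + κ ^ 2) + (c₁ + c₂) * (z ^ 2 + r ^ 2) =
      c₁ * (1 + l ^ 2) * (y ^ 2 + κ ^ 2) + c₂ * (1 + l ^ 2) * (y ^ 2 + κ ^ 2)
      + c₁ * (z ^ 2 + r ^ 2) + c₂ * (z ^ 2 + r ^ 2) := by ring
  rw [e, add_assoc (ν * x ^ 2), e2]
  have e3 : (8 / ν + 1) * (γ * K * m * κ * (B + l)) ^ 2 =
    8 / ν * (γ * K * m * κ * (B + l)) ^ 2 + (γ * K * m * κ * (B + l)) ^ 2 := by ring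
  rw [e3] at t9
  -- With every product turned into an atom, the claim is a linear inequality.
  generalize (γ * K * m * κ * (B + l)) ^ 2 = S at *
  generalize 8 / ν * (m * B * κ) ^ 2 = S₁ at *
  generalize 8 / ν * S = S₂ at *
  generalize 8 / ν * ((K * m + 2 * N * B) * z) ^ 2 = S₃ at *
  generalize 8 / ν * (d * r) ^ 2 = S₄ at *
  generalize c₁ * (1 + l ^ 2) * (y ^ 2 + κ ^ 2) = S₅ at *
  generalize c₂ * (1 + l ^ 2) * (y ^ 2 + κ ^ 2) = S₆ at *
  generalize 2 * (m * B * κ * x) = S₇ at *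
  generalize 2 * ((K * m + 2 * N * B) * z * x) = S₈ at *
  generalize 2 * (B * (ν / (16 * (B + 1)) * x ^ 2)) = S₉ at *
  generalize 2 * (γ * K * m * κ * (B + l) * z) = S₁₀ at *
  generalize 2 * (γ * K * m * κ * (B + l) * x) = S₁₁ at *
  clear e e2 e3 t8 hc₁ hc₂ hone
  linarith

namespace FlowForms

variable (𝓕 : FlowForms H L G P)

/-- The elements of `W` whose divergence is orthogonal to `Q`. -/
def discKer (W : Submodule ℝ H) (Q : Submodule ℝ P) : Submodule ℝ H where
  carrier := {u | u ∈ W ∧ ∀ p ∈ Q, 𝓕.div u p = 0}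
  add_mem' := fun ha hb => ⟨W.add_mem ha.1 hb.1, fun p hp => by
    rw [map_add, LinearMap.add_apply, ha.2 p hp, hb.2 p hp, add_zero]⟩
  zero_mem' := ⟨W.zero_mem, fun p _ => by simp⟩
  smul_mem' := fun c u hu => ⟨W.smul_mem c hu.1, fun p hp => by
    rw [map_smul, LinearMap.smul_apply, hu.2 p hp, smul_zero]⟩

/-- Here `z` is the discrete velocity. Skew-symmetry cancels `conv z (z - w) (z - w)`, so `z` enters
only through `z - w` and never as a coefficient. This matters because its gradient is not bounded
uniformly in time. -/
theorem conv_sub_conv (v w z : H) :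
    𝓕.conv v v (z - w) - 𝓕.conv z z (z - w) =
      𝓕.conv (v - w) v (z - w) + 𝓕.conv w (v - w) (z - w) - 𝓕.conv (z - w) w (z - w) := by
  have h1 := 𝓕.conv_self z (z - w)
  simp only [map_sub, LinearMap.sub_apply] at h1 ⊢
  linarith

variable {𝓕} {ν c γ T : ℝ} {f : ℝ → StrongDual ℝ H}

/-- Two solutions of the momentum equation, on the whole space and on a subspace, tested with the
difference of the discrete velocity and a comparison element. -/
theorem momentum_error {W : Submodule ℝ H} {Q : Submodule ℝ P} {g : StrongDual ℝ H}
    {v v' vh vh' w w' : H} {q qh p : P} {k kh : ℝ}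
    (h : ∀ χ, ⟪𝓕.val v', 𝓕.val χ⟫_ℝ + ν * ⟪𝓕.grad v, 𝓕.grad χ⟫_ℝ + k * 𝓕.visc v χ
      + 𝓕.conv v v χ - 𝓕.div χ q = g χ)
    (hh : ∀ χ ∈ W, ⟪𝓕.val vh', 𝓕.val χ⟫_ℝ + ν * ⟪𝓕.grad vh, 𝓕.grad χ⟫_ℝ + kh * 𝓕.visc vh χ
      + 𝓕.conv vh vh χ - 𝓕.div χ qh = g χ)
    (hw : ∀ χ ∈ 𝓕.discKer W Q, ⟪𝓕.val v' - 𝓕.val w', 𝓕.val χ⟫_ℝ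
      + ν * ⟪𝓕.grad v - 𝓕.grad w, 𝓕.grad χ⟫_ℝ = 0)
    (hqh : qh ∈ Q) (hp : p ∈ Q) (hφ : vh - w ∈ 𝓕.discKer W Q) :
    ⟪𝓕.val vh' - 𝓕.val w', 𝓕.val vh - 𝓕.val w⟫_ℝ =
      - ν * ‖𝓕.grad (vh - w)‖ ^ 2 + (k - kh) * 𝓕.visc v (vh - w)
      + kh * 𝓕.visc (v - w) (vh - w) - kh * 𝓕.visc (vh - w) (vh - w)
      + (𝓕.conv (v - w) v (vh - w) + 𝓕.conv w (v - w) (vh - w) - 𝓕.conv (vh - w) w (vh - w))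
      - 𝓕.div (vh - w) (q - p) := by
  have e1 := h (vh - w)
  have e2 := hh (vh - w) hφ.1
  -- Orthogonality removes both the time derivative and the `ν`-gradient of `v - w`; the turbulent,
  -- convective and pressure errors remain.
  have e3 := hw (vh - w) hφ
  have e4 := hφ.2 qh hqh
  have e5 := hφ.2 p hp
  have e6 := 𝓕.conv_sub_conv v w vh
  rw [← e6]
  rw [← real_inner_self_eq_norm_sq]
  have e7 : 𝓕.visc (v - w) (vh - w) - 𝓕.visc (vh - w) (vh - w)
      = 𝓕.visc v (vh - w) - 𝓕.visc vh (vh - w) := by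
    have : v - w = v - vh + (vh - w) := by abel
    rw [this, map_add, add_apply, add_sub_cancel_right, map_sub 𝓕.visc v vh, sub_apply]
  -- The test element is discretely divergence-free, so any discrete pressure may be subtracted from
  -- `q`.
  have e8 : 𝓕.div (vh - w) (q - p) = 𝓕.div (vh - w) q := by
    rw [map_sub (𝓕.div (vh - w)), e5, sub_zero]
  have e9 : kh * 𝓕.visc (v - w) (vh - w) - kh * 𝓕.visc (vh - w) (vh - w) =
      kh * (𝓕.visc v (vh - w) - 𝓕.visc vh (vh - w)) := by rw [← mul_sub, e7]
  have e10 : ⟪𝓕.grad (vh - w), 𝓕.grad (vh - w)⟫_ℝ = ⟪𝓕.grad vh, 𝓕.grad (vh - w)⟫_ℝ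
      - ⟪𝓕.grad w, 𝓕.grad (vh - w)⟫_ℝ := by
    rw [← inner_sub_left, ← map_sub]
  rw [e8, ← map_sub 𝓕.val vh w, inner_sub_left, e10]
  rw [inner_sub_left, inner_sub_left] at e3
  rw [e4] at e2
  linear_combination e2 - e1 + e3 - e9

variable [CompleteSpace H] [CompleteSpace L]

/-- Error estimate against a comparison path that satisfies the Galerkin orthogonality of the
linear parabolic problem and has a bounded gradient. -/
theorem exists_error_constant (hν : 0 < ν) (hc : 0 ≤ c) (hγ : 0 ≤ γ) (hT : 0 ≤ T)
    (hf : MemLp f 2 (volume.restrict (Icc 0 T))) {R B : ℝ} (hR : 0 ≤ R) (hB : 0 ≤ B) :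
    ∃ C, 0 ≤ C ∧ ∀ {v v' q k k'}, 𝓕.IsSolution ν c γ T f ⊤ v v' q k k' →
      ∀ {W : Submodule ℝ H} {Q : Submodule ℝ P} {vh vh' qh kh kh'},
      𝓕.IsSolution ν c γ T f W vh vh' qh kh kh' → (∀ t ∈ Icc 0 T, qh t ∈ Q) →
      (∀ t ∈ Icc 0 T, vh t ∈ 𝓕.discKer W Q) →
      ‖𝓕.val (vh 0)‖ ≤ R → 0 ≤ kh 0 → kh 0 ≤ R →
      ∀ {w w'}, HasTimeDeriv T w w' → (∀ t ∈ Icc 0 T, w t ∈ 𝓕.discKer W Q) →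
      (∀ᵐ t ∂(volume.restrict (Icc 0 T)), ∀ χ ∈ 𝓕.discKer W Q,
        ⟪𝓕.val (v' t) - 𝓕.val (w' t), 𝓕.val χ⟫_ℝ
          + ν * ⟪𝓕.grad (v t) - 𝓕.grad (w t), 𝓕.grad χ⟫_ℝ = 0) →
      (∀ t ∈ Icc 0 T, ‖𝓕.grad (v t)‖ ≤ B) → (∀ t ∈ Icc 0 T, ‖𝓕.grad (w t)‖ ≤ B) →
      ∀ {p : ℝ → P}, (∀ t ∈ Icc 0 T, p t ∈ Q) →
      IntegrableOn (fun t => ‖q t - p t‖ ^ 2) (Icc 0 T) →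
      ∀ t ∈ Icc 0 T, ‖𝓕.val (vh t) - 𝓕.val (w t)‖ ^ 2 + (k t - kh t) ^ 2
          + ∫ s in (0 : ℝ)..t, ν * ‖𝓕.grad (vh s) - 𝓕.grad (w s)‖ ^ 2
        ≤ C * (‖𝓕.val (vh 0) - 𝓕.val (w 0)‖ ^ 2 + (k 0 - kh 0) ^ 2
          + ∫ s in (0 : ℝ)..T, (‖𝓕.grad (v s) - 𝓕.grad (w s)‖ ^ 2 + ‖q s - p s‖ ^ 2)) := by
  -- `E` bounds `∫‖∇v_h‖²` and `K` bounds `k_h`, both through the data alone.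
  set E := ν⁻¹ * (R ^ 2 + ν⁻¹ * (1 + 𝓕.poincare) ^ 2 * ∫ s in (0 : ℝ)..T, ‖f s‖ ^ 2) with hE
  set K := R * Real.exp (γ * 𝓕.viscBound * E) with hK
  have hK0 : 0 ≤ K := mul_nonneg hR (Real.exp_pos _).le
  -- Multiplied by `2 * B`, this `ε` costs at most `ν / 8`; `B + 1` keeps the denominator positive.
  obtain ⟨A, hA0, hA⟩ := 𝓕.abs_conv_self_le (ν / (16 * (B + 1))) (by positivity)
  obtain ⟨C, hC0, hC⟩ := exists_absorption_constant (N := 𝓕.convBound) (K := K)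
    (d := 𝓕.divBound) hν 𝓕.viscBound_nonneg hB hγ hA0
  refine ⟨Real.exp (C * (T + E)) * (1 + C), by positivity, ?_⟩
  intro v v' q k k' h W Q vh vh' qh kh kh' hh hqh hvh hvh0 hkh0 hkhR w w' hw hwm horth hvB hwB
    p hp hpq t ht
  have hdiv : ∀ t ∈ Icc 0 T, 𝓕.div (vh t) (qh t) = 0 := fun t ht => (hvh t ht).2 _ (hqh t ht)
  obtain ⟨hgE, hkK⟩ := hh.a_priori hν hc hγ hT hkh0 hf hdiv hvh0 hkhR hE.ge
  have hkn := hh.k_nonneg hT hkh0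
  have hvg := h.continuousOn_grad hT
  have hvhg := hh.continuousOn_grad hT
  have hwg : ContinuousOn (fun t => 𝓕.grad (w t)) (Icc 0 T) :=
    𝓕.grad.continuous.comp_continuousOn (hw.continuousOn hT)
  have hy := (((hh.deriv_v.map 𝓕.val).sub (hw.map 𝓕.val)).norm_sq hT).add
    ((h.deriv_k.sub hh.deriv_k).mul hT (h.deriv_k.sub hh.deriv_k))
  have hF : IntegrableOn
      (fun s => C * (‖𝓕.grad (v s) - 𝓕.grad (w s)‖ ^ 2 + ‖q s - p s‖ ^ 2)) (Icc 0 T) :=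
    ((((hvg.sub hwg).norm.pow 2).integrableOn_Icc).add hpq).const_mul C
  -- The rate depends on the discrete solution, but its integral is at most `C * (T + E)`.
  have key := hy.gronwall (a := fun s => C * (1 + ‖𝓕.grad (vh s)‖ ^ 2))
    (g := fun s => ν * ‖𝓕.grad (vh s) - 𝓕.grad (w s)‖ ^ 2) hT
    (continuousOn_const.mul (continuousOn_const.add (hvhg.norm.pow 2)))
    (fun _ _ => by positivity)
    (continuousOn_const.mul ((hvhg.sub hwg).norm.pow 2)).integrableOn_Icc
    (fun _ _ => by positivity) hF (fun _ _ => by positivity)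
    (fun _ _ => add_nonneg (sq_nonneg _) (mul_self_nonneg _)) ?_ t ht
  · simp only [← pow_two] at key
    refine key.trans ?_
    have hgi : IntervalIntegrable (fun s => ‖𝓕.grad (vh s)‖ ^ 2) volume 0 T := by
      refine ContinuousOn.intervalIntegrable ?_
      rw [uIcc_of_le hT]
      exact hvhg.norm.pow 2
    have ha : ∫ s in (0 : ℝ)..T, C * (1 + ‖𝓕.grad (vh s)‖ ^ 2) ≤ C * (T + E) := by
      rw [intervalIntegral.integral_const_mul, intervalIntegral.integral_add (by simp) hgi]
      simp only [intervalIntegral.integral_const, sub_zero, smul_eq_mul, mul_one]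
      gcongr
    rw [mul_assoc]
    have hI : 0 ≤ ∫ s in (0 : ℝ)..T, (‖𝓕.grad (v s) - 𝓕.grad (w s)‖ ^ 2 + ‖q s - p s‖ ^ 2) :=
      intervalIntegral.integral_nonneg hT fun _ _ => by positivity
    have eF : ∫ s in (0 : ℝ)..T, C * (‖𝓕.grad (v s) - 𝓕.grad (w s)‖ ^ 2 + ‖q s - p s‖ ^ 2) =
        C * ∫ s in (0 : ℝ)..T, (‖𝓕.grad (v s) - 𝓕.grad (w s)‖ ^ 2 + ‖q s - p s‖ ^ 2) :=
      intervalIntegral.integral_const_mul _ _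
    rw [eF]
    have h0 : 0 ≤ ‖𝓕.val (vh 0) - 𝓕.val (w 0)‖ ^ 2 + (k 0 - kh 0) ^ 2 := by positivity
    refine mul_le_mul (Real.exp_le_exp.2 ha) ?_ (by positivity) (Real.exp_pos _).le
    nlinarith
  · filter_upwards [h.momentum, hh.momentum, h.kEquation, hh.kEquation, horth,
      ae_restrict_mem measurableSet_Icc] with s h1 h2 h3 h4 h5 hs
    have hφ : vh s - w s ∈ 𝓕.discKer W Q := Submodule.sub_mem _ (hvh s hs) (hwm s hs)
    have e := momentum_error (fun χ => h1 χ trivial) h2 h5 (hqh s hs) (hp s hs) hφ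
    set x := ‖𝓕.grad (vh s - w s)‖
    set z := ‖𝓕.grad (v s - w s)‖
    set r := ‖q s - p s‖
    set κ := k s - kh s with hκ
    set l := ‖𝓕.grad (vh s)‖
    set y := ‖𝓕.val (vh s - w s)‖
    have hx : 0 ≤ x := norm_nonneg _
    have hz : 0 ≤ z := norm_nonneg _
    have hl : 0 ≤ l := norm_nonneg _
    have hb := hC x z r |κ| y l hx hz (norm_nonneg _) (abs_nonneg _) (norm_nonneg _) hl
    have hm0 := 𝓕.viscBound_nonneg
    have hN0 := 𝓕.convBound_nonneg
    have hks := hkn s hs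
    have b1 : κ * 𝓕.visc (v s) (vh s - w s) ≤ 𝓕.viscBound * B * |κ| * x := by
      refine (le_abs_self _).trans ?_
      rw [abs_mul]
      calc |κ| * |𝓕.visc (v s) (vh s - w s)| ≤ |κ| * (𝓕.viscBound * B * x) := by
            gcongr
            refine (𝓕.abs_visc_le _ _).trans ?_
            gcongr
            exact hvB s hs
        _ = _ := by ring
    have b2 : kh s * 𝓕.visc (v s - w s) (vh s - w s) ≤ K * 𝓕.viscBound * z * x := by
      calc kh s * 𝓕.visc (v s - w s) (vh s - w s) ≤ kh s * (𝓕.viscBound * z * x) := by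
            gcongr
            exact (le_abs_self _).trans (𝓕.abs_visc_le _ _)
        _ ≤ K * (𝓕.viscBound * z * x) := by
            gcongr
            exact hkK s hs
        _ = _ := by ring
    have b3 : 0 ≤ kh s * 𝓕.visc (vh s - w s) (vh s - w s) :=
      mul_nonneg hks (𝓕.visc_nonneg _)
    have b4 : 𝓕.conv (v s - w s) (v s) (vh s - w s) ≤ 𝓕.convBound * B * z * x := by
      refine (le_abs_self _).trans ((𝓕.abs_conv_le _ _ _).trans ?_)
      calc 𝓕.convBound * z * ‖𝓕.grad (v s)‖ * x ≤ 𝓕.convBound * z * B * x := by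
            gcongr
            exact hvB s hs
        _ = _ := by ring
    have b5 : 𝓕.conv (w s) (v s - w s) (vh s - w s) ≤ 𝓕.convBound * B * z * x := by
      refine (le_abs_self _).trans ((𝓕.abs_conv_le _ _ _).trans ?_)
      gcongr
      exact hwB s hs
    have b6 : - 𝓕.conv (vh s - w s) (w s) (vh s - w s) ≤
        B * (ν / (16 * (B + 1)) * x ^ 2 + A * y ^ 2) := by
      refine (neg_le_abs _).trans ((hA _ _).trans ?_)
      gcongr
      exact hwB s hs
    have b7 : - 𝓕.div (vh s - w s) (q s - p s) ≤ 𝓕.divBound * x * r :=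
      (neg_le_abs _).trans (𝓕.abs_div_le _ _)
    have b8 : κ * (k' s - kh' s) ≤ γ * (𝓕.viscBound * B ^ 2 * |κ| ^ 2
        + K * 𝓕.viscBound * |κ| * (z + x) * (B + l)) := by
      -- The symmetry of `visc` factors the difference of the quadratic productions. The relaxation
      -- term contributes `-c * κ ^ 2`, which is dropped.
      have e1 : k' s - kh' s = - c * κ + γ * (κ * 𝓕.visc (v s) (v s)
          + kh s * 𝓕.visc (v s - vh s) (v s + vh s)) := by
        have e2 : 𝓕.visc (v s - vh s) (v s + vh s)
            = 𝓕.visc (v s) (v s) - 𝓕.visc (vh s) (vh s) := by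
          simp only [map_sub, map_add, sub_apply]
          rw [𝓕.visc_symm (vh s) (v s)]
          ring
        rw [e2, hκ]
        linear_combination h3 - h4
      have u1 : κ ^ 2 * 𝓕.visc (v s) (v s) ≤ 𝓕.viscBound * B ^ 2 * |κ| ^ 2 := by
        rw [sq_abs]
        calc κ ^ 2 * 𝓕.visc (v s) (v s) ≤ κ ^ 2 * (𝓕.viscBound * B * B) := by
              gcongr
              refine (le_abs_self _).trans ((𝓕.abs_visc_le _ _).trans ?_)
              gcongr <;> exact hvB s hs
          _ = _ := by ring
      have u2 : κ * (kh s * 𝓕.visc (v s - vh s) (v s + vh s)) ≤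
          K * 𝓕.viscBound * |κ| * (z + x) * (B + l) := by
        refine (le_abs_self _).trans ?_
        rw [abs_mul, abs_mul, abs_of_nonneg hks]
        calc |κ| * (kh s * |𝓕.visc (v s - vh s) (v s + vh s)|)
            ≤ |κ| * (K * (𝓕.viscBound * (z + x) * (B + l))) := by
              gcongr
              · exact hkK s hs
              · refine (𝓕.abs_visc_le _ _).trans ?_
                gcongr
                · have : v s - vh s = (v s - w s) - (vh s - w s) := by abel
                  rw [this, map_sub]
                  exact norm_sub_le _ _
                · rw [map_add]
                  exact (norm_add_le _ _).trans (add_le_add (hvB s hs) le_rfl)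
          _ = _ := by ring
      rw [e1]
      have u3 : 0 ≤ c * κ ^ 2 := by positivity
      calc κ * (-c * κ + γ * (κ * 𝓕.visc (v s) (v s) + kh s * 𝓕.visc (v s - vh s) (v s + vh s)))
          = γ * (κ ^ 2 * 𝓕.visc (v s) (v s) + κ * (kh s * 𝓕.visc (v s - vh s) (v s + vh s)))
            - c * κ ^ 2 := by ring
        _ ≤ γ * (κ ^ 2 * 𝓕.visc (v s) (v s) + κ * (kh s * 𝓕.visc (v s - vh s) (v s + vh s))) := by
            linarith
        _ ≤ _ := by gcongr
    rw [sq_abs] at hb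
    have ey : ‖𝓕.val (vh s) - 𝓕.val (w s)‖ = y := by rw [← map_sub]
    have ex : ‖𝓕.grad (vh s) - 𝓕.grad (w s)‖ = x := by rw [← map_sub]
    have ez : ‖𝓕.grad (v s) - 𝓕.grad (w s)‖ = z := by rw [← map_sub]
    rw [e, ey, ex, ez, ← pow_two κ]
    have b8' := b8
    rw [sq_abs] at b8'
    linarith

end FlowForms

/-! ### Linear evolution equations and the parabolic projection. -/

/-- A linear equation with integrable right-hand side has an absolutely continuous solution. -/
theorem exists_hasTimeDeriv_linear {E : Type*} [NormedAddCommGroup E] [NormedSpace ℝ E]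
    [CompleteSpace E] (A : E →L[ℝ] E) {T : ℝ} (hT : 0 ≤ T) {g : ℝ → E}
    (hg : IntervalIntegrable g volume 0 T) (w₀ : E) :
    ∃ w, HasTimeDeriv T w (fun t => g t - A (w t)) ∧ w 0 = w₀ := by
  -- Since `g` is merely integrable, its primitive `Y` is split off. The remainder solves `z' = -A z
  -- - A Y`, whose inhomogeneity is continuous, and Duhamel's formula gives a classical solution.
  have hY : HasTimeDeriv T (fun t => ∫ s in (0 : ℝ)..t, g s) g :=
    ⟨hg, fun t _ => by simp⟩
  set Y : ℝ → E := IccExtend hT ((Icc 0 T).domRestrict (fun t => ∫ s in (0 : ℝ)..t, g s)) with hYd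
  have hYc : Continuous Y := (hY.continuousOn hT).domRestrict.Icc_extend'
  have hYe : ∀ s ∈ Icc 0 T, Y s = ∫ r in (0 : ℝ)..s, g r := fun s hs => by
    rw [hYd, IccExtend_of_mem _ _ hs]; rfl
  set X : ℝ → (E →L[ℝ] E) := fun t => NormedSpace.exp (t • A) with hX
  have hXd : ∀ t, HasDerivAt X (A * X t) t := fun t => hasDerivAt_exp_smul_const' A t
  have hXc : Continuous X := continuous_iff_continuousAt.2 fun t => (hXd t).continuousAt
  have hXinv : ∀ t, X (-t) * X t = 1 := fun t => by
    let : NormedAlgebra ℚ (E →L[ℝ] E) := NormedAlgebra.restrictScalars ℚ ℝ _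
    rw [hX]
    simp only
    rw [← NormedSpace.exp_add_of_commute]
    · simp
    · exact ((Commute.refl A).smul_left _).smul_right _
  have hcont : Continuous (fun s => X s (A (Y s))) :=
    hXc.clm_apply (A.continuous.comp hYc)
  set I : ℝ → E := fun t => w₀ - ∫ s in (0 : ℝ)..t, X s (A (Y s)) with hI
  have hId : ∀ t, HasDerivAt I (- X t (A (Y t))) t := fun t => by
    have := intervalIntegral.integral_hasDerivAt_right (hcont.intervalIntegrable 0 t)
      hcont.stronglyMeasurable.stronglyMeasurableAtFilter hcont.continuousAt
    simpa using this.const_sub w₀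
  set z : ℝ → E := fun t => X (-t) (I t) with hz
  have hzd : ∀ t, HasDerivAt z (- A (Y t) - A (z t)) t := fun t => by
    have h1 : HasDerivAt (fun t => X (-t)) (-(A * X (-t))) t := by
      simpa [Function.comp_def] using (hXd (-t)).scomp t (hasDerivAt_neg t)
    have h2 := h1.clm_apply (hId t)
    refine h2.congr_deriv ?_
    have h3 : X (-t) (X t (A (Y t))) = A (Y t) := by
      rw [← mul_apply_eq_comp, hXinv, one_apply_eq_self]
    rw [map_neg, h3, neg_apply, mul_apply_eq_comp]
    abel
  have hzc : Continuous z := continuous_iff_continuousAt.2 fun t => (hzd t).continuousAt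
  have hzc' : Continuous (fun t => - A (Y t) - A (z t)) :=
    (A.continuous.comp hYc).neg.sub (A.continuous.comp hzc)
  have hzT : HasTimeDeriv T z (fun t => - A (Y t) - A (z t)) := by
    refine ⟨hzc'.intervalIntegrable _ _, fun t _ => ?_⟩
    rw [intervalIntegral.integral_eq_sub_of_hasDerivAt (fun x _ => hzd x)
      (hzc'.intervalIntegrable _ _)]
    abel
  have hsum := (hY.congr_path hT hYe).add hzT
  refine ⟨fun t => Y t + z t, ?_, ?_⟩
  · convert hsum using 2 with t
    rw [map_add]
    abel
  · have hX0 : X 0 = 1 := by simp [hX]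
    have : Y 0 = 0 := by rw [hYe 0 ⟨le_rfl, hT⟩]; simp
    simp [this, hz, hI, hX0]

/-- The functional `χ ↦ ⟪A u, A χ⟫` on a subspace. -/
noncomputable def gram {H E : Type*} [NormedAddCommGroup H] [NormedSpace ℝ H]
    [NormedAddCommGroup E] [InnerProductSpace ℝ E] (A : H →L[ℝ] E) (W : Submodule ℝ H) :
    H →L[ℝ] StrongDual ℝ W :=
  ((ContinuousLinearMap.compL ℝ W E ℝ).flip (A.comp W.subtypeL)).comp ((innerSL ℝ).comp A)

namespace FlowForms

variable (𝓕 : FlowForms H L G P) {ν T : ℝ}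

/-- The Riesz representation with respect to the pivot inner product on a finite-dimensional
subspace. -/
theorem exists_riesz (W : Submodule ℝ H) [FiniteDimensional ℝ W] :
    ∃ J : StrongDual ℝ W →L[ℝ] W, ∀ (l : StrongDual ℝ W) (χ : W),
      ⟪𝓕.val (J l : H), 𝓕.val (χ : H)⟫_ℝ = l χ := by
  let Φ : W →ₗ[ℝ] Module.Dual ℝ W := LinearMap.mk₂ ℝ
    (fun u χ => ⟪𝓕.val (u : H), 𝓕.val (χ : H)⟫_ℝ)
    (fun a b c => by rw [Submodule.coe_add, map_add, inner_add_left])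
    (fun a b c => by
      rw [Submodule.coe_smul, map_smul, real_inner_smul_left, smul_eq_mul])
    (fun a b c => by rw [Submodule.coe_add, map_add, inner_add_right])
    (fun a b c => by
      rw [Submodule.coe_smul, map_smul, real_inner_smul_right, smul_eq_mul])
  -- The mass form is positive definite on `W` because `val` is injective; in finite dimension it is
  -- then invertible.
  have hinj : Function.Injective Φ := by
    rw [injective_iff_map_eq_zero]
    intro u hu
    have h1 : ⟪𝓕.val (u : H), 𝓕.val (u : H)⟫_ℝ = 0 := by
      have := LinearMap.congr_fun hu u
      simpa [Φ] using this
    have h2 : 𝓕.val (u : H) = 𝓕.val 0 := by rw [map_zero]; exact inner_self_eq_zero.1 h1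
    exact Subtype.ext (𝓕.val_injective h2)
  have hsurj : Function.Surjective Φ :=
    (LinearMap.injective_iff_surjective_of_finrank_eq_finrank
      (Subspace.dual_finrank_eq).symm).1 hinj
  let e := LinearEquiv.ofBijective Φ ⟨hinj, hsurj⟩
  refine ⟨(e.symm.toLinearMap ∘ₗ ContinuousLinearMap.coeLM ℝ).toContinuousLinearMap,
    fun l χ => ?_⟩
  have : Φ (e.symm l) = l := e.apply_symm_apply _
  exact LinearMap.congr_fun this χ

/-- The Galerkin approximation of a path by the linear parabolic problem. -/
theorem exists_parabolic_projection [CompleteSpace H] (ν : ℝ) (W : Submodule ℝ H)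
    [FiniteDimensional ℝ W] (hT : 0 ≤ T) {v v' : ℝ → H} (hv : HasTimeDeriv T v v') {w₀ : H}
    (hw₀ : w₀ ∈ W) :
    ∃ w w' : ℝ → H, HasTimeDeriv T w w' ∧ (∀ t, w t ∈ W) ∧ (∀ t, w' t ∈ W) ∧ w 0 = w₀ ∧
      ∀ t, ∀ χ ∈ W, ⟪𝓕.val (v' t) - 𝓕.val (w' t), 𝓕.val χ⟫_ℝ
        + ν * ⟪𝓕.grad (v t) - 𝓕.grad (w t), 𝓕.grad χ⟫_ℝ = 0 := by
  obtain ⟨J, hJ⟩ := 𝓕.exists_riesz W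
  have hm : ∀ u (χ : W), gram 𝓕.val W u χ = ⟪𝓕.val u, 𝓕.val (χ : H)⟫_ℝ := fun u χ => rfl
  have hk : ∀ u (χ : W), gram 𝓕.grad W u χ = ⟪𝓕.grad u, 𝓕.grad (χ : H)⟫_ℝ := fun u χ => rfl
  -- In terms of the Riesz images `M` and `K` of the mass and stiffness forms, orthogonality reads
  -- `w' = M v' + K v - K w`, a linear equation in `W`.
  let M : H →L[ℝ] W := J.comp (gram 𝓕.val W)
  let K : H →L[ℝ] W := ν • J.comp (gram 𝓕.grad W)
  have hMK : IntervalIntegrable (fun t => M (v' t) + K (v t)) volume 0 T := by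
    refine (hv.map M).1.add (ContinuousOn.intervalIntegrable ?_)
    rw [uIcc_of_le hT]
    exact K.continuous.comp_continuousOn (hv.continuousOn hT)
  obtain ⟨w, hw, hw0⟩ := exists_hasTimeDeriv_linear (K.comp W.subtypeL) hT hMK ⟨w₀, hw₀⟩
  refine ⟨fun t => w t, fun t => ((M (v' t) + K (v t) - K (w t) : W) : H), hw.map W.subtypeL,
    fun t => (w t).2, fun t => Subtype.coe_prop _, congrArg Subtype.val hw0, fun t χ hχ => ?_⟩
  have e1 := hJ (gram 𝓕.val W (v' t)) ⟨χ, hχ⟩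
  have e2 := hJ (gram 𝓕.grad W (v t - w t)) ⟨χ, hχ⟩
  rw [hm] at e1
  rw [hk] at e2
  have e3 : ((M (v' t) + K (v t) - K (w t) : W) : H) =
      J (gram 𝓕.val W (v' t)) + ν • (J (gram 𝓕.grad W (v t - w t)) : H) := by
    have : M (v' t) + K (v t) - K (w t) =
      J (gram 𝓕.val W (v' t)) + ν • J (gram 𝓕.grad W (v t - w t)) := by
      rw [add_sub_assoc, ← map_sub]; rfl
    rw [this]; rfl
  dsimp only at e1 e2 ⊢
  rw [e3, map_add, map_smul, inner_sub_left, inner_add_left, real_inner_smul_left, e1, e2, map_sub]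
  ring

end FlowForms

/-! ### Stability and quasi-optimality of the parabolic projection. -/

namespace FlowForms

variable {𝓕 : FlowForms H L G P} {ν T : ℝ} {v v' w w' z z' : ℝ → H} {n : ℝ → ℝ}

theorem norm_val_le_norm (u : H) : ‖𝓕.val u‖ ^ 2 ≤ ‖u‖ ^ 2 := by
  rw [𝓕.norm_sq_eq u]
  exact le_add_of_nonneg_right (sq_nonneg _)

theorem norm_grad_le_norm (u : H) : ‖𝓕.grad u‖ ^ 2 ≤ ‖u‖ ^ 2 := by
  rw [𝓕.norm_sq_eq u]
  exact le_add_of_nonneg_left (sq_nonneg _)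

/-- The gradient of the parabolic projection is controlled by the regularity of the path. -/
theorem norm_grad_parabolic_le [CompleteSpace H] [CompleteSpace G] {W : Submodule ℝ H}
    (hν : 0 < ν) (hT : 0 ≤ T) (hv : HasTimeDeriv T v v')
    (hv' : MemLp v' 2 (volume.restrict (Icc 0 T))) (hw : HasTimeDeriv T w w')
    (hw' : ∀ t, w' t ∈ W)
    (horth : ∀ t, ∀ χ ∈ W, ⟪𝓕.val (v' t) - 𝓕.val (w' t), 𝓕.val χ⟫_ℝ
        + ν * ⟪𝓕.grad (v t) - 𝓕.grad (w t), 𝓕.grad χ⟫_ℝ = 0) :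
    ∀ t ∈ Icc 0 T, ‖𝓕.grad (v t) - 𝓕.grad (w t)‖ ^ 2 ≤ Real.exp T *
      (‖𝓕.grad (v 0) - 𝓕.grad (w 0)‖ ^ 2
        + (1 + (2 * ν)⁻¹) * ∫ s in (0 : ℝ)..T, ‖v' s‖ ^ 2) := by
  intro t ht
  have hy := ((hv.map 𝓕.grad).sub (hw.map 𝓕.grad)).norm_sq hT
  have key := hy.gronwall (a := fun _ => 1) (g := fun _ => 0)
    (F := fun s => (1 + (2 * ν)⁻¹) * ‖v' s‖ ^ 2) hT continuousOn_const
    (fun _ _ => zero_le_one) (integrableOn_zero) (fun _ _ => le_rfl)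
    ((integrableOn_norm_sq hv').const_mul _) (fun _ _ => by positivity)
    (fun _ _ => by positivity) ?_ t ht
  · simpa using key
  · refine Filter.Eventually.of_forall fun s => ?_
    -- Testing with `w'` trades `-⟪η, ∇w'⟫` for `ν⁻¹ ⟪v' - w', w'⟫`, and completing the square
    -- bounds this by `‖v'‖² / (4ν)`, without any norm of `w'`.
    have e1 := horth s (w' s) (hw' s)
    set η := 𝓕.grad (v s) - 𝓕.grad (w s)
    have h1 : ⟪𝓕.val (v' s) - 𝓕.val (w' s), 𝓕.val (w' s)⟫_ℝ ≤ 4⁻¹ * ‖𝓕.val (v' s)‖ ^ 2 := by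
      have h := norm_sub_sq_real (𝓕.val (w' s)) ((2 : ℝ)⁻¹ • 𝓕.val (v' s))
      rw [real_inner_smul_right, norm_smul, real_inner_comm] at h
      rw [inner_sub_left, real_inner_self_eq_norm_sq]
      have h2 : ‖(2 : ℝ)⁻¹‖ = 2⁻¹ := by norm_num
      rw [h2] at h
      have := sq_nonneg ‖𝓕.val (w' s) - (2 : ℝ)⁻¹ • 𝓕.val (v' s)‖
      nlinarith
    have h2 : - ⟪η, 𝓕.grad (w' s)⟫_ℝ ≤ ν⁻¹ * (4⁻¹ * ‖𝓕.val (v' s)‖ ^ 2) := by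
      rw [le_inv_mul_iff₀ hν]
      linarith
    have h3 : 2 * ⟪𝓕.grad (v' s), η⟫_ℝ ≤ ‖𝓕.grad (v' s)‖ ^ 2 + ‖η‖ ^ 2 := by
      have := real_inner_le_norm (𝓕.grad (v' s)) η
      nlinarith [sq_nonneg (‖𝓕.grad (v' s)‖ - ‖η‖)]
    rw [inner_sub_left, real_inner_comm η (𝓕.grad (w' s))]
    have h4 : ν⁻¹ * (4⁻¹ * ‖𝓕.val (v' s)‖ ^ 2) ≤ 2⁻¹ * ((2 * ν)⁻¹ * ‖v' s‖ ^ 2) := by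
      have := mul_le_mul_of_nonneg_left (𝓕.norm_val_le_norm (v' s)) (inv_pos.2 hν).le
      rw [mul_inv]
      linarith
    have h5 := 𝓕.norm_grad_le_norm (v' s)
    linarith

/-- The parabolic projection is quasi-optimal in the energy norm. -/
theorem parabolic_quasi_optimal [CompleteSpace H] [CompleteSpace L] {W : Submodule ℝ H}
    (hν : 0 < ν) (hT : 0 ≤ T) (hv : HasTimeDeriv T v v')
    (hw : HasTimeDeriv T w w') (hwm : ∀ t, w t ∈ W)
    (horth : ∀ t, ∀ χ ∈ W, ⟪𝓕.val (v' t) - 𝓕.val (w' t), 𝓕.val χ⟫_ℝ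
        + ν * ⟪𝓕.grad (v t) - 𝓕.grad (w t), 𝓕.grad χ⟫_ℝ = 0)
    (hz : HasTimeDeriv T z z') (hzm : ∀ t ∈ Icc 0 T, z t ∈ W)
    (hn : IntegrableOn (fun t => n t ^ 2) (Icc 0 T))
    (hzn : ∀ᵐ t ∂(volume.restrict (Icc 0 T)), ∀ χ,
      |⟪𝓕.val (v' t) - 𝓕.val (z' t), 𝓕.val χ⟫_ℝ| ≤ n t * ‖𝓕.grad χ‖) :
    ∀ t ∈ Icc 0 T, ‖𝓕.val (w t) - 𝓕.val (z t)‖ ^ 2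
        + ∫ s in (0 : ℝ)..t, ν * ‖𝓕.grad (w s) - 𝓕.grad (z s)‖ ^ 2 ≤
      ‖𝓕.val (w 0) - 𝓕.val (z 0)‖ ^ 2 + (2 * ν⁻¹ + 2 * ν) *
        ∫ s in (0 : ℝ)..T, (n s ^ 2 + ‖𝓕.grad (v s) - 𝓕.grad (z s)‖ ^ 2) := by
  intro t ht
  have hc : ∀ {u u' : ℝ → H}, HasTimeDeriv T u u' →
      ContinuousOn (fun t => 𝓕.grad (u t)) (Icc 0 T) := fun hu =>
    𝓕.grad.continuous.comp_continuousOn (hu.continuousOn hT)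
  have hy := ((hw.map 𝓕.val).sub (hz.map 𝓕.val)).norm_sq hT
  have hF : IntegrableOn (fun s => (2 * ν⁻¹ + 2 * ν) *
      (n s ^ 2 + ‖𝓕.grad (v s) - 𝓕.grad (z s)‖ ^ 2)) (Icc 0 T) :=
    Integrable.const_mul (Integrable.add hn
      (((hc hv).sub (hc hz)).norm.pow 2).integrableOn_Icc) _
  have key := hy.gronwall (a := fun _ => 0)
    (g := fun s => ν * ‖𝓕.grad (w s) - 𝓕.grad (z s)‖ ^ 2)
    (F := fun s => (2 * ν⁻¹ + 2 * ν) * (n s ^ 2 + ‖𝓕.grad (v s) - 𝓕.grad (z s)‖ ^ 2))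
    hT continuousOn_const (fun _ _ => le_rfl)
    (continuousOn_const.mul (((hc hw).sub (hc hz)).norm.pow 2)).integrableOn_Icc
    (fun _ _ => by positivity)
    hF
    (fun _ _ => by positivity) (fun _ _ => by positivity) ?_ t ht
  · simpa using key
  · filter_upwards [hzn, ae_restrict_mem measurableSet_Icc] with s hs hsm
    have hψ : w s - z s ∈ W := W.sub_mem (hwm s) (hzm s hsm)
    have e1 := horth s _ hψ
    have e2 := (abs_le.1 (hs (w s - z s))).2
    have e3 : 𝓕.grad (v s) - 𝓕.grad (w s) =
        (𝓕.grad (v s) - 𝓕.grad (z s)) - 𝓕.grad (w s - z s) := by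
      rw [map_sub]; abel
    rw [e3, inner_sub_left (𝓕.grad (v s) - 𝓕.grad (z s)), real_inner_self_eq_norm_sq] at e1
    have e4 := real_inner_le_norm (𝓕.grad (v s) - 𝓕.grad (z s)) (𝓕.grad (w s - z s))
    rw [← map_sub 𝓕.val (w s), ← map_sub 𝓕.grad (w s)]
    set x := ‖𝓕.grad (w s - z s)‖
    set y := ‖𝓕.grad (v s) - 𝓕.grad (z s)‖
    -- Write `(w - z)' = (v - z)' - (v - w)'`: the dual bound `n` controls the first part, and
    -- orthogonality turns the second into gradients.
    have e5 : ⟪𝓕.val (w' s) - 𝓕.val (z' s), 𝓕.val (w s - z s)⟫_ℝ ≤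
        n s * x + ν * (y * x) - ν * x ^ 2 := by
      have e6 : 𝓕.val (w' s) - 𝓕.val (z' s) =
        (𝓕.val (v' s) - 𝓕.val (z' s)) - (𝓕.val (v' s) - 𝓕.val (w' s)) := by abel
      rw [e6, inner_sub_left]
      have := mul_le_mul_of_nonneg_left e4 hν.le
      linarith
    have e7 : 2 * (n s * x) ≤ 2⁻¹ * ν * x ^ 2 + 2 * ν⁻¹ * n s ^ 2 := by
      have : 0 ≤ 2 * ν⁻¹ * (n s - ν / 2 * x) ^ 2 := by positivity
      have e : 2 * ν⁻¹ * (n s - ν / 2 * x) ^ 2 =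
        2⁻¹ * ν * x ^ 2 + 2 * ν⁻¹ * n s ^ 2 - 2 * (n s * x) := by field_simp; ring
      linarith
    have e8 : 2 * (ν * (y * x)) ≤ 2⁻¹ * ν * x ^ 2 + 2 * ν * y ^ 2 := by
      have : 0 ≤ 2 * ν * (y - 2⁻¹ * x) ^ 2 := by positivity
      linarith
    have e9 : 0 ≤ 2 * ν * n s ^ 2 := by positivity
    have e10 : 0 ≤ 2 * ν⁻¹ * y ^ 2 := by positivity
    linarith

/-- The pivot norm of a path is controlled, uniformly in time, by its energy norm. -/
theorem norm_val_sq_le_energy [CompleteSpace H] [CompleteSpace L] (hT : 0 < T)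
    (hz : HasTimeDeriv T z z')
    (hn : IntegrableOn (fun t => n t ^ 2) (Icc 0 T))
    (hzn : ∀ᵐ t ∂(volume.restrict (Icc 0 T)), ∀ χ,
      |⟪𝓕.val (z' t), 𝓕.val χ⟫_ℝ| ≤ n t * ‖𝓕.grad χ‖) :
    ∀ t ∈ Icc 0 T, ‖𝓕.val (z t)‖ ^ 2 ≤ (1 + T⁻¹ * 𝓕.poincare ^ 2) *
        ∫ s in (0 : ℝ)..T, (n s ^ 2 + ‖𝓕.grad (z s)‖ ^ 2) := by
  intro t ht
  have hc : ContinuousOn (fun t => ‖𝓕.grad (z t)‖ ^ 2) (Icc 0 T) :=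
    (𝓕.grad.continuous.comp_continuousOn (hz.continuousOn hT.le)).norm.pow 2
  have hcv : ContinuousOn (fun t => ‖𝓕.val (z t)‖ ^ 2) (Icc 0 T) :=
    (𝓕.val.continuous.comp_continuousOn (hz.continuousOn hT.le)).norm.pow 2
  have hci : IntervalIntegrable (fun t => ‖𝓕.grad (z t)‖ ^ 2) volume 0 T := by
    refine ContinuousOn.intervalIntegrable ?_
    rwa [uIcc_of_le hT.le]
  have hcvi : IntervalIntegrable (fun t => ‖𝓕.val (z t)‖ ^ 2) volume 0 T := by
    refine ContinuousOn.intervalIntegrable ?_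
    rwa [uIcc_of_le hT.le]
  have hJI : IntervalIntegrable (fun s => n s ^ 2 + ‖𝓕.grad (z s)‖ ^ 2) volume 0 T := by
    rw [intervalIntegrable_iff_integrableOn_Icc_of_le hT.le]
    exact hn.add hc.integrableOn_Icc
  set J := ∫ s in (0 : ℝ)..T, (n s ^ 2 + ‖𝓕.grad (z s)‖ ^ 2) with hJ
  have hy := (hz.map 𝓕.val).norm_sq hT.le
  -- No initial value is controlled, so time `t` is compared with every time `s`. Averaging over `s`
  -- and using Poincaré's inequality gives the bound.
  have hstep : ∀ s ∈ Icc 0 T, ‖𝓕.val (z t)‖ ^ 2 ≤ ‖𝓕.val (z s)‖ ^ 2 + J := by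
    intro s hs
    have h1 := hy.sub_eq_integral hs ht
    have h2 : |∫ r in s..t, 2 * ⟪𝓕.val (z' r), 𝓕.val (z r)⟫_ℝ| ≤ J := by
      rw [← Real.norm_eq_abs]
      refine (intervalIntegral.norm_integral_le_integral_norm_uIoc).trans ?_
      simp only [Real.norm_eq_abs]
      rw [hJ, intervalIntegral.integral_of_le hT.le]
      have hsub : uIoc s t ⊆ Ioc 0 T := by
        rw [uIoc]
        exact Ioc_subset_Ioc (le_min hs.1 ht.1) (max_le hs.2 ht.2)
      have hd : IntegrableOn (fun r => |2 * ⟪𝓕.val (z' r), 𝓕.val (z r)⟫_ℝ|) (Ioc 0 T) := by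
        have := hy.1.norm
        rw [intervalIntegrable_iff_integrableOn_Ioc_of_le hT.le] at this
        exact this
      refine (setIntegral_mono_set hd (Filter.Eventually.of_forall fun r => abs_nonneg _)
        hsub.eventuallyLE).trans ?_
      refine setIntegral_mono_ae_restrict hd
        ((intervalIntegrable_iff_integrableOn_Ioc_of_le hT.le).1 hJI) ?_
      filter_upwards [ae_restrict_of_ae_restrict_of_subset Ioc_subset_Icc_self hzn] with r hr
      have h3 := hr (z r)
      rw [abs_mul, abs_two]
      nlinarith [sq_nonneg (n r - ‖𝓕.grad (z r)‖)]
    have h4 := (abs_le.1 h2).2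
    linarith
  have havg : T * ‖𝓕.val (z t)‖ ^ 2 ≤ 𝓕.poincare ^ 2 * J + T * J := by
    have h1 : ∫ s in (0 : ℝ)..T, ‖𝓕.val (z t)‖ ^ 2 ≤
        ∫ s in (0 : ℝ)..T, (‖𝓕.val (z s)‖ ^ 2 + J) :=
      intervalIntegral.integral_mono_on hT.le (by simp)
        (hcvi.add (by simp)) hstep
    rw [intervalIntegral.integral_add hcvi (by simp)] at h1
    simp only [intervalIntegral.integral_const, sub_zero, smul_eq_mul] at h1
    have h2 : ∫ s in (0 : ℝ)..T, ‖𝓕.val (z s)‖ ^ 2 ≤ 𝓕.poincare ^ 2 * J := by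
      rw [hJ, ← intervalIntegral.integral_const_mul]
      refine intervalIntegral.integral_mono_on hT.le hcvi (hJI.const_mul _) fun s _ => ?_
      have := pow_le_pow_left₀ (norm_nonneg _) (𝓕.norm_val_le (z s)) 2
      rw [mul_pow] at this
      nlinarith [mul_nonneg (sq_nonneg 𝓕.poincare) (sq_nonneg (n s))]
    linarith
  have : ‖𝓕.val (z t)‖ ^ 2 ≤ T⁻¹ * (𝓕.poincare ^ 2 * J + T * J) := by
    rw [le_inv_mul_iff₀ hT]; exact havg
  refine this.trans (le_of_eq ?_)
  field_simp
  ring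

end FlowForms

/-! ### Replacing a discrete path by one with bounded gradient. -/

namespace FlowForms

variable {𝓕 : FlowForms H L G P} {ν T B I Δ : ℝ} {v v' z z' : ℝ → H} {n : ℝ → ℝ}

/-- The displacement is at most `∫‖v'‖`, and Young's inequality `‖v'‖ ≤ Δ^(-1/2) + Δ^(1/2) ‖v'‖²`,
integrated over a time of length at most `Δ`, yields the order `√Δ`. -/
theorem norm_sub_sq_le_mul_integral [CompleteSpace H] (hT : 0 ≤ T) (hΔ : 0 < Δ)
    (hv : HasTimeDeriv T v v')
    (hv' : MemLp v' 2 (volume.restrict (Icc 0 T))) (hI : ∫ s in (0 : ℝ)..T, ‖v' s‖ ^ 2 ≤ I)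
    {s : ℝ} (hs : s ∈ Icc 0 T) (hsΔ : s ≤ Δ) :
    ‖v 0 - v s‖ ^ 2 ≤ (1 + I) ^ 2 * Δ := by
  have h0 : (0 : ℝ) ∈ Icc 0 T := ⟨le_rfl, hT⟩
  have hq : 0 < √Δ := Real.sqrt_pos.2 hΔ
  have hqq : √Δ ^ 2 = Δ := Real.sq_sqrt hΔ.le
  have hi : IntervalIntegrable (fun r => ‖v' r‖ ^ 2) volume 0 T := by
    rw [intervalIntegrable_iff_integrableOn_Icc_of_le hT]
    exact integrableOn_norm_sq hv'
  have his : IntervalIntegrable (fun r => ‖v' r‖ ^ 2) volume 0 s := by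
    rw [intervalIntegrable_iff_integrableOn_Icc_of_le hs.1]
    exact (integrableOn_norm_sq hv').mono_set (Icc_subset_Icc_right hs.2)
  have hIs : ∫ r in (0 : ℝ)..s, ‖v' r‖ ^ 2 ≤ I :=
    (intervalIntegral.integral_mono_interval le_rfl hs.1 hs.2
      (Filter.Eventually.of_forall fun r => sq_nonneg _) hi).trans hI
  have hI0 : 0 ≤ I := (intervalIntegral.integral_nonneg hs.1 fun r _ => sq_nonneg _).trans hIs
  have h1 : ‖v 0 - v s‖ ≤ √Δ * (1 + I) := by
    rw [norm_sub_rev, hv.sub_eq_integral h0 hs]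
    calc ‖∫ r in (0 : ℝ)..s, v' r‖ ≤ ∫ r in (0 : ℝ)..s, ‖v' r‖ :=
          intervalIntegral.norm_integral_le_integral_norm hs.1
      _ ≤ ∫ r in (0 : ℝ)..s, ((√Δ)⁻¹ + √Δ * ‖v' r‖ ^ 2) := by
          refine intervalIntegral.integral_mono_on hs.1 (hv.intervalIntegrable h0 hs).norm
            (IntervalIntegrable.add (by simp) (his.const_mul _)) fun r _ => ?_
          have h : 0 ≤ (√Δ)⁻¹ * (1 - √Δ * ‖v' r‖) ^ 2 := by positivity
          have e : (√Δ)⁻¹ * (1 - √Δ * ‖v' r‖) ^ 2 =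
            (√Δ)⁻¹ + √Δ * ‖v' r‖ ^ 2 - 2 * ‖v' r‖ := by field_simp; ring
          linarith [norm_nonneg (v' r)]
      _ = s * (√Δ)⁻¹ + √Δ * ∫ r in (0 : ℝ)..s, ‖v' r‖ ^ 2 := by
          rw [intervalIntegral.integral_add (by simp) (his.const_mul _),
            intervalIntegral.integral_const_mul]
          simp
      _ ≤ √Δ + √Δ * I := by
          gcongr
          rw [← div_eq_mul_inv, div_le_iff₀ hq, ← pow_two, hqq]
          exact hsΔ
      _ = _ := by ring
  calc ‖v 0 - v s‖ ^ 2 ≤ (√Δ * (1 + I)) ^ 2 := by gcongr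
    _ = _ := by rw [mul_pow, hqq]; ring

/-- A path with small energy distance to `v` yields an initial value in the discrete space that is
close to `v 0` and has a bounded gradient. -/
theorem exists_initial_value [CompleteSpace H] {W : Submodule ℝ H} (hT : 0 < T) (hΔ : 0 < Δ)
    (hv : HasTimeDeriv T v v')
    (hv' : MemLp v' 2 (volume.restrict (Icc 0 T))) (hI : ∫ s in (0 : ℝ)..T, ‖v' s‖ ^ 2 ≤ I)
    (hvB : ∀ t ∈ Icc 0 T, ‖𝓕.grad (v t)‖ ≤ B)
    (hz : HasTimeDeriv T z z') (hzm : ∀ t ∈ Icc 0 T, z t ∈ W)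
    (hzΔ : ∫ s in (0 : ℝ)..T, ‖𝓕.grad (v s) - 𝓕.grad (z s)‖ ^ 2 ≤ Δ)
    {A : ℝ} (hA : ∀ t ∈ Icc 0 T, ‖𝓕.val (v t) - 𝓕.val (z t)‖ ^ 2 ≤ A * Δ) :
    ∃ w₀ ∈ W, ‖𝓕.val (v 0) - 𝓕.val w₀‖ ^ 2 ≤
        ((𝓕.poincare * B) ^ 2 * T⁻¹ + 2 * (1 + I) ^ 2 + 2 * A) * Δ ∧
      ‖𝓕.grad (v 0) - 𝓕.grad w₀‖ ≤ 2 * B + 2 := by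
  have h0 : (0 : ℝ) ∈ Icc 0 T := ⟨le_rfl, hT.le⟩
  have hB0 : 0 ≤ B := (norm_nonneg _).trans (hvB 0 h0)
  have hA0 : 0 ≤ A * Δ := (sq_nonneg _).trans (hA 0 h0)
  have hA0' : 0 ≤ A := nonneg_of_mul_nonneg_left hA0 hΔ
  -- If `T ≤ Δ`, an error of order one is allowed and the zero initial value is good enough.
  rcases le_total T Δ with hTΔ | hTΔ
  · refine ⟨0, W.zero_mem, ?_, ?_⟩
    · rw [map_zero, sub_zero]
      have h1 : ‖𝓕.val (v 0)‖ ^ 2 ≤ (𝓕.poincare * B) ^ 2 := by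
        refine pow_le_pow_left₀ (norm_nonneg _) ((𝓕.norm_val_le _).trans ?_) 2
        exact mul_le_mul_of_nonneg_left (hvB 0 h0) 𝓕.poincare_nonneg
      have h2 : (𝓕.poincare * B) ^ 2 ≤ (𝓕.poincare * B) ^ 2 * T⁻¹ * Δ := by
        rw [mul_assoc]
        refine le_mul_of_one_le_right (sq_nonneg _) ?_
        rw [inv_mul_eq_div, le_div_iff₀ hT]
        linarith
      have h3 : 0 ≤ 2 * (1 + I) ^ 2 * Δ := by positivity
      linarith
    · rw [map_zero, sub_zero]
      linarith [hvB 0 h0]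
  · have hc : ContinuousOn (fun t => ‖𝓕.grad (v t) - 𝓕.grad (z t)‖ ^ 2) (Icc 0 T) :=
      ((𝓕.grad.continuous.comp_continuousOn (hv.continuousOn hT.le)).sub
        (𝓕.grad.continuous.comp_continuousOn (hz.continuousOn hT.le))).norm.pow 2
    -- The mean of the squared gradient error over `[0, Δ]` is at most one, so it cannot exceed two
    -- throughout. The value `z s` then has a bounded gradient, and `v` moves by only `O(√Δ)` up to
    -- time `s`.
    obtain ⟨s, hs, hs2⟩ : ∃ s ∈ Icc 0 Δ, ‖𝓕.grad (v s) - 𝓕.grad (z s)‖ ^ 2 ≤ 2 := by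
      by_contra! hcon
      have hiT : IntervalIntegrable (fun t => ‖𝓕.grad (v t) - 𝓕.grad (z t)‖ ^ 2) volume 0 T := by
        refine ContinuousOn.intervalIntegrable ?_
        rwa [uIcc_of_le hT.le]
      have hiΔ : IntervalIntegrable (fun t => ‖𝓕.grad (v t) - 𝓕.grad (z t)‖ ^ 2) volume 0 Δ := by
        refine ContinuousOn.intervalIntegrable ?_
        rw [uIcc_of_le hΔ.le]
        exact hc.mono (Icc_subset_Icc_right hTΔ)
      have h1 : ∫ _ in (0 : ℝ)..Δ, (2 : ℝ) ≤
          ∫ s in (0 : ℝ)..Δ, ‖𝓕.grad (v s) - 𝓕.grad (z s)‖ ^ 2 :=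
        intervalIntegral.integral_mono_on hΔ.le (by simp) hiΔ fun s hs => (hcon s hs).le
      have h2 := intervalIntegral.integral_mono_interval le_rfl hΔ.le hTΔ
        (Filter.Eventually.of_forall fun r => sq_nonneg _) hiT
      simp only [intervalIntegral.integral_const, sub_zero, smul_eq_mul] at h1
      linarith
    have hsT : s ∈ Icc 0 T := ⟨hs.1, hs.2.trans hTΔ⟩
    refine ⟨z s, hzm s hsT, ?_, ?_⟩
    · have h1 := norm_sub_sq_le_mul_integral hT.le hΔ hv hv' hI hsT hs.2
      have h2 := (𝓕.norm_val_le_norm (v 0 - v s)).trans h1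
      have h3 := hA s hsT
      have e : 𝓕.val (v 0) - 𝓕.val (z s) = 𝓕.val (v 0 - v s) + (𝓕.val (v s) - 𝓕.val (z s)) := by
        rw [map_sub]; abel
      have h4 : ‖𝓕.val (v 0) - 𝓕.val (z s)‖ ≤
          ‖𝓕.val (v 0 - v s)‖ + ‖𝓕.val (v s) - 𝓕.val (z s)‖ := by
        rw [e]; exact norm_add_le _ _
      have h5 := pow_le_pow_left₀ (norm_nonneg _) h4 2
      have h6 := add_sq_le (a := ‖𝓕.val (v 0 - v s)‖) (b := ‖𝓕.val (v s) - 𝓕.val (z s)‖)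
      have h7 : 0 ≤ (𝓕.poincare * B) ^ 2 * T⁻¹ * Δ := by positivity
      linarith
    · have h1 : ‖𝓕.grad (v s) - 𝓕.grad (z s)‖ ≤ 2 := by
        nlinarith [norm_nonneg (𝓕.grad (v s) - 𝓕.grad (z s))]
      have e : 𝓕.grad (v 0) - 𝓕.grad (z s) =
        𝓕.grad (v 0) - 𝓕.grad (v s) + (𝓕.grad (v s) - 𝓕.grad (z s)) := by abel
      rw [e]
      have h2 := norm_add_le (𝓕.grad (v 0) - 𝓕.grad (v s)) (𝓕.grad (v s) - 𝓕.grad (z s))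
      have h3 := norm_sub_le (𝓕.grad (v 0)) (𝓕.grad (v s))
      linarith [hvB 0 h0, hvB s hsT]

variable [CompleteSpace H] [CompleteSpace L] [CompleteSpace G]

/-- Every discrete path may be replaced by one with the Galerkin orthogonality of the linear
parabolic problem and a bounded gradient, at the cost of a constant. -/
theorem exists_improved_path (hν : 0 < ν) (hT : 0 < T) (𝓕 : FlowForms H L G P) (B I : ℝ) :
    ∃ A, 0 ≤ A ∧ ∀ {v v' : ℝ → H}, HasTimeDeriv T v v' →
      MemLp v' 2 (volume.restrict (Icc 0 T)) → ∫ s in (0 : ℝ)..T, ‖v' s‖ ^ 2 ≤ I →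
      (∀ t ∈ Icc 0 T, ‖𝓕.grad (v t)‖ ≤ B) →
      ∀ (W : Submodule ℝ H) [FiniteDimensional ℝ W] {z z' : ℝ → H}, HasTimeDeriv T z z' →
      (∀ t ∈ Icc 0 T, z t ∈ W) → ∀ {n : ℝ → ℝ}, IntegrableOn (fun t => n t ^ 2) (Icc 0 T) →
      (∀ᵐ t ∂(volume.restrict (Icc 0 T)), ∀ χ,
        |⟪𝓕.val (v' t) - 𝓕.val (z' t), 𝓕.val χ⟫_ℝ| ≤ n t * ‖𝓕.grad χ‖) →
      ∀ {Δ}, 0 < Δ →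
      ∫ s in (0 : ℝ)..T, (n s ^ 2 + ‖𝓕.grad (v s) - 𝓕.grad (z s)‖ ^ 2) ≤ Δ →
      ∃ w w' : ℝ → H, HasTimeDeriv T w w' ∧ (∀ t, w t ∈ W) ∧
        (∀ t, ∀ χ ∈ W, ⟪𝓕.val (v' t) - 𝓕.val (w' t), 𝓕.val χ⟫_ℝ
          + ν * ⟪𝓕.grad (v t) - 𝓕.grad (w t), 𝓕.grad χ⟫_ℝ = 0) ∧
        (∀ t ∈ Icc 0 T, ‖𝓕.grad (w t)‖ ≤ A) ∧
        (∀ t ∈ Icc 0 T, ‖𝓕.val (v t) - 𝓕.val (w t)‖ ^ 2 ≤ A * Δ) ∧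
        ∫ s in (0 : ℝ)..T, ‖𝓕.grad (v s) - 𝓕.grad (w s)‖ ^ 2 ≤ A * Δ := by
  -- In multiples of `Δ`, `a₁` bounds `‖v - z‖²` uniformly in time, `a₂` the squared error of the
  -- initial value, and `a₃` the energy of `w - z`. The gradient bound `a₄` for `v - w` does not
  -- involve `Δ`.
  set a₁ := 1 + T⁻¹ * 𝓕.poincare ^ 2 with ha₁
  set a₂ := (𝓕.poincare * B) ^ 2 * T⁻¹ + 2 * (1 + I) ^ 2 + 2 * a₁ with ha₂
  set a₃ := 2 * a₂ + 2 * a₁ + (2 * ν⁻¹ + 2 * ν) with ha₃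
  set a₄ := Real.exp T * ((2 * B + 2) ^ 2 + (1 + (2 * ν)⁻¹) * I) with ha₄
  set A := |B| + (1 + |a₄|) + (2 * a₁ + 2 * a₃) + (2 + 2 * (ν⁻¹ * a₃)) with hA
  have ha₁0 : 0 ≤ a₁ := by positivity
  have ha₂0 : 0 ≤ a₂ := by positivity
  have ha₃0 : 0 ≤ a₃ := by positivity
  refine ⟨A, by positivity, ?_⟩
  intro v v' hv hv' hI hvB W _ z z' hz hzm n hn hzn Δ hΔ hzΔ
  have h0 : (0 : ℝ) ∈ Icc 0 T := ⟨le_rfl, hT.le⟩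
  have hc : ∀ {u u' : ℝ → H}, HasTimeDeriv T u u' →
      ContinuousOn (fun t => 𝓕.grad (u t)) (Icc 0 T) := fun hu =>
    𝓕.grad.continuous.comp_continuousOn (hu.continuousOn hT.le)
  have hsq : ∀ {u u' y y' : ℝ → H}, HasTimeDeriv T u u' → HasTimeDeriv T y y' →
      IntervalIntegrable (fun t => ‖𝓕.grad (u t) - 𝓕.grad (y t)‖ ^ 2) volume 0 T := by
    intro u u' y y' hu hy
    refine ContinuousOn.intervalIntegrable ?_
    rw [uIcc_of_le hT.le]
    exact ((hc hu).sub (hc hy)).norm.pow 2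
  have hη : ∀ t ∈ Icc 0 T, ‖𝓕.val (v t) - 𝓕.val (z t)‖ ^ 2 ≤ a₁ * Δ := fun t ht => by
    have := norm_val_sq_le_energy (𝓕 := 𝓕) hT (hv.sub hz) hn
      (by simpa only [map_sub] using hzn) t ht
    simp only [map_sub] at this
    exact this.trans (mul_le_mul_of_nonneg_left hzΔ ha₁0)
  have hni : IntervalIntegrable (fun t => n t ^ 2) volume 0 T := by
    rwa [intervalIntegrable_iff_integrableOn_Icc_of_le hT.le]
  have hzD : ∫ s in (0 : ℝ)..T, ‖𝓕.grad (v s) - 𝓕.grad (z s)‖ ^ 2 ≤ Δ := by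
    refine le_trans ?_ hzΔ
    exact intervalIntegral.integral_mono_on hT.le (hsq hv hz) (hni.add (hsq hv hz))
      fun s _ => le_add_of_nonneg_left (sq_nonneg _)
  obtain ⟨w₀, hw₀, hw₀v, hw₀g⟩ := exists_initial_value hT hΔ hv hv' hI hvB hz hzm hzD hη
  obtain ⟨w, w', hw, hwm, hwm', hw0, horth⟩ := 𝓕.exists_parabolic_projection ν W hT.le hv hw₀
  have hq := parabolic_quasi_optimal hν hT.le hv hw hwm horth hz hzm hn hzn
  have hψ0 : ‖𝓕.val (w 0) - 𝓕.val (z 0)‖ ^ 2 ≤ (2 * a₂ + 2 * a₁) * Δ := by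
    have e : 𝓕.val (w 0) - 𝓕.val (z 0) =
        (𝓕.val (v 0) - 𝓕.val (z 0)) - (𝓕.val (v 0) - 𝓕.val w₀) := by rw [hw0]; abel
    have h1 := pow_le_pow_left₀ (norm_nonneg _)
      (norm_sub_le (𝓕.val (v 0) - 𝓕.val (z 0)) (𝓕.val (v 0) - 𝓕.val w₀)) 2
    rw [← e] at h1
    have h2 := add_sq_le (a := ‖𝓕.val (v 0) - 𝓕.val (z 0)‖) (b := ‖𝓕.val (v 0) - 𝓕.val w₀‖)
    linarith [hη 0 h0]
  have hψ : ∀ t ∈ Icc 0 T, ‖𝓕.val (w t) - 𝓕.val (z t)‖ ^ 2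
        + ∫ s in (0 : ℝ)..t, ν * ‖𝓕.grad (w s) - 𝓕.grad (z s)‖ ^ 2 ≤ a₃ * Δ := fun t ht => by
    have h1 := hq t ht
    have h2 := mul_le_mul_of_nonneg_left hzΔ (show 0 ≤ 2 * ν⁻¹ + 2 * ν by positivity)
    rw [ha₃, add_mul]
    linarith
  refine ⟨w, w', hw, hwm, horth, fun t ht => ?_, fun t ht => ?_, ?_⟩
  · have h1 := norm_grad_parabolic_le hν hT.le hv hv' hw hwm' horth t ht
    have h2 : ‖𝓕.grad (v t) - 𝓕.grad (w t)‖ ^ 2 ≤ a₄ := by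
      refine h1.trans ?_
      rw [hw0, ha₄]
      gcongr
    have h3 : ‖𝓕.grad (v t) - 𝓕.grad (w t)‖ ≤ 1 + |a₄| := by
      have := le_abs_self a₄
      nlinarith [norm_nonneg (𝓕.grad (v t) - 𝓕.grad (w t)),
        sq_nonneg (‖𝓕.grad (v t) - 𝓕.grad (w t)‖ - 1)]
    have h4 : ‖𝓕.grad (w t)‖ ≤ ‖𝓕.grad (v t)‖ + ‖𝓕.grad (v t) - 𝓕.grad (w t)‖ :=
      norm_le_norm_add_norm_sub _ _
    have h5 := hvB t ht
    have h6 := le_abs_self B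
    have h7 : 0 ≤ (2 * a₁ + 2 * a₃) + (2 + 2 * (ν⁻¹ * a₃)) := by positivity
    linarith
  · have h1 := hψ t ht
    have h2 : 0 ≤ ∫ s in (0 : ℝ)..t, ν * ‖𝓕.grad (w s) - 𝓕.grad (z s)‖ ^ 2 :=
      intervalIntegral.integral_nonneg ht.1 fun _ _ => by positivity
    have h3 := hη t ht
    have e : 𝓕.val (v t) - 𝓕.val (w t) =
        (𝓕.val (v t) - 𝓕.val (z t)) - (𝓕.val (w t) - 𝓕.val (z t)) := by abel
    have h4 := pow_le_pow_left₀ (norm_nonneg _)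
      (norm_sub_le (𝓕.val (v t) - 𝓕.val (z t)) (𝓕.val (w t) - 𝓕.val (z t))) 2
    rw [← e] at h4
    have h5 := add_sq_le (a := ‖𝓕.val (v t) - 𝓕.val (z t)‖)
      (b := ‖𝓕.val (w t) - 𝓕.val (z t)‖)
    have h6 : 0 ≤ (|B| + (1 + |a₄|) + (2 + 2 * (ν⁻¹ * a₃))) * Δ := by positivity
    rw [hA]
    linarith
  · have h1 := hψ T ⟨hT.le, le_rfl⟩
    rw [intervalIntegral.integral_const_mul] at h1
    have h2 : ∫ s in (0 : ℝ)..T, ‖𝓕.grad (w s) - 𝓕.grad (z s)‖ ^ 2 ≤ ν⁻¹ * (a₃ * Δ) := by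
      rw [le_inv_mul_iff₀ hν]
      linarith [sq_nonneg ‖𝓕.val (w T) - 𝓕.val (z T)‖]
    have h3 : ∫ s in (0 : ℝ)..T, ‖𝓕.grad (v s) - 𝓕.grad (w s)‖ ^ 2 ≤
        ∫ s in (0 : ℝ)..T, (2 * ‖𝓕.grad (v s) - 𝓕.grad (z s)‖ ^ 2
          + 2 * ‖𝓕.grad (w s) - 𝓕.grad (z s)‖ ^ 2) := by
      refine intervalIntegral.integral_mono_on hT.le (hsq hv hw)
        (((hsq hv hz).const_mul 2).add ((hsq hw hz).const_mul 2)) fun s _ => ?_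
      have e : 𝓕.grad (v s) - 𝓕.grad (w s) =
        (𝓕.grad (v s) - 𝓕.grad (z s)) - (𝓕.grad (w s) - 𝓕.grad (z s)) := by abel
      have h4 := pow_le_pow_left₀ (norm_nonneg _)
        (norm_sub_le (𝓕.grad (v s) - 𝓕.grad (z s)) (𝓕.grad (w s) - 𝓕.grad (z s))) 2
      rw [← e] at h4
      have h5 := add_sq_le (a := ‖𝓕.grad (v s) - 𝓕.grad (z s)‖)
        (b := ‖𝓕.grad (w s) - 𝓕.grad (z s)‖)
      linarith
    rw [intervalIntegral.integral_add ((hsq hv hz).const_mul 2) ((hsq hw hz).const_mul 2),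
      intervalIntegral.integral_const_mul, intervalIntegral.integral_const_mul] at h3
    have h6 : 0 ≤ (|B| + (1 + |a₄|) + (2 * a₁ + 2 * a₃)) * Δ := by positivity
    rw [hA]
    linarith

end FlowForms

/-! ### Sobolev, Poincaré and Ladyzhenskaya inequalities in `H¹₀`. -/

section Interpolation

variable {α F : Type*} [MeasurableSpace α] {μ : Measure α} [NormedAddCommGroup F]

/-- Interpolation of the fourth power between the second and the sixth. -/
theorem eLpNorm_four_pow_le {f : α → F} (hf : AEStronglyMeasurable f μ) :
    eLpNorm f 4 μ ^ 4 ≤ eLpNorm f 2 μ * eLpNorm f 6 μ ^ 3 := by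
  have h4 := eLpNorm_nnreal_pow_eq_lintegral (f := f) (μ := μ) (p := 4) (by norm_num)
  have h2 := eLpNorm_nnreal_pow_eq_lintegral (f := f) (μ := μ) (p := 2) (by norm_num)
  have h6 := eLpNorm_nnreal_pow_eq_lintegral (f := f) (μ := μ) (p := 6) (by norm_num)
  simp only [NNReal.coe_ofNat, ENNReal.coe_ofNat] at h2 h4 h6
  -- Cauchy–Schwarz for the splitting `|f|⁴ = |f| * |f|³`.
  have hmul := ENNReal.lintegral_mul_le_Lp_mul_Lq μ Real.HolderConjugate.two_two
    hf.enorm (hf.enorm.pow_const 3)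
  have e4 : eLpNorm f 4 μ ^ 4 = ∫⁻ x, ((fun x => ‖f x‖ₑ) * (fun x => ‖f x‖ₑ ^ 3)) x ∂μ := by
    rw [← ENNReal.rpow_natCast]
    simp only [Nat.cast_ofNat]
    rw [h4]
    refine lintegral_congr fun x => ?_
    rw [Pi.mul_apply, ← pow_succ', ← ENNReal.rpow_natCast]
    norm_num
  rw [e4]
  refine hmul.trans (le_of_eq ?_)
  congr 1
  · rw [← h2, ← ENNReal.rpow_mul]
    norm_num
  · have e6 : ∫⁻ a, (‖f a‖ₑ ^ 3) ^ (2 : ℝ) ∂μ = eLpNorm f 6 μ ^ (6 : ℝ) := by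
      rw [h6]
      refine lintegral_congr fun x => ?_
      rw [← ENNReal.rpow_natCast, ← ENNReal.rpow_mul]
      norm_num
    rw [e6, ← ENNReal.rpow_mul, ← ENNReal.rpow_natCast]
    norm_num

end Interpolation

/-- A product of three functions in `L⁴`, `L²` and `L⁴` is integrable. -/
theorem integrable_mul_mul {α : Type*} [MeasurableSpace α] {μ : Measure α} {f g h : α → ℝ}
    (hf : MemLp f 4 μ) (hg : MemLp g 2 μ) (hh : MemLp h 4 μ) :
    Integrable (fun x => f x * g x * h x) μ ∧
      ‖∫ x, f x * g x * h x ∂μ‖ₑ ≤ eLpNorm f 4 μ * eLpNorm g 2 μ * eLpNorm h 4 μ := by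
  have : ENNReal.HolderTriple 4 4 2 := ⟨by
    rw [← two_mul, show (4 : ℝ≥0∞) = 2 * 2 by norm_num, ENNReal.mul_inv (by simp) (by simp),
      ← mul_assoc, ENNReal.mul_inv_cancel (by simp) (by simp), one_mul]⟩
  have hfh : MemLp (f * h) 2 μ := hh.mul hf
  have hfg : Integrable (g * (f * h)) μ := hg.integrable_mul hfh
  have e : (fun x => f x * g x * h x) = g * (f * h) := by
    funext x; simp only [Pi.mul_apply]; ring
  refine ⟨e ▸ hfg, ?_⟩
  rw [e]
  calc ‖∫ x, (g * (f * h)) x ∂μ‖ₑ ≤ ∫⁻ x, ‖(g * (f * h)) x‖ₑ ∂μ := enorm_integral_le_lintegral_enorm _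
    _ = eLpNorm (g • (f * h)) 1 μ := by rw [eLpNorm_one_eq_lintegral_enorm]; rfl
    _ ≤ eLpNorm g 2 μ * eLpNorm (f • h) 2 μ :=
        eLpNorm_smul_le_mul_eLpNorm hfh.1 hg.1
    _ ≤ eLpNorm g 2 μ * (eLpNorm f 4 μ * eLpNorm h 4 μ) := by
        gcongr
        exact eLpNorm_smul_le_mul_eLpNorm hh.1 hf.1
    _ = _ := by ring

variable {d : ℕ} {Ω : Set (Vec d)}

theorem norm_fderiv_le (φ : Vec d → Vec d) (x : Vec d) :
    ‖fderiv ℝ φ x‖ ≤ d * ‖classicalGrad φ x‖ := by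
  refine ContinuousLinearMap.opNorm_le_bound _ (by positivity) fun y => ?_
  have hcol : ∀ i, ‖fderiv ℝ φ x (EuclideanSpace.single i 1)‖ ≤ ‖classicalGrad φ x‖ := fun i => by
    rw [EuclideanSpace.norm_eq, EuclideanSpace.norm_eq]
    refine Real.sqrt_le_sqrt ?_
    rw [Fintype.sum_prod_type]
    exact Finset.single_le_sum
      (f := fun i => ∑ j, ‖classicalGrad φ x (i, j)‖ ^ 2)
      (fun i _ => Finset.sum_nonneg fun j _ => sq_nonneg _) (Finset.mem_univ i)
  have hy : y = ∑ i, y i • EuclideanSpace.single i (1 : ℝ) := by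
    ext j
    simp [Finset.sum_apply, Pi.single_apply]
  calc ‖fderiv ℝ φ x y‖ = ‖∑ i, y i • fderiv ℝ φ x (EuclideanSpace.single i 1)‖ := by
        conv_lhs => rw [hy]
        rw [map_sum]
        simp only [map_smul]
    _ ≤ ∑ i, ‖y i • fderiv ℝ φ x (EuclideanSpace.single i 1)‖ := norm_sum_le _ _
    _ ≤ ∑ _i : Fin d, ‖y‖ * ‖classicalGrad φ x‖ := by
        refine Finset.sum_le_sum fun i _ => ?_
        rw [norm_smul]
        exact mul_le_mul (PiLp.norm_apply_le y i) (hcol i) (norm_nonneg _) (norm_nonneg _)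
    _ = _ := by simp; ring

theorem continuous_classicalGrad {φ : Vec d → Vec d} (hφ : ContDiff ℝ ∞ φ) :
    Continuous (classicalGrad φ) := by
  have h : Continuous (fderiv ℝ φ) := hφ.continuous_fderiv (by simp)
  refine (PiLp.continuous_toLp 2 _).comp (continuous_pi fun ij => ?_)
  exact (EuclideanSpace.proj (𝕜 := ℝ) ij.2).continuous.comp (h.clm_apply continuous_const)

/-- The Sobolev inequality for smooth fields with compact support in a bounded set. -/
theorem exists_sobolev_test (hd : d = 2 ∨ d = 3) (hΩb : Bornology.IsBounded Ω) :
    ∃ C : NNReal, ∀ φ : Vec d → Vec d, ContDiff ℝ ∞ φ → tsupport φ ⊆ Ω →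
      eLpNorm φ 6 (volume.restrict Ω) ≤ C * eLpNorm (classicalGrad φ) 2 (volume.restrict Ω) := by
  have hvol : volume Ω < ⊤ := hΩb.measure_lt_top
  have hfin : Module.finrank ℝ (Vec d) = d := by simp
  -- The Sobolev inequality needs `p < d` and `1/p - 1/d ≤ 1/6`. For `d = 3` the choice `p = 2` is
  -- critical; for `d = 2` it is excluded, and `p = 3/2` gives `2/3 - 1/2 = 1/6`. Finite volume
  -- raises the gradient exponent to two.
  obtain ⟨p, hp1, hp2, hpd, hp6⟩ : ∃ p : NNReal, 1 ≤ p ∧ p ≤ 2 ∧ p < (d : NNReal) ∧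
      (p : ℝ)⁻¹ - (d : ℝ)⁻¹ ≤ (6 : ℝ)⁻¹ := by
    rcases hd with rfl | rfl
    · refine ⟨3 / 2, ?_, ?_, ?_, ?_⟩
      · rw [← NNReal.coe_le_coe]; norm_num
      · rw [← NNReal.coe_le_coe]; norm_num
      · rw [← NNReal.coe_lt_coe]; norm_num
      · norm_num
    · refine ⟨2, ?_, ?_, ?_, ?_⟩
      · norm_num
      · norm_num
      · norm_num
      · norm_num
  set K := eLpNormLESNormFDerivOfLeConst (Vec d) (volume : Measure (Vec d)) Ω p 6
  set V := ((volume.restrict Ω) univ) ^ (1 / (p : ℝ≥0∞).toReal - 1 / (2 : ℝ≥0∞).toReal) with hV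
  have hVtop : V ≠ ⊤ := by
    refine ENNReal.rpow_ne_top_of_nonneg ?_ (by simpa using hvol.ne)
    have : (p : ℝ) ≤ 2 := by exact_mod_cast hp2
    have h1 : (1 : ℝ) ≤ p := by exact_mod_cast hp1
    simp only [ENNReal.coe_toReal, ENNReal.toReal_ofNat, sub_nonneg]
    exact one_div_le_one_div_of_le (by linarith) this
  refine ⟨K * (d * V.toNNReal), fun φ hφ hsupp => ?_⟩
  have hsub : Function.support φ ⊆ Ω := (subset_tsupport φ).trans hsupp
  have h1 := eLpNorm_le_eLpNorm_fderiv_of_le (volume : Measure (Vec d)) (u := φ) (s := Ω)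
    (hφ.of_le (by exact_mod_cast le_top)) hsub (p := p) (q := 6) hp1
    (by rw [hfin]; exact hpd) (by rw [hfin]; exact_mod_cast hp6) hΩb
  have h2 : eLpNorm (fderiv ℝ φ) p volume ≤
      d * eLpNorm (classicalGrad φ) p (volume.restrict Ω) := by
    rw [← eLpNorm_restrict_eq_of_support_subset (f := fderiv ℝ φ)
      ((support_fderiv_subset ℝ (f := φ)).trans hsupp)]
    have := eLpNorm_le_mul_eLpNorm_of_ae_le_mul (μ := volume.restrict Ω) (c := (d : ℝ))
      (Filter.Eventually.of_forall (norm_fderiv_le φ)) (p := p)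
    simpa using this
  have h3 : eLpNorm (classicalGrad φ) p (volume.restrict Ω) ≤
      eLpNorm (classicalGrad φ) 2 (volume.restrict Ω) * V :=
    eLpNorm_le_eLpNorm_mul_rpow_measure_univ (by exact_mod_cast hp2)
      (continuous_classicalGrad hφ).aestronglyMeasurable
  rw [eLpNorm_restrict_eq_of_support_subset hsub]
  calc eLpNorm φ 6 volume ≤ K * eLpNorm (fderiv ℝ φ) p volume := by exact_mod_cast h1
    _ ≤ K * (d * (eLpNorm (classicalGrad φ) 2 (volume.restrict Ω) * V)) := by
        gcongr
        exact h2.trans (by gcongr)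
    _ = _ := by
        rw [ENNReal.coe_mul, ENNReal.coe_mul, ENNReal.coe_toNNReal hVtop, ENNReal.coe_natCast]
        ring

theorem classicalGrad_add {φ ψ : Vec d → Vec d} (hφ : ContDiff ℝ ∞ φ) (hψ : ContDiff ℝ ∞ ψ) :
    classicalGrad (φ + ψ) = classicalGrad φ + classicalGrad ψ := by
  funext x
  ext ij
  simp only [classicalGrad, Pi.add_apply, PiLp.add_apply]
  rw [fderiv_add (hφ.differentiable (by simp)).differentiableAt
    (hψ.differentiable (by simp)).differentiableAt]
  rfl

theorem classicalGrad_smul (c : ℝ) {φ : Vec d → Vec d} (hφ : ContDiff ℝ ∞ φ) :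
    classicalGrad (c • φ) = c • classicalGrad φ := by
  funext x
  ext ij
  simp only [classicalGrad, Pi.smul_apply, PiLp.smul_apply]
  rw [fderiv_const_smul (hφ.differentiable (by simp)).differentiableAt]
  rfl

/-- The test pairs form a subspace. -/
theorem span_testPairs (Ω : Set (Vec d)) :
    (Submodule.span ℝ (testPairs Ω) : Set (WithLp 2 (L2 Ω (Vec d) × L2 Ω (Mat d)))) =
      testPairs Ω := by
  let S : Submodule ℝ (WithLp 2 (L2 Ω (Vec d) × L2 Ω (Mat d))) :=
    { carrier := testPairs Ω
      zero_mem' := by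
        refine ⟨0, contDiff_const, HasCompactSupport.zero, by simp [tsupport], ?_, ?_⟩
        · exact Lp.coeFn_zero _ _ _
        · have : classicalGrad (0 : Vec d → Vec d) = 0 := by
            funext x
            ext ij
            simp [classicalGrad]
          rw [this]
          exact Lp.coeFn_zero _ _ _
      add_mem' := by
        rintro a b ⟨φ, hφ, hφc, hφs, ha1, ha2⟩ ⟨ψ, hψ, hψc, hψs, hb1, hb2⟩
        refine ⟨φ + ψ, hφ.add hψ, hφc.add hψc,
          (tsupport_add φ ψ).trans (union_subset hφs hψs), ?_, ?_⟩
        · exact (Lp.coeFn_add _ _).trans (ha1.add hb1)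
        · rw [classicalGrad_add hφ hψ]
          exact (Lp.coeFn_add _ _).trans (ha2.add hb2)
      smul_mem' := by
        rintro c a ⟨φ, hφ, hφc, hφs, ha1, ha2⟩
        refine ⟨c • φ, hφ.const_smul c, hφc.smul_left (f := fun _ => c),
          (tsupport_smul_subset_right (fun _ => c) φ).trans hφs, ?_, ?_⟩
        · exact (Lp.coeFn_smul _ _).trans (ha1.const_smul c)
        · rw [classicalGrad_smul c hφ]
          exact (Lp.coeFn_smul _ _).trans (ha2.const_smul c) }
  have : Submodule.span ℝ (testPairs Ω) = S := Submodule.span_eq S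
  rw [this]
  rfl

/-- The test pairs already form a subspace, so the closure of their span consists of limits of test
pairs themselves. -/
theorem H10.exists_seq_tendsto (u : H10 Ω) :
    ∃ h : ℕ → WithLp 2 (L2 Ω (Vec d) × L2 Ω (Mat d)), (∀ n, h n ∈ testPairs Ω) ∧
      Filter.Tendsto h Filter.atTop (nhds (u : WithLp 2 (L2 Ω (Vec d) × L2 Ω (Mat d)))) := by
  have h : (u : WithLp 2 (L2 Ω (Vec d) × L2 Ω (Mat d))) ∈ closure (testPairs Ω) := by
    rw [← span_testPairs]
    exact u.2
  exact mem_closure_iff_seq_limit.1 h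

instance : CompleteSpace (H10 Ω) := by
  unfold H10
  infer_instance

/-- The embedding of `H¹₀` into `L²` as a continuous linear map. -/
noncomputable def valCLM (Ω : Set (Vec d)) : H10 Ω →L[ℝ] L2 Ω (Vec d) :=
  (WithLp.fstL 2 ℝ _ _).comp (H10 Ω).subtypeL

/-- The gradient as a continuous linear map. -/
noncomputable def gradCLM (Ω : Set (Vec d)) : H10 Ω →L[ℝ] L2 Ω (Mat d) :=
  (WithLp.sndL 2 ℝ _ _).comp (H10 Ω).subtypeL

@[simp] theorem valCLM_apply (u : H10 Ω) : valCLM Ω u = val u := rfl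

@[simp] theorem gradCLM_apply (u : H10 Ω) : gradCLM Ω u = grad u := rfl

theorem H10.norm_sq_eq (u : H10 Ω) : ‖u‖ ^ 2 = ‖val u‖ ^ 2 + ‖grad u‖ ^ 2 :=
  WithLp.prod_norm_sq_eq_of_L2 (u : WithLp 2 (L2 Ω (Vec d) × L2 Ω (Mat d)))

/-- The Sobolev inequality in `H¹₀`. -/
theorem exists_sobolev (hd : d = 2 ∨ d = 3) (hΩb : Bornology.IsBounded Ω) :
    ∃ C : NNReal, ∀ u : H10 Ω, eLpNorm (val u) 6 (volume.restrict Ω) ≤ C * ‖grad u‖ₑ := by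
  obtain ⟨C, hC⟩ := exists_sobolev_test hd hΩb
  refine ⟨C, fun u => le_of_forall_gt fun c hc => ?_⟩
  obtain ⟨h, hmem, hlim⟩ := H10.exists_seq_tendsto u
  have hfst : Filter.Tendsto (fun n => (h n).fst) Filter.atTop (nhds (val u)) :=
    ((WithLp.fstL 2 ℝ _ _).continuous.tendsto _).comp hlim
  have hsnd : Filter.Tendsto (fun n => (h n).snd) Filter.atTop (nhds (grad u)) :=
    ((WithLp.sndL 2 ℝ _ _).continuous.tendsto _).comp hlim
  have hlt : ∃ c' < c, C * ‖grad u‖ₑ < c' := exists_between hc |>.imp fun _ h => ⟨h.2, h.1⟩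
  obtain ⟨c', hc', hcc⟩ := hlt
  refine lt_of_le_of_lt ?_ hc'
  have hev : ∀ᶠ n in Filter.atTop, C * ‖(h n).snd‖ₑ < c' :=
    (ENNReal.Tendsto.const_mul hsnd.enorm (Or.inr ENNReal.coe_ne_top)).eventually_lt_const hcc
  -- Convergence in `L²` says nothing directly about the `L⁶` norm. An almost everywhere convergent
  -- subsequence does, since that norm is lower semicontinuous under such limits.
  obtain ⟨ns, hns, hae⟩ := (tendstoInMeasure_of_tendsto_Lp hfst).exists_seq_tendsto_ae
  refine Lp.eLpNorm_le_of_ae_tendsto (f := fun i => ((h (ns i)).fst : Vec d → Vec d))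
    ?_ (fun n => (Lp.memLp _).1) hae
  filter_upwards [hns.tendsto_atTop.eventually hev] with n hn
  obtain ⟨φ, hφ, -, hφs, h1, h2⟩ := hmem (ns n)
  refine le_trans ?_ hn.le
  rw [eLpNorm_congr_ae h1, Lp.enorm_def, eLpNorm_congr_ae h2]
  exact hC φ hφ hφs

/-- Integration by parts against a smooth function with compact support. -/
theorem setIntegral_mul_grad (u : H10 Ω) {g : Vec d → ℝ} (hg : ContDiff ℝ ∞ g)
    (hgc : HasCompactSupport g) (i j : Fin d) :
    ∫ x in Ω, g x * grad u x (i, j) =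
      -∫ x in Ω, fderiv ℝ g x (EuclideanSpace.single i 1) * val u x j := by
  have hg' : Continuous fun x => fderiv ℝ g x (EuclideanSpace.single i 1) :=
    (hg.continuous_fderiv (by simp)).clm_apply continuous_const
  have hgc' : HasCompactSupport fun x => fderiv ℝ g x (EuclideanSpace.single i 1) :=
    hgc.fderiv_apply (𝕜 := ℝ) _
  have ha : MemLp (fun x => g x • (EuclideanSpace.single (i, j) 1 : Mat d)) 2
      (volume.restrict Ω) :=
    (Continuous.memLp_of_hasCompactSupport (μ := volume) (hg.continuous.smul continuous_const)
      hgc.smul_right).restrict Ω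
  have hb : MemLp (fun x => fderiv ℝ g x (EuclideanSpace.single i 1) •
      (EuclideanSpace.single j 1 : Vec d)) 2 (volume.restrict Ω) :=
    (Continuous.memLp_of_hasCompactSupport (μ := volume) (hg'.smul continuous_const)
      hgc'.smul_right).restrict Ω
  have ea : ∀ y : L2 Ω (Mat d), ⟪ha.toLp, y⟫_ℝ = ∫ x in Ω, g x * y x (i, j) := fun y => by
    rw [L2.inner_def]
    refine integral_congr_ae ?_
    filter_upwards [ha.coeFn_toLp] with x hx
    rw [hx, real_inner_smul_left, EuclideanSpace.inner_single_left]
    simp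
  have eb : ∀ y : L2 Ω (Vec d), ⟪hb.toLp, y⟫_ℝ =
      ∫ x in Ω, fderiv ℝ g x (EuclideanSpace.single i 1) * y x j := fun y => by
    rw [L2.inner_def]
    refine integral_congr_ae ?_
    filter_upwards [hb.coeFn_toLp] with x hx
    rw [hx, real_inner_smul_left, EuclideanSpace.inner_single_left]
    simp
  rw [← ea, ← eb]
  obtain ⟨h, hmem, hlim⟩ := H10.exists_seq_tendsto u
  have hfst : Filter.Tendsto (fun n => (h n).fst) Filter.atTop (nhds (val u)) :=
    ((WithLp.fstL 2 ℝ _ _).continuous.tendsto _).comp hlim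
  have hsnd : Filter.Tendsto (fun n => (h n).snd) Filter.atTop (nhds (grad u)) :=
    ((WithLp.sndL 2 ℝ _ _).continuous.tendsto _).comp hlim
  -- Both sides are continuous in the pair of field and gradient, so classical integration by parts
  -- for test fields suffices. The field vanishes outside `Ω`, and therefore `g` need not.
  refine tendsto_nhds_unique (Filter.Tendsto.inner tendsto_const_nhds hsnd)
    ((Filter.Tendsto.inner tendsto_const_nhds hfst).neg.congr fun n => ?_)
  obtain ⟨φ, hφ, hφc, hφs, h1, h2⟩ := hmem n
  rw [ea, eb]
  have hφj : ContDiff ℝ ∞ fun x => φ x j :=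
    (EuclideanSpace.proj (𝕜 := ℝ) j).contDiff.comp hφ
  have hφjc : HasCompactSupport fun x => φ x j :=
    hφc.comp_left (g := fun y : Vec d => y j) rfl
  have hφj' : ∀ x, fderiv ℝ (fun x => φ x j) x (EuclideanSpace.single i 1) =
      classicalGrad φ x (i, j) := fun x => by
    have := (EuclideanSpace.proj (𝕜 := ℝ) (ι := Fin d) j).hasFDerivAt.comp x
      ((hφ.differentiable (by simp)) x).hasFDerivAt
    have e := this.fderiv
    change fderiv ℝ (fun x => φ x j) x = _ at e
    rw [e]
    rfl
  have hc1 : Continuous fun x => fderiv ℝ (fun x => φ x j) x (EuclideanSpace.single i 1) :=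
    (hφj.continuous_fderiv (by simp)).clm_apply continuous_const
  have hibp := integral_mul_fderiv_eq_neg_fderiv_mul_of_integrable (μ := (volume : Measure (Vec d)))
    (f := g) (g := fun x => φ x j) (v := EuclideanSpace.single i 1)
    ((hg'.mul hφj.continuous).integrable_of_hasCompactSupport hgc'.mul_right)
    ((hg.continuous.mul hc1).integrable_of_hasCompactSupport hgc.mul_right)
    ((hg.continuous.mul hφj.continuous).integrable_of_hasCompactSupport hgc.mul_right)
    (fun x _ => hg.differentiable (by simp) x) (fun x _ => hφj.differentiable (by simp) x)
  have z1 : ∀ x ∉ Ω, φ x = 0 := fun x hx => image_eq_zero_of_notMem_tsupport fun h => hx (hφs h)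
  have z2 : ∀ x ∉ Ω, fderiv ℝ (fun x => φ x j) x = 0 := fun x hx => by
    have : x ∉ tsupport fun x => φ x j := fun h =>
      hx (hφs (tsupport_comp_subset (g := fun y : Vec d => y j) rfl φ h))
    exact image_eq_zero_of_notMem_tsupport fun h => this (tsupport_fderiv_subset ℝ h)
  have l : ∫ x in Ω, g x * (h n).snd x (i, j) =
      ∫ x, g x * fderiv ℝ (fun x => φ x j) x (EuclideanSpace.single i 1) := by
    rw [← setIntegral_eq_integral_of_forall_compl_eq_zero (s := Ω)
      (f := fun x => g x * fderiv ℝ (fun x => φ x j) x (EuclideanSpace.single i 1))]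
    · refine integral_congr_ae ?_
      filter_upwards [h2] with x hx
      rw [hx, hφj']
    · intro x hx
      rw [z2 x hx]
      simp
  have r : ∫ x in Ω, fderiv ℝ g x (EuclideanSpace.single i 1) * (h n).fst x j =
      ∫ x, fderiv ℝ g x (EuclideanSpace.single i 1) * φ x j := by
    rw [← setIntegral_eq_integral_of_forall_compl_eq_zero (s := Ω)
      (f := fun x => fderiv ℝ g x (EuclideanSpace.single i 1) * φ x j)]
    · refine integral_congr_ae ?_
      filter_upwards [h1] with x hx
      rw [hx]
    · intro x hx
      rw [z1 x hx]
      simp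
  rw [l, r, hibp]

theorem integrable_grad_apply (hΩb : Bornology.IsBounded Ω) (u : H10 Ω) (ij : Fin d × Fin d) :
    Integrable (fun x => grad u x ij) (volume.restrict Ω) := by
  have : IsFiniteMeasure (volume.restrict Ω) := ⟨by simpa using hΩb.measure_lt_top⟩
  have h := (Lp.memLp (grad u)).integrable one_le_two
  exact ContinuousLinearMap.integrable_comp (EuclideanSpace.proj (𝕜 := ℝ) ij) h

/-- An element of `H¹₀` is determined by the underlying field. -/
theorem val_injective (hΩo : IsOpen Ω) (hΩb : Bornology.IsBounded Ω) :
    Function.Injective (valCLM Ω) := by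
  rw [injective_iff_map_eq_zero]
  intro u hu
  rw [valCLM_apply] at hu
  -- Elements are pairs, so it must be shown that a zero field forces a zero gradient: by parts,
  -- each gradient entry integrates to zero against all test functions in `Ω`.
  have hgrad : ∀ ij : Fin d × Fin d, ∀ᵐ x ∂(volume.restrict Ω), grad u x ij = 0 := fun ⟨i, j⟩ => by
    rw [ae_restrict_iff' hΩo.measurableSet]
    refine hΩo.ae_eq_zero_of_integral_contDiff_smul_eq_zero
      (IntegrableOn.locallyIntegrableOn (integrable_grad_apply hΩb u (i, j))) fun g hg hgc hgs => ?_
    simp only [smul_eq_mul]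
    rw [← setIntegral_eq_integral_of_forall_compl_eq_zero (s := Ω), setIntegral_mul_grad u hg hgc]
    · rw [neg_eq_zero]
      refine integral_eq_zero_of_ae ?_
      rw [hu]
      filter_upwards [Lp.coeFn_zero (Vec d) 2 (volume.restrict Ω)] with x hx
      rw [hx]
      simp
    · intro x hx
      rw [image_eq_zero_of_notMem_tsupport fun h => hx (hgs h), zero_mul]
  have hg0 : grad u = 0 := by
    refine Lp.ext ?_
    filter_upwards [ae_all_iff.2 hgrad, Lp.coeFn_zero (Mat d) 2 (volume.restrict Ω)] with x hx h0
    rw [h0]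
    ext ij
    exact hx ij
  have := H10.norm_sq_eq u
  rw [hu, hg0] at this
  simpa using this

/-- The `L⁴` norm of an element of `H¹₀`. -/
noncomputable def normFour (u : H10 Ω) : ℝ := (eLpNorm (val u) 4 (volume.restrict Ω)).toReal

theorem normFour_nonneg (u : H10 Ω) : 0 ≤ normFour u := ENNReal.toReal_nonneg

/-- The Poincaré, Sobolev and Ladyzhenskaya inequalities. -/
theorem exists_normFour_le (hd : d = 2 ∨ d = 3) (hΩb : Bornology.IsBounded Ω) :
    ∃ K : ℝ, 0 ≤ K ∧ ∀ u : H10 Ω, MemLp (val u) 4 (volume.restrict Ω) ∧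
      ‖val u‖ ≤ K * ‖grad u‖ ∧ normFour u ≤ K * ‖grad u‖ ∧
      normFour u ^ 4 ≤ K * ‖val u‖ * ‖grad u‖ ^ 3 := by
  obtain ⟨C, hC⟩ := exists_sobolev hd hΩb
  have hvol : (volume.restrict Ω) univ ≠ ⊤ := by simpa using hΩb.measure_lt_top.ne
  -- On a set of finite volume every exponent up to six inherits the `L⁶` bound; `p = 2` is
  -- Poincaré's inequality.
  have key : ∀ p : ℝ≥0∞, p ≤ 6 → 0 < p.toReal → ∃ D : ℝ, 0 ≤ D ∧ ∀ u : H10 Ω,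
      eLpNorm (val u) p (volume.restrict Ω) ≤ ENNReal.ofReal (D * ‖grad u‖) := by
    intro p hp hp0
    set V := ((volume.restrict Ω) univ) ^ (1 / p.toReal - 1 / (6 : ℝ≥0∞).toReal)
    have hV : V ≠ ⊤ := by
      refine ENNReal.rpow_ne_top_of_nonneg ?_ hvol
      rw [sub_nonneg]
      exact one_div_le_one_div_of_le hp0 (ENNReal.toReal_mono (by simp) hp)
    refine ⟨C * V.toReal, by positivity, fun u => ?_⟩
    calc eLpNorm (val u) p (volume.restrict Ω)
        ≤ eLpNorm (val u) 6 (volume.restrict Ω) * V :=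
          eLpNorm_le_eLpNorm_mul_rpow_measure_univ hp (Lp.memLp _).1
      _ ≤ C * ‖grad u‖ₑ * V := by gcongr; exact hC u
      _ = _ := by
        rw [ENNReal.ofReal_mul (by positivity), ENNReal.ofReal_mul (by positivity),
          ENNReal.ofReal_toReal hV, ofReal_norm, ENNReal.ofReal_coe_nnreal]
        ring
  obtain ⟨D₂, hD₂, h2⟩ := key 2 (by norm_num) (by norm_num)
  obtain ⟨D₄, hD₄, h4⟩ := key 4 (by norm_num) (by norm_num)
  have hC3 : (0 : ℝ) ≤ (C : ℝ) ^ 3 := by positivity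
  refine ⟨D₂ + D₄ + (C : ℝ) ^ 3, by positivity, fun u => ?_⟩
  have hg := norm_nonneg (grad u)
  have hv := norm_nonneg (val u)
  refine ⟨⟨(Lp.memLp _).1, (h4 u).trans_lt ENNReal.ofReal_lt_top⟩, ?_, ?_, ?_⟩
  · rw [Lp.norm_def]
    refine (ENNReal.toReal_le_of_le_ofReal (by positivity) (h2 u)).trans ?_
    gcongr
    linarith
  · refine (ENNReal.toReal_le_of_le_ofReal (by positivity) (h4 u)).trans ?_
    gcongr
    linarith
  · have h := (eLpNorm_four_pow_le (Lp.memLp (val u)).1).trans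
      (mul_le_mul_right (pow_le_pow_left' (hC u) 3) _)
    rw [← Lp.enorm_def] at h
    have h' := ENNReal.toReal_mono (by finiteness) h
    rw [ENNReal.toReal_pow, ENNReal.toReal_mul, ENNReal.toReal_pow, ENNReal.toReal_mul,
      toReal_enorm, toReal_enorm, ENNReal.coe_toReal] at h'
    calc normFour u ^ 4 ≤ ‖val u‖ * (C * ‖grad u‖) ^ 3 := h'
      _ = (C : ℝ) ^ 3 * ‖val u‖ * ‖grad u‖ ^ 3 := by ring
      _ ≤ _ := by gcongr; linarith

/-- Young's inequality without fractional powers. If `n ≤ δ * b`, both terms on the left are small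
multiples of `b ^ 2`. Otherwise `b ≤ n / δ`, and the quartic bound forces `n ≤ K / δ ^ 3 * a`. It is
applied with `n`, `a`, `b` the `L⁴`, `L²` and gradient norms. -/
theorem exists_absorb_of_pow_four_le {K : ℝ} (hK : 0 ≤ K) {ε : ℝ} (hε : 0 < ε) :
    ∃ C, 0 ≤ C ∧ ∀ a b n : ℝ, 0 ≤ a → 0 ≤ b → 0 ≤ n → n ^ 4 ≤ K * a * b ^ 3 →
      n ^ 2 + K * n * b ≤ ε * b ^ 2 + C * a ^ 2 := by
  set δ := min 1 (ε / (1 + K)) with hδdef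
  have hK1 : 0 < 1 + K := by linarith
  have hδ : 0 < δ := lt_min one_pos (div_pos hε hK1)
  have hδ1 : δ ≤ 1 := min_le_left _ _
  have hδε : δ * (1 + K) ≤ ε := by
    rw [← le_div_iff₀ hK1]
    exact min_le_right _ _
  refine ⟨(K / δ ^ 3) ^ 2 * (1 + K / δ), by positivity, fun a b n ha hb hn h => ?_⟩
  rcases le_or_gt n (δ * b) with hc | hc
  · have h1 : n ^ 2 ≤ δ * b ^ 2 := by
      calc n ^ 2 ≤ (δ * b) ^ 2 := pow_le_pow_left₀ hn hc 2
        _ = δ * (δ * b ^ 2) := by ring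
        _ ≤ 1 * (δ * b ^ 2) := by gcongr
        _ = _ := by ring
    have h2 : K * n * b ≤ K * (δ * b) * b := by gcongr
    have h3 : δ * (1 + K) * b ^ 2 ≤ ε * b ^ 2 := by gcongr
    have h4 : 0 ≤ (K / δ ^ 3) ^ 2 * (1 + K / δ) * a ^ 2 := by positivity
    nlinarith
  · have hn0 : 0 < n := lt_of_le_of_lt (by positivity) hc
    have hb' : b ≤ n / δ := by
      rw [le_div_iff₀ hδ]
      linarith
    have hna : n ≤ K / δ ^ 3 * a := by
      have h1 : n * n ^ 3 ≤ K / δ ^ 3 * a * n ^ 3 := by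
        calc n * n ^ 3 = n ^ 4 := by ring
          _ ≤ K * a * b ^ 3 := h
          _ ≤ K * a * (n / δ) ^ 3 := by gcongr
          _ = _ := by field_simp
      exact le_of_mul_le_mul_right h1 (by positivity)
    calc n ^ 2 + K * n * b ≤ n ^ 2 + K * n * (n / δ) := by gcongr
      _ = (1 + K / δ) * n ^ 2 := by ring
      _ ≤ (1 + K / δ) * (K / δ ^ 3 * a) ^ 2 := by gcongr
      _ = 0 + (K / δ ^ 3) ^ 2 * (1 + K / δ) * a ^ 2 := by ring
      _ ≤ _ := by gcongr; positivity

/-! ### The convective, divergence and viscous forms. -/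

section Convection

variable (h4 : ∀ u : H10 Ω, MemLp (val u) 4 (volume.restrict Ω))
include h4

/-- Hölder's inequality with exponents 4, 2, 4, each component being dominated by its vector or
matrix. -/
theorem conv_term (u v w : H10 Ω) (i j : Fin d) :
    Integrable (fun x => val u x i * grad v x (i, j) * val w x j) (volume.restrict Ω) ∧
      |∫ x in Ω, val u x i * grad v x (i, j) * val w x j| ≤
        normFour u * ‖grad v‖ * normFour w := by
  have hp : ∀ u : H10 Ω, ∀ i, MemLp (fun x => val u x i) 4 (volume.restrict Ω) ∧
      eLpNorm (fun x => val u x i) 4 (volume.restrict Ω) ≤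
        eLpNorm (val u) 4 (volume.restrict Ω) := fun u i =>
    ⟨(EuclideanSpace.proj (𝕜 := ℝ) i).comp_memLp' (h4 u),
      eLpNorm_mono fun x => PiLp.norm_apply_le _ _⟩
  have hg : MemLp (fun x => grad v x (i, j)) 2 (volume.restrict Ω) ∧
      eLpNorm (fun x => grad v x (i, j)) 2 (volume.restrict Ω) ≤ ‖grad v‖ₑ := by
    rw [Lp.enorm_def]
    exact ⟨(EuclideanSpace.proj (𝕜 := ℝ) (i, j)).comp_memLp' (Lp.memLp (grad v)),
      eLpNorm_mono fun x => PiLp.norm_apply_le _ _⟩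
  obtain ⟨hi, hb⟩ := integrable_mul_mul (hp u i).1 hg.1 (hp w j).1
  refine ⟨hi, ?_⟩
  have hb' := hb.trans (mul_le_mul' (mul_le_mul' (hp u i).2 hg.2) (hp w j).2)
  have := ENNReal.toReal_mono (ENNReal.mul_ne_top (ENNReal.mul_ne_top (h4 u).2.ne (by simp))
    (h4 w).2.ne) hb'
  rwa [ENNReal.toReal_mul, ENNReal.toReal_mul, toReal_enorm, toReal_enorm, Real.norm_eq_abs]
    at this

theorem integrable_conv (u v w : H10 Ω) :
    Integrable (fun x => ∑ i, ∑ j, val u x i * grad v x (i, j) * val w x j)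
      (volume.restrict Ω) :=
  integrable_finsetSum _ fun i _ => integrable_finsetSum _ fun j _ => (conv_term h4 u v w i j).1

theorem abs_conv_le (u v w : H10 Ω) :
    |conv u v w| ≤ d ^ 2 * (normFour u * ‖grad v‖ * normFour w) := by
  unfold conv
  rw [integral_finsetSum _ fun i _ => integrable_finsetSum _ fun j _ => (conv_term h4 u v w i j).1]
  refine (Finset.abs_sum_le_sum_abs _ _).trans ?_
  calc ∑ i : Fin d, |∫ x in Ω, ∑ j, val u x i * grad v x (i, j) * val w x j|
      ≤ ∑ i : Fin d, ∑ j : Fin d, normFour u * ‖grad v‖ * normFour w := by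
        refine Finset.sum_le_sum fun i _ => ?_
        rw [integral_finsetSum _ fun j _ => (conv_term h4 u v w i j).1]
        exact (Finset.abs_sum_le_sum_abs _ _).trans
          (Finset.sum_le_sum fun j _ => (conv_term h4 u v w i j).2)
    _ = _ := by simp; ring

theorem conv_add_left (u u' v w : H10 Ω) : conv (u + u') v w = conv u v w + conv u' v w := by
  unfold conv
  rw [← integral_add (integrable_conv h4 u v w) (integrable_conv h4 u' v w)]
  refine integral_congr_ae ?_
  filter_upwards [Lp.coeFn_add (val u) (val u')] with x hx
  have : val (u + u') x = val u x + val u' x := hx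
  simp only [this, PiLp.add_apply, add_mul, Finset.sum_add_distrib]

theorem conv_add_middle (u v v' w : H10 Ω) : conv u (v + v') w = conv u v w + conv u v' w := by
  unfold conv
  rw [← integral_add (integrable_conv h4 u v w) (integrable_conv h4 u v' w)]
  refine integral_congr_ae ?_
  filter_upwards [Lp.coeFn_add (grad v) (grad v')] with x hx
  have : grad (v + v') x = grad v x + grad v' x := hx
  simp only [this, PiLp.add_apply, mul_add, add_mul, Finset.sum_add_distrib]

theorem conv_add_right (u v w w' : H10 Ω) : conv u v (w + w') = conv u v w + conv u v w' := by
  unfold conv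
  rw [← integral_add (integrable_conv h4 u v w) (integrable_conv h4 u v w')]
  refine integral_congr_ae ?_
  filter_upwards [Lp.coeFn_add (val w) (val w')] with x hx
  have : val (w + w') x = val w x + val w' x := hx
  simp only [this, PiLp.add_apply, mul_add, Finset.sum_add_distrib]

end Convection

theorem conv_smul_left (c : ℝ) (u v w : H10 Ω) : conv (c • u) v w = c * conv u v w := by
  unfold conv
  rw [← integral_const_mul]
  refine integral_congr_ae ?_
  filter_upwards [Lp.coeFn_smul c (val u)] with x hx
  have : val (c • u) x = c • val u x := hx
  simp only [this, PiLp.smul_apply, smul_eq_mul, Finset.mul_sum, mul_assoc]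

theorem conv_smul_middle (c : ℝ) (u v w : H10 Ω) : conv u (c • v) w = c * conv u v w := by
  unfold conv
  rw [← integral_const_mul]
  refine integral_congr_ae ?_
  filter_upwards [Lp.coeFn_smul c (grad v)] with x hx
  have : grad (c • v) x = c • grad v x := hx
  simp only [this, PiLp.smul_apply, smul_eq_mul, Finset.mul_sum, mul_assoc, mul_left_comm c]

theorem conv_smul_right (c : ℝ) (u v w : H10 Ω) : conv u v (c • w) = c * conv u v w := by
  unfold conv
  rw [← integral_const_mul]
  refine integral_congr_ae ?_
  filter_upwards [Lp.coeFn_smul c (val w)] with x hx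
  have : val (c • w) x = c • val w x := hx
  simp only [this, PiLp.smul_apply, smul_eq_mul, Finset.mul_sum, mul_left_comm c]

/-- The skew-symmetric convective form as a trilinear map. -/
noncomputable def triLinear (h4 : ∀ u : H10 Ω, MemLp (val u) 4 (volume.restrict Ω)) :
    H10 Ω →ₗ[ℝ] H10 Ω →ₗ[ℝ] H10 Ω →ₗ[ℝ] ℝ :=
  LinearMap.mk₂ ℝ
    (fun u v =>
      { toFun := fun w => triForm u v w
        map_add' := fun w w' => by
          simp only [triForm, conv_add_right h4, conv_add_middle h4]
          ring
        map_smul' := fun c w => by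
          simp only [triForm, conv_smul_right, conv_smul_middle, RingHom.id_apply, smul_eq_mul]
          ring })
    (fun u u' v => by
      ext w
      simp only [triForm, LinearMap.coe_mk, AddHom.coe_mk, LinearMap.add_apply, conv_add_left h4]
      ring)
    (fun c u v => by
      ext w
      simp only [triForm, LinearMap.coe_mk, AddHom.coe_mk, LinearMap.smul_apply, conv_smul_left,
        smul_eq_mul]
      ring)
    (fun u v v' => by
      ext w
      simp only [triForm, LinearMap.coe_mk, AddHom.coe_mk, LinearMap.add_apply,
        conv_add_middle h4, conv_add_right h4]
      ring)
    (fun c u v => by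
      ext w
      simp only [triForm, LinearMap.coe_mk, AddHom.coe_mk, LinearMap.smul_apply, conv_smul_middle,
        conv_smul_right, smul_eq_mul]
      ring)

theorem triLinear_apply (h4 : ∀ u : H10 Ω, MemLp (val u) 4 (volume.restrict Ω))
    (u v w : H10 Ω) : triLinear h4 u v w = triForm u v w := rfl

theorem abs_triForm_le (h4 : ∀ u : H10 Ω, MemLp (val u) 4 (volume.restrict Ω)) (u v w : H10 Ω) :
    |triForm u v w| ≤
      d ^ 2 / 2 * (normFour u * (‖grad v‖ * normFour w + ‖grad w‖ * normFour v)) := by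
  unfold triForm
  have h1 := abs_conv_le h4 u v w
  have h2 := abs_conv_le h4 u w v
  rw [abs_le] at *
  constructor <;> nlinarith

/-- The trace of a gradient. -/
noncomputable def traceCLM (d : ℕ) : Mat d →L[ℝ] ℝ := ∑ i, EuclideanSpace.proj (𝕜 := ℝ) (i, i)

/-- The divergence as a continuous linear map. -/
noncomputable def divCLM (Ω : Set (Vec d)) : H10 Ω →L[ℝ] L2 Ω ℝ :=
  ((traceCLM d).compLpL 2 (volume.restrict Ω)).comp (gradCLM Ω)

theorem divForm_eq_inner (u : H10 Ω) (p : L2 Ω ℝ) : divForm u p = ⟪divCLM Ω u, p⟫_ℝ := by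
  rw [L2.inner_def, divForm]
  refine integral_congr_ae ?_
  filter_upwards [(traceCLM d).coeFn_compLpL (grad u)] with x hx
  have : divCLM Ω u x = traceCLM d (grad u x) := hx
  rw [this, real_inner_comm]
  simp [traceCLM]

theorem abs_divForm_le (u : H10 Ω) (p : L2 Ω ℝ) :
    |divForm u p| ≤ ‖(traceCLM d).compLpL 2 (volume.restrict Ω)‖ * ‖grad u‖ * ‖p‖ := by
  rw [divForm_eq_inner]
  refine (abs_real_inner_le_norm _ _).trans ?_
  gcongr
  exact ((traceCLM d).compLpL 2 (volume.restrict Ω)).le_opNorm (grad u)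

/-- The divergence pairing as a bilinear map. -/
noncomputable def divBilinear (Ω : Set (Vec d)) : H10 Ω →ₗ[ℝ] L2 Ω ℝ →ₗ[ℝ] ℝ :=
  LinearMap.mk₂ ℝ divForm
    (fun u u' p => by simp only [divForm_eq_inner, map_add, inner_add_left])
    (fun c u p => by simp only [divForm_eq_inner, map_smul, real_inner_smul_left, smul_eq_mul])
    (fun u p p' => by simp only [divForm_eq_inner, inner_add_right])
    (fun c u p => by simp only [divForm_eq_inner, real_inner_smul_right, smul_eq_mul])

section Viscosity

variable {c : Vec d → ℝ} {cmax : ℝ}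

theorem integrable_gradForm (hcm : Measurable c)
    (hc : ∀ᵐ x ∂(volume.restrict Ω), 0 ≤ c x ∧ c x ≤ cmax) (u w : H10 Ω) :
    Integrable (fun x => c x * ⟪grad u x, grad w x⟫_ℝ) (volume.restrict Ω) := by
  refine (L2.integrable_inner (𝕜 := ℝ) (grad u) (grad w)).bdd_mul (c := cmax)
    hcm.aestronglyMeasurable ?_
  filter_upwards [hc] with x hx
  rw [Real.norm_of_nonneg hx.1]
  exact hx.2

theorem gradForm_add_left (hcm : Measurable c)
    (hc : ∀ᵐ x ∂(volume.restrict Ω), 0 ≤ c x ∧ c x ≤ cmax) (u u' w : H10 Ω) :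
    gradForm c (u + u') w = gradForm c u w + gradForm c u' w := by
  unfold gradForm
  rw [← integral_add (integrable_gradForm hcm hc u w) (integrable_gradForm hcm hc u' w)]
  refine integral_congr_ae ?_
  filter_upwards [Lp.coeFn_add (grad u) (grad u')] with x hx
  have : grad (u + u') x = grad u x + grad u' x := hx
  rw [this, inner_add_left, mul_add]

theorem gradForm_smul_left (a : ℝ) (u w : H10 Ω) :
    gradForm c (a • u) w = a * gradForm c u w := by
  unfold gradForm
  rw [← integral_const_mul]
  refine integral_congr_ae ?_
  filter_upwards [Lp.coeFn_smul a (grad u)] with x hx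
  have : grad (a • u) x = a • grad u x := hx
  rw [this, real_inner_smul_left, mul_left_comm]

theorem gradForm_comm (u w : H10 Ω) : gradForm c u w = gradForm c w u := by
  unfold gradForm
  simp only [real_inner_comm]

theorem abs_gradForm_le (hcm : Measurable c)
    (hc : ∀ᵐ x ∂(volume.restrict Ω), 0 ≤ c x ∧ c x ≤ cmax) (u w : H10 Ω) :
    |gradForm c u w| ≤ cmax * ‖grad u‖ * ‖grad w‖ := by
  have hle : ∀ᵐ x ∂(volume.restrict Ω), ‖c x • grad u x‖ ≤ cmax * ‖grad u x‖ := by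
    filter_upwards [hc] with x hx
    rw [norm_smul, Real.norm_of_nonneg hx.1]
    exact mul_le_mul_of_nonneg_right hx.2 (norm_nonneg _)
  have hm : MemLp (fun x => c x • grad u x) 2 (volume.restrict Ω) :=
    (Lp.memLp (grad u)).of_le_mul (hcm.aestronglyMeasurable.smul (Lp.memLp (grad u)).1) hle
  have e : gradForm c u w = ⟪hm.toLp, grad w⟫_ℝ := by
    rw [L2.inner_def, gradForm]
    refine integral_congr_ae ?_
    filter_upwards [hm.coeFn_toLp] with x hx
    rw [hx, real_inner_smul_left]
  rw [e]
  refine (abs_real_inner_le_norm _ _).trans ?_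
  gcongr
  refine Lp.norm_le_mul_norm_of_ae_le_mul ?_
  filter_upwards [hm.coeFn_toLp, hle] with x hx hx'
  rw [hx]
  exact hx'

/-- The weighted gradient form as a continuous bilinear map. -/
noncomputable def gradBilinear (Ω : Set (Vec d)) (hcm : Measurable c)
    (hc : ∀ᵐ x ∂(volume.restrict Ω), 0 ≤ c x ∧ c x ≤ cmax) (hcmax : 0 ≤ cmax) :
    H10 Ω →L[ℝ] H10 Ω →L[ℝ] ℝ :=
  LinearMap.mkContinuous₂
    (LinearMap.mk₂ ℝ (gradForm c) (gradForm_add_left hcm hc) gradForm_smul_left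
      (fun u w w' => by simp only [gradForm_comm u, gradForm_add_left hcm hc])
      (fun a u w => by simp only [gradForm_comm u, gradForm_smul_left, smul_eq_mul]))
    cmax fun u w => by
      have hle : ∀ u : H10 Ω, ‖grad u‖ ≤ ‖u‖ := fun u => by
        refine abs_le_of_sq_le_sq' ?_ (norm_nonneg _) |>.2
        rw [H10.norm_sq_eq]
        linarith [sq_nonneg ‖val u‖]
      refine (abs_gradForm_le hcm hc u w).trans ?_
      gcongr <;> exact hle _

theorem gradBilinear_apply (hcm : Measurable c)
    (hc : ∀ᵐ x ∂(volume.restrict Ω), 0 ≤ c x ∧ c x ≤ cmax) (hcmax : 0 ≤ cmax) (u w : H10 Ω) :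
    gradBilinear Ω hcm hc hcmax u w = gradForm c u w := rfl

/-- Since `k` is constant in space, the time-dependent viscous form splits into two fixed forms,
with time entering only through the factor `k`. -/
theorem gradForm_add_mul (hcm : Measurable c)
    (hc : ∀ᵐ x ∂(volume.restrict Ω), 0 ≤ c x ∧ c x ≤ cmax) (ν k : ℝ) (u w : H10 Ω) :
    gradForm (fun x => ν + c x * k) u w = ν * ⟪grad u, grad w⟫_ℝ + k * gradForm c u w := by
  rw [L2.inner_def, gradForm, gradForm, ← integral_const_mul, ← integral_const_mul,
    ← integral_add ((L2.integrable_inner _ _).const_mul _)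
      ((integrable_gradForm hcm hc u w).const_mul _)]
  congr 1
  funext x
  ring

theorem gradForm_mul (k : ℝ) (u w : H10 Ω) :
    gradForm (fun x => c x * k) u w = k * gradForm c u w := by
  rw [gradForm, gradForm, ← integral_const_mul]
  congr 1
  funext x
  ring

end Viscosity

/-! ### The abstract hypotheses verified for the model. -/

/-- The forms of the 1/2-equation model on `H¹₀(Ω)`. -/
theorem exists_flowForms (hd : d = 2 ∨ d = 3) (hΩo : IsOpen Ω) (hΩb : Bornology.IsBounded Ω)
    {c : Vec d → ℝ} {cmax : ℝ} (hcm : Measurable c) (hc : ∀ x ∈ Ω, 0 ≤ c x ∧ c x ≤ cmax)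
    (hcmax : 0 ≤ cmax) :
    ∃ 𝓕 : FlowForms (H10 Ω) (L2 Ω (Vec d)) (L2 Ω (Mat d)) (L2 Ω ℝ),
      (∀ u, 𝓕.val u = val u) ∧ (∀ u, 𝓕.grad u = grad u) ∧ (∀ u w, 𝓕.visc u w = gradForm c u w) ∧
      (∀ u v w, 𝓕.conv u v w = triForm u v w) ∧ ∀ u p, 𝓕.div u p = divForm u p := by
  obtain ⟨K, hK, hKu⟩ := exists_normFour_le hd hΩb
  have h4 : ∀ u : H10 Ω, MemLp (val u) 4 (volume.restrict Ω) := fun u => (hKu u).1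
  have hc' : ∀ᵐ x ∂(volume.restrict Ω), 0 ≤ c x ∧ c x ≤ cmax :=
    ae_restrict_of_forall_mem hΩo.measurableSet hc
  refine ⟨
    { val := valCLM Ω
      grad := gradCLM Ω
      visc := gradBilinear Ω hcm hc' hcmax
      conv := triLinear h4
      div := divBilinear Ω
      poincare := K
      viscBound := cmax
      convBound := d ^ 2 * K ^ 2
      divBound := ‖(traceCLM d).compLpL 2 (volume.restrict Ω)‖
      poincare_nonneg := hK
      viscBound_nonneg := hcmax
      convBound_nonneg := by positivity
      norm_sq_eq := H10.norm_sq_eq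
      norm_val_le := fun u => (hKu u).2.1
      val_injective := val_injective hΩo hΩb
      visc_symm := gradForm_comm
      visc_nonneg := fun u => ?_
      abs_visc_le := abs_gradForm_le hcm hc'
      conv_self := fun u w => ?_
      abs_conv_le := fun u v w => ?_
      abs_conv_self_le := fun ε hε => ?_
      abs_div_le := abs_divForm_le }, fun _ => rfl, fun _ => rfl, fun _ _ => rfl,
      fun _ _ _ => rfl, fun _ _ => rfl⟩
  · rw [gradBilinear_apply]
    refine integral_nonneg_of_ae ?_
    filter_upwards [hc'] with x hx
    exact mul_nonneg hx.1 real_inner_self_nonneg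
  · rw [triLinear_apply, triForm, sub_self]
  · rw [triLinear_apply]
    refine (abs_triForm_le h4 u v w).trans ?_
    have hu := (hKu u).2.2.1
    have hv := (hKu v).2.2.1
    have hw := (hKu w).2.2.1
    have := normFour_nonneg u
    simp only [gradCLM_apply]
    calc (d : ℝ) ^ 2 / 2 * (normFour u * (‖grad v‖ * normFour w + ‖grad w‖ * normFour v))
        ≤ (d : ℝ) ^ 2 / 2 * (K * ‖grad u‖ * (‖grad v‖ * (K * ‖grad w‖)
          + ‖grad w‖ * (K * ‖grad v‖))) := by
          have h0 := normFour_nonneg v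
          have h1 := normFour_nonneg w
          gcongr
      _ = _ := by ring
  -- The rescaled `ε` compensates the factor `d ^ 2 / 2` in the bound for the trilinear form.
  · obtain ⟨C, hC, hCa⟩ := exists_absorb_of_pow_four_le hK
      (ε := ε / ((d : ℝ) ^ 2 / 2 + 1)) (by positivity)
    refine ⟨(d : ℝ) ^ 2 / 2 * C, by positivity, fun u w => ?_⟩
    rw [triLinear_apply]
    simp only [gradCLM_apply, valCLM_apply]
    refine (abs_triForm_le h4 u w u).trans ?_
    have hn := normFour_nonneg u
    have h := hCa ‖val u‖ ‖grad u‖ (normFour u) (norm_nonneg _) (norm_nonneg _) hn (hKu u).2.2.2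
    have hw := (hKu w).2.2.1
    have hε' : (d : ℝ) ^ 2 / 2 * (ε / ((d : ℝ) ^ 2 / 2 + 1)) ≤ ε := by
      rw [mul_div_assoc', div_le_iff₀ (by positivity)]
      nlinarith
    calc (d : ℝ) ^ 2 / 2 * (normFour u * (‖grad w‖ * normFour u + ‖grad u‖ * normFour w))
        ≤ (d : ℝ) ^ 2 / 2 * (normFour u * (‖grad w‖ * normFour u
          + ‖grad u‖ * (K * ‖grad w‖))) := by gcongr
      _ = ‖grad w‖ * ((d : ℝ) ^ 2 / 2 * (normFour u ^ 2 + K * normFour u * ‖grad u‖)) := by ring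
      _ ≤ ‖grad w‖ * ((d : ℝ) ^ 2 / 2 * (ε / ((d : ℝ) ^ 2 / 2 + 1) * ‖grad u‖ ^ 2
          + C * ‖val u‖ ^ 2)) := by gcongr
      _ = ‖grad w‖ * ((d : ℝ) ^ 2 / 2 * (ε / ((d : ℝ) ^ 2 / 2 + 1)) * ‖grad u‖ ^ 2
          + (d : ℝ) ^ 2 / 2 * C * ‖val u‖ ^ 2) := by ring
      _ ≤ _ := by gcongr

/-! ### Uniqueness and the abstract Galerkin error estimate. -/

namespace FlowForms

variable {𝓕 : FlowForms H L G P} {ν c γ T : ℝ}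
    {f : ℝ → StrongDual ℝ H}

/-- Solutions of the model are determined by their initial values. -/
theorem IsSolution.eqOn [CompleteSpace H] [CompleteSpace L] {v₁ v₁' v₂ v₂' : ℝ → H}
    {q₁ q₂ : ℝ → P} {k₁ k₁' k₂ k₂' : ℝ → ℝ}
    (h₁ : 𝓕.IsSolution ν c γ T f ⊤ v₁ v₁' q₁ k₁ k₁')
    (h₂ : 𝓕.IsSolution ν c γ T f ⊤ v₂ v₂' q₂ k₂ k₂') (hν : 0 < ν) (hc : 0 ≤ c) (hγ : 0 ≤ γ)
    (hT : 0 ≤ T) (hf : MemLp f 2 (volume.restrict (Icc 0 T))) {Q : Submodule ℝ P}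
    (hq₁ : ∀ t ∈ Icc 0 T, q₁ t ∈ Q) (hq₂ : ∀ t ∈ Icc 0 T, q₂ t ∈ Q)
    (hv₁ : ∀ t ∈ Icc 0 T, v₁ t ∈ 𝓕.discKer ⊤ Q) (hv₂ : ∀ t ∈ Icc 0 T, v₂ t ∈ 𝓕.discKer ⊤ Q)
    (hv0 : v₁ 0 = v₂ 0) (hk0 : k₁ 0 = k₂ 0) (hk : 0 ≤ k₂ 0) :
    ∀ t ∈ Icc 0 T, v₁ t = v₂ t := by
  obtain ⟨B, hB⟩ := isCompact_Icc.exists_bound_of_continuousOn (h₁.continuousOn_grad hT)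
  have hB0 : 0 ≤ B := (norm_nonneg _).trans (hB 0 ⟨le_rfl, hT⟩)
  obtain ⟨C, -, hC⟩ := exists_error_constant (𝓕 := 𝓕) hν hc hγ hT hf
    (R := max ‖𝓕.val (v₂ 0)‖ (k₂ 0)) (le_max_of_le_left (norm_nonneg _)) hB0
  intro t ht
  -- The second solution plays the discrete one, with the whole space as `W`, and the first serves
  -- as its own comparison path and pressure. All approximation errors then vanish.
  have key := hC h₁ h₂ hq₂ hv₂ (le_max_left _ _) hk (le_max_right _ _) h₁.deriv_v hv₁
    (Filter.Eventually.of_forall fun s χ _ => by simp) hB hB hq₁ (by simp) t ht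
  rw [hv0, hk0] at key
  simp only [sub_self, norm_zero, ne_eq, OfNat.ofNat_ne_zero, not_false_eq_true, zero_pow,
    add_zero, intervalIntegral.integral_zero, mul_zero] at key
  have hint : 0 ≤ ∫ s in (0 : ℝ)..t, ν * ‖𝓕.grad (v₂ s) - 𝓕.grad (v₁ s)‖ ^ 2 :=
    intervalIntegral.integral_nonneg ht.1 fun _ _ => by positivity
  have h0 : ‖𝓕.val (v₂ t) - 𝓕.val (v₁ t)‖ ^ 2 = 0 :=
    le_antisymm (by nlinarith [sq_nonneg (k₁ t - k₂ t)]) (sq_nonneg _)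
  exact 𝓕.val_injective (sub_eq_zero.1 (norm_eq_zero.1 (pow_eq_zero_iff two_ne_zero |>.1 h0))).symm

theorem norm_sub_sq_le_two_mul {E : Type*} [NormedAddCommGroup E] (x y z : E) :
    ‖x - z‖ ^ 2 ≤ 2 * ‖x - y‖ ^ 2 + 2 * ‖y - z‖ ^ 2 := by
  have h := norm_sub_le_norm_sub_add_norm_sub x y z
  have h' := pow_le_pow_left₀ (norm_nonneg _) h 2
  nlinarith [sq_nonneg (‖x - y‖ - ‖y - z‖)]

/-- The error of the Galerkin approximation is bounded by the distance of the solution to the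
discrete spaces. -/
theorem exists_galerkin_constant [CompleteSpace H] [CompleteSpace L] [CompleteSpace G]
    (hν : 0 < ν) (hc : 0 ≤ c) (hγ : 0 ≤ γ) (hT : 0 < T)
    (hf : MemLp f 2 (volume.restrict (Icc 0 T))) {R B : ℝ} (hR : 0 ≤ R) (hB : 0 ≤ B) (I : ℝ) :
    ∃ C, 0 ≤ C ∧ ∀ {v v' q k k'}, 𝓕.IsSolution ν c γ T f ⊤ v v' q k k' →
      MemLp v' 2 (volume.restrict (Icc 0 T)) → ∫ s in (0 : ℝ)..T, ‖v' s‖ ^ 2 ≤ I →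
      (∀ t ∈ Icc 0 T, ‖𝓕.grad (v t)‖ ≤ B) →
      ∀ {W : Submodule ℝ H} [FiniteDimensional ℝ W] {Q : Submodule ℝ P} {vh vh' qh kh kh'},
      𝓕.IsSolution ν c γ T f W vh vh' qh kh kh' → (∀ t ∈ Icc 0 T, qh t ∈ Q) →
      (∀ t ∈ Icc 0 T, vh t ∈ 𝓕.discKer W Q) →
      ‖𝓕.val (vh 0)‖ ≤ R → 0 ≤ kh 0 → kh 0 ≤ R →
      ∀ {z z'}, HasTimeDeriv T z z' → (∀ t ∈ Icc 0 T, z t ∈ 𝓕.discKer W Q) →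
      ∀ {n : ℝ → ℝ}, IntegrableOn (fun t => n t ^ 2) (Icc 0 T) →
      (∀ᵐ t ∂(volume.restrict (Icc 0 T)), ∀ χ,
        |⟪𝓕.val (v' t) - 𝓕.val (z' t), 𝓕.val χ⟫_ℝ| ≤ n t * ‖𝓕.grad χ‖) →
      ∀ {p : ℝ → P}, (∀ t ∈ Icc 0 T, p t ∈ Q) →
      IntegrableOn (fun t => ‖q t - p t‖ ^ 2) (Icc 0 T) → ∀ {Δ : ℝ}, 0 < Δ →
      ∫ s in (0 : ℝ)..T, (n s ^ 2 + ‖𝓕.grad (v s) - 𝓕.grad (z s)‖ ^ 2) ≤ Δ →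
      ∫ s in (0 : ℝ)..T, ‖q s - p s‖ ^ 2 ≤ Δ →
      (∀ t ∈ Icc 0 T, ‖𝓕.val (v t) - 𝓕.val (vh t)‖ ^ 2 ≤
        C * (‖𝓕.val (v 0) - 𝓕.val (vh 0)‖ ^ 2 + (k 0 - kh 0) ^ 2 + Δ)) ∧
      (∀ t ∈ Icc 0 T, (k t - kh t) ^ 2 ≤
        C * (‖𝓕.val (v 0) - 𝓕.val (vh 0)‖ ^ 2 + (k 0 - kh 0) ^ 2 + Δ)) ∧
      ν * ∫ s in (0 : ℝ)..T, ‖𝓕.grad (v s) - 𝓕.grad (vh s)‖ ^ 2 ≤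
        C * (‖𝓕.val (v 0) - 𝓕.val (vh 0)‖ ^ 2 + (k 0 - kh 0) ^ 2 + Δ) := by
  obtain ⟨A, hA0, hA⟩ := exists_improved_path hν hT 𝓕 B I
  obtain ⟨K, hK0, hK⟩ := exists_error_constant (𝓕 := 𝓕) hν hc hγ hT.le hf hR
    (B := max B A) (le_max_of_le_left hB)
  refine ⟨2 * K * (3 + 3 * A) + 2 * A + 2 * ν * A, by positivity, ?_⟩
  intro v v' q k k' h hv' hI hvB W _ Q vh vh' qh kh kh' hh hqh hvh hvh0 hkh0 hkhR z z' hz hzm n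
    hn hneg p hp hpq Δ hΔ hzΔ hpΔ
  have h0T : (0 : ℝ) ∈ Icc 0 T := ⟨le_rfl, hT.le⟩
  have hfin : FiniteDimensional ℝ (𝓕.discKer W Q) :=
    Submodule.finiteDimensional_of_le (S₂ := W) fun u hu => hu.1
  -- The given path `z` is used only to produce `w`, which has the orthogonality and gradient bound
  -- required by the error estimate; triangle inequalities through `w` conclude.
  obtain ⟨w, w', hw, hwm, horth, hwA, hwv, hwg⟩ := hA h.deriv_v hv' hI hvB (𝓕.discKer W Q) hz hzm
    hn hneg hΔ hzΔ
  have key := hK h hh hqh hvh hvh0 hkh0 hkhR hw (fun t _ => hwm t)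
    (Filter.Eventually.of_forall horth) (fun t ht => (hvB t ht).trans (le_max_left _ _))
    (fun t ht => (hwA t ht).trans (le_max_right _ _)) hp hpq
  have cv := h.continuousOn_grad hT.le
  have cvh := hh.continuousOn_grad hT.le
  have cw : ContinuousOn (fun t => 𝓕.grad (w t)) (Icc 0 T) :=
    𝓕.grad.continuous.comp_continuousOn (hw.continuousOn hT.le)
  have ii : ∀ {a b : ℝ → G}, ContinuousOn a (Icc 0 T) → ContinuousOn b (Icc 0 T) →
      IntervalIntegrable (fun s => ‖a s - b s‖ ^ 2) volume 0 T := fun ha hb =>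
    ContinuousOn.intervalIntegrable (by rw [uIcc_of_le hT.le]; exact (ha.sub hb).norm.pow 2)
  have hpq' : IntervalIntegrable (fun t => ‖q t - p t‖ ^ 2) volume 0 T :=
    (intervalIntegrable_iff_integrableOn_Icc_of_le hT.le).2 hpq
  rw [intervalIntegral.integral_add (ii cv cw) hpq'] at key
  set e := ‖𝓕.val (v 0) - 𝓕.val (vh 0)‖ ^ 2 + (k 0 - kh 0) ^ 2 with he
  have he0 : 0 ≤ e := by positivity
  have hini : ‖𝓕.val (vh 0) - 𝓕.val (w 0)‖ ^ 2 + (k 0 - kh 0) ^ 2 ≤ 2 * e + 2 * A * Δ := by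
    have h1 := norm_sub_sq_le_two_mul (𝓕.val (vh 0)) (𝓕.val (v 0)) (𝓕.val (w 0))
    rw [norm_sub_rev (𝓕.val (vh 0)) (𝓕.val (v 0))] at h1
    have h2 := hwv 0 h0T
    linarith [sq_nonneg (k 0 - kh 0)]
  set S := K * (3 + 3 * A) * (e + Δ) with hS
  have hS0 : 0 ≤ S := by positivity
  have key' : ∀ t ∈ Icc 0 T, ‖𝓕.val (vh t) - 𝓕.val (w t)‖ ^ 2 + (k t - kh t) ^ 2
          + ∫ s in (0 : ℝ)..t, ν * ‖𝓕.grad (vh s) - 𝓕.grad (w s)‖ ^ 2 ≤ S := fun t ht => by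
    refine (key t ht).trans ?_
    rw [hS, mul_assoc]
    refine mul_le_mul_of_nonneg_left ?_ hK0
    have : 0 ≤ A * e := mul_nonneg hA0 he0
    nlinarith
  have hgn : ∀ t ∈ Icc 0 T, 0 ≤ ∫ s in (0 : ℝ)..t, ν * ‖𝓕.grad (vh s) - 𝓕.grad (w s)‖ ^ 2 :=
    fun t ht => intervalIntegral.integral_nonneg ht.1 fun _ _ => by positivity
  have hAe : 0 ≤ A * e := mul_nonneg hA0 he0
  have hAd : 0 ≤ A * Δ := mul_nonneg hA0 hΔ.le
  have hνA : 0 ≤ ν * (A * (e + Δ)) := by positivity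
  have hC : (2 * K * (3 + 3 * A) + 2 * A + 2 * ν * A) * (e + Δ) =
      2 * S + 2 * (A * e + A * Δ) + 2 * (ν * (A * (e + Δ))) := by rw [hS]; ring
  rw [hC]
  refine ⟨fun t ht => ?_, fun t ht => ?_, ?_⟩
  · have h1 := norm_sub_sq_le_two_mul (𝓕.val (v t)) (𝓕.val (w t)) (𝓕.val (vh t))
    rw [norm_sub_rev (𝓕.val (w t))] at h1
    have h2 := hwv t ht
    linarith [key' t ht, hgn t ht, sq_nonneg (k t - kh t)]
  · linarith [key' t ht, hgn t ht, sq_nonneg ‖𝓕.val (vh t) - 𝓕.val (w t)‖]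
  · have hTT : T ∈ Icc 0 T := ⟨hT.le, le_rfl⟩
    have h1 : ∫ s in (0 : ℝ)..T, ‖𝓕.grad (v s) - 𝓕.grad (vh s)‖ ^ 2 ≤
        2 * (∫ s in (0 : ℝ)..T, ‖𝓕.grad (v s) - 𝓕.grad (w s)‖ ^ 2) +
        2 * ∫ s in (0 : ℝ)..T, ‖𝓕.grad (vh s) - 𝓕.grad (w s)‖ ^ 2 := by
      rw [← intervalIntegral.integral_const_mul, ← intervalIntegral.integral_const_mul,
        ← intervalIntegral.integral_add ((ii cv cw).const_mul 2) ((ii cvh cw).const_mul 2)]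
      refine intervalIntegral.integral_mono_on hT.le (ii cv cvh)
        (((ii cv cw).const_mul 2).add ((ii cvh cw).const_mul 2)) fun s _ => ?_
      rw [norm_sub_rev (𝓕.grad (vh s))]
      exact norm_sub_sq_le_two_mul _ _ _
    have h2 := key' T hTT
    rw [intervalIntegral.integral_const_mul] at h2
    have h3 : ν * ∫ s in (0 : ℝ)..T, ‖𝓕.grad (v s) - 𝓕.grad (w s)‖ ^ 2 ≤ ν * (A * Δ) :=
      mul_le_mul_of_nonneg_left hwg hν.le
    have h4 : ν * (A * Δ) ≤ ν * (A * (e + Δ)) := by gcongr; linarith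
    have h5 := mul_le_mul_of_nonneg_left h1 hν.le
    linarith [sq_nonneg (k T - kh T), sq_nonneg ‖𝓕.val (vh T) - 𝓕.val (w T)‖]

end FlowForms

/-! ### The dual norm, extended-valued integrals and the estimate for the model. -/

theorem le_mul_add_of_forall_pos {x C a Δ : ℝ} (hC : 0 ≤ C)
    (h : ∀ ε > 0, x ≤ C * (a + (Δ + ε))) : x ≤ C * (a + Δ) := by
  refine le_of_forall_pos_le_add fun ε hε => ?_
  refine (h (ε / (C + 1)) (by positivity)).trans ?_
  have : C * (ε / (C + 1)) ≤ ε := by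
    rw [mul_div_assoc', div_le_iff₀ (by positivity)]
    nlinarith
  linarith

theorem enorm_sq_eq_ofReal {E : Type*} [NormedAddCommGroup E] (x : E) :
    ‖x‖ₑ ^ 2 = ENNReal.ofReal (‖x‖ ^ 2) := by
  rw [ENNReal.ofReal_pow (norm_nonneg _), ofReal_norm]

/-- A supremum of continuous functions is lower semicontinuous. This makes the dual norm of a
measurable path measurable in time, although the supremum is uncountable. -/
theorem lowerSemicontinuous_negNorm :
    LowerSemicontinuous (negNorm : L2 Ω (Vec d) → ℝ≥0∞) := by
  refine lowerSemicontinuous_biSup fun w _ => Continuous.lowerSemicontinuous ?_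
  exact ENNReal.continuous_ofReal.comp (continuous_id.inner continuous_const)

theorem aemeasurable_negNorm {g : ℝ → L2 Ω (Vec d)} {m : Measure ℝ}
    (hg : AEStronglyMeasurable g m) : AEMeasurable (fun t => negNorm (g t)) m := by
  borelize (L2 Ω (Vec d))
  exact lowerSemicontinuous_negNorm.measurable.comp_aemeasurable hg.aemeasurable

/-- By homogeneity, rescale `χ` to unit gradient norm. If the gradient is zero, Poincaré's
inequality makes the field zero too. -/
theorem abs_inner_le_negNorm {K : ℝ} (hK : ∀ u : H10 Ω, ‖val u‖ ≤ K * ‖grad u‖)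
    {g : L2 Ω (Vec d)} (hg : negNorm g ≠ ⊤) (χ : H10 Ω) :
    |⟪g, val χ⟫_ℝ| ≤ (negNorm g).toReal * ‖grad χ‖ := by
  have key : ∀ χ : H10 Ω, ⟪g, val χ⟫_ℝ ≤ (negNorm g).toReal * ‖grad χ‖ := fun χ => by
    rcases eq_or_ne ‖grad χ‖ 0 with h0 | h0
    · have : ‖val χ‖ ≤ 0 := by simpa [h0] using hK χ
      rw [norm_le_zero_iff.1 this, inner_zero_right, h0, mul_zero]
    · have hpos : 0 < ‖grad χ‖ := lt_of_le_of_ne (norm_nonneg _) h0.symm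
      have e1 : grad (‖grad χ‖⁻¹ • χ) = ‖grad χ‖⁻¹ • grad χ := map_smul (gradCLM Ω) _ _
      have e2 : val (‖grad χ‖⁻¹ • χ) = ‖grad χ‖⁻¹ • val χ := map_smul (valCLM Ω) _ _
      have h1 : ‖grad (‖grad χ‖⁻¹ • χ)‖ ≤ 1 := by
        rw [e1, norm_smul, norm_inv, norm_norm, inv_mul_cancel₀ h0]
      have h2 : ENNReal.ofReal ⟪g, val (‖grad χ‖⁻¹ • χ)⟫_ℝ ≤ negNorm g :=
        le_iSup₂_of_le (f := fun (w : H10 Ω) (_ : ‖grad w‖ ≤ 1) => ENNReal.ofReal ⟪g, val w⟫_ℝ)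
          _ h1 le_rfl
      have h3 := (ENNReal.ofReal_le_iff_le_toReal hg).1 h2
      rw [e2, real_inner_smul_right, inv_mul_le_iff₀ hpos] at h3
      linarith
  refine abs_le.2 ⟨?_, key χ⟩
  have h := key (-χ)
  have e1 : grad (-χ) = -grad χ := map_neg (gradCLM Ω) _
  have e2 : val (-χ) = -val χ := map_neg (valCLM Ω) _
  rw [e1, e2, inner_neg_right, norm_neg] at h
  linarith

section Conversion

variable {ν τ T : ℝ} {μ : Vec d → ℝ} {cmax : ℝ} {f : ℝ → StrongDual ℝ (H10 Ω)}
    {𝓕 : FlowForms (H10 Ω) (L2 Ω (Vec d)) (L2 Ω (Mat d)) (L2 Ω ℝ)}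
    (hcm : Measurable fun x => μ x * τ)
    (hc : ∀ᵐ x ∂(volume.restrict Ω), 0 ≤ μ x * τ ∧ μ x * τ ≤ cmax)
    (hval : ∀ u, 𝓕.val u = val u) (hgrad : ∀ u, 𝓕.grad u = grad u)
    (hvisc : ∀ u w, 𝓕.visc u w = gradForm (fun x => μ x * τ) u w)
    (hconv : ∀ u v w, 𝓕.conv u v w = triForm u v w) (hdiv : ∀ u p, 𝓕.div u p = divForm u p)
include hcm hc hval hgrad hvisc hconv hdiv

theorem IsModelSolution.isSolution {v v' : ℝ → H10 Ω} {q : ℝ → L2 Ω ℝ} {k k' : ℝ → ℝ}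
    (h : IsModelSolution Ω ν τ μ T f v v' q k k') :
    𝓕.IsSolution ν (√2 / 2 * τ⁻¹) (1 / volume.real Ω) T f ⊤ v v' q k k' where
  deriv_v := h.hasDeriv_v
  deriv_k := h.hasDeriv_k
  mem := fun _ _ => trivial
  momentum := by
    filter_upwards [h.momentum] with t ht w _
    rw [hval, hval, hgrad, hgrad, hvisc, hconv, hdiv, ← ht w,
      gradForm_add_mul (c := fun x => μ x * τ) hcm hc]
    ring
  kEquation := by
    filter_upwards [h.kEquation] with t ht
    rw [hvisc, ht, gradForm_mul]

theorem IsSemidiscreteSolution.isSolution {Wh : Submodule ℝ (H10 Ω)} {Qh : Submodule ℝ (L2 Ω ℝ)}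
    {vh vh' : ℝ → H10 Ω} {qh : ℝ → L2 Ω ℝ} {kh kh' : ℝ → ℝ}
    (h : IsSemidiscreteSolution Ω ν τ μ T f Wh Qh vh vh' qh kh kh') :
    𝓕.IsSolution ν (√2 / 2 * τ⁻¹) (1 / volume.real Ω) T f Wh vh vh' qh kh kh' where
  deriv_v := h.path_vh.1
  deriv_k := h.hasDeriv_kh
  mem := h.path_vh.2
  momentum := by
    filter_upwards [h.momentum] with t ht w hw
    rw [hval, hval, hgrad, hgrad, hvisc, hconv, hdiv, ← ht w hw,
      gradForm_add_mul (c := fun x => μ x * τ) hcm hc]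
    ring
  kEquation := by
    filter_upwards [h.kEquation] with t ht
    rw [hvisc, ht, gradForm_mul]

end Conversion

theorem iSup_enorm_sq_le {E : Type*} [NormedAddCommGroup E] {s : Set ℝ} {g : ℝ → E} {X : ℝ}
    (h : ∀ t ∈ s, ‖g t‖ ^ 2 ≤ X) : ⨆ t ∈ s, ‖g t‖ₑ ^ 2 ≤ ENNReal.ofReal X :=
  iSup₂_le fun t ht => by
    rw [enorm_sq_eq_ofReal]
    exact ENNReal.ofReal_le_ofReal (h t ht)

/-- A bound for a Lebesgue integral of three squares, in terms of real-valued integrals. -/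
theorem integral_bounds_of_lintegral_le {α E F : Type*} [MeasurableSpace α] {m : Measure α}
    [NormedAddCommGroup E] [NormedAddCommGroup F] {a : α → E} {N : α → ℝ≥0∞} {b : α → F}
    (ha : AEStronglyMeasurable a m) (hN : AEMeasurable N m) (hb : AEStronglyMeasurable b m)
    {J : ℝ} (hJ : 0 ≤ J) (h : ∫⁻ t, (‖a t‖ₑ ^ 2 + N t ^ 2 + ‖b t‖ₑ ^ 2) ∂m ≤ ENNReal.ofReal J) :
    (∀ᵐ t ∂m, N t ≠ ⊤) ∧ Integrable (fun t => ‖a t‖ ^ 2) m ∧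
      Integrable (fun t => (N t).toReal ^ 2) m ∧ ∫ t, ‖a t‖ ^ 2 ∂m ≤ J ∧
      ∫ t, ((N t).toReal ^ 2 + ‖b t‖ ^ 2) ∂m ≤ J := by
  set S : α → ℝ≥0∞ := fun t => ‖a t‖ₑ ^ 2 + N t ^ 2 + ‖b t‖ₑ ^ 2 with hSdef
  have mS : AEMeasurable S m :=
    ((ha.enorm.pow_const 2).add (hN.pow_const 2)).add (hb.enorm.pow_const 2)
  have hStop : ∫⁻ t, S t ∂m ≠ ⊤ := (h.trans_lt ENNReal.ofReal_lt_top).ne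
  have hSfin : ∀ᵐ t ∂m, S t < ⊤ := ae_lt_top' mS hStop
  have iS : Integrable (fun t => (S t).toReal) m :=
    integrable_toReal_of_lintegral_ne_top mS hStop
  have hSJ : ∫ t, (S t).toReal ∂m ≤ J := by
    rw [integral_toReal mS hSfin]
    exact ENNReal.toReal_le_of_le_ofReal hJ h
  have hSeq : ∀ᵐ t ∂m, N t ≠ ⊤ ∧
      (S t).toReal = ‖a t‖ ^ 2 + (N t).toReal ^ 2 + ‖b t‖ ^ 2 := by
    filter_upwards [hSfin] with t ht
    have hNt : N t ≠ ⊤ := fun htop => by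
      rw [hSdef] at ht
      simp [htop] at ht
    refine ⟨hNt, ?_⟩
    rw [hSdef]
    dsimp only
    rw [ENNReal.toReal_add (by finiteness) (by finiteness),
      ENNReal.toReal_add (by finiteness) (by finiteness), ENNReal.toReal_pow, ENNReal.toReal_pow,
      ENNReal.toReal_pow, toReal_enorm, toReal_enorm]
  have ia : Integrable (fun t => ‖a t‖ ^ 2) m := by
    refine iS.mono' (ha.norm.pow 2) ?_
    filter_upwards [hSeq] with t ht
    rw [ht.2, Real.norm_of_nonneg (sq_nonneg _)]
    linarith [sq_nonneg (N t).toReal, sq_nonneg ‖b t‖]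
  have iN : Integrable (fun t => (N t).toReal ^ 2) m := by
    refine iS.mono' (hN.ennreal_toReal.pow_const 2).aestronglyMeasurable ?_
    filter_upwards [hSeq] with t ht
    rw [ht.2, Real.norm_of_nonneg (sq_nonneg _)]
    linarith [sq_nonneg ‖a t‖, sq_nonneg ‖b t‖]
  have ib : Integrable (fun t => ‖b t‖ ^ 2) m := by
    refine iS.mono' (hb.norm.pow 2) ?_
    filter_upwards [hSeq] with t ht
    rw [ht.2, Real.norm_of_nonneg (sq_nonneg _)]
    linarith [sq_nonneg ‖a t‖, sq_nonneg (N t).toReal]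
  refine ⟨hSeq.mono fun t ht => ht.1, ia, iN, (integral_mono_ae ia iS ?_).trans hSJ,
    (integral_mono_ae (iN.add ib) iS ?_).trans hSJ⟩
  · filter_upwards [hSeq] with t ht
    rw [ht.2]
    linarith [sq_nonneg (N t).toReal, sq_nonneg ‖b t‖]
  · filter_upwards [hSeq] with t ht
    rw [ht.2]
    simp only [Pi.add_apply]
    linarith [sq_nonneg ‖a t‖]

set_option maxHeartbeats 1000000 in
/-- The error estimate against a fixed pair of discrete paths. -/
theorem exists_estimate (hd : d = 2 ∨ d = 3) (hΩo : IsOpen Ω) (hΩb : Bornology.IsBounded Ω)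
    (hΩn : Ω.Nonempty) {ν τ T : ℝ} (hν : 0 < ν) (hτ : 0 < τ) (hT : 0 < T)
    {μ : Vec d → ℝ} (hμm : Measurable μ) {μmax : ℝ} (hμ : ∀ x ∈ Ω, 0 ≤ μ x ∧ μ x ≤ μmax)
    {f : ℝ → StrongDual ℝ (H10 Ω)} (hf : MemLp f 2 (volume.restrict (Icc 0 T)))
    (v₀ : H10 Ω) {k₀ : ℝ} (hk₀ : 0 ≤ k₀) (R : ℝ) :
    ∃ C : ℝ, 0 ≤ C ∧ ∀ {v v' : ℝ → H10 Ω} {q : ℝ → L2 Ω ℝ} {k k' : ℝ → ℝ},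
      IsModelSolution Ω ν τ μ T f v v' q k k' → v 0 = v₀ → k 0 = k₀ →
      ∀ {Wh : Submodule ℝ (H10 Ω)} {Qh : Submodule ℝ (L2 Ω ℝ)}, FiniteDimensional ℝ Wh →
      ∀ {vh vh' : ℝ → H10 Ω} {qh : ℝ → L2 Ω ℝ} {kh kh' : ℝ → ℝ},
      IsSemidiscreteSolution Ω ν τ μ T f Wh Qh vh vh' qh kh kh' →
      ‖val (vh 0)‖ ≤ R → 0 ≤ kh 0 → kh 0 ≤ R →
      ∀ {w w' : ℝ → H10 Ω}, IsPath T (discDivFree Wh Qh) w w' →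
      ∀ {p : ℝ → L2 Ω ℝ}, IsPressurePath T Qh p → ∀ {J : ℝ}, 0 ≤ J →
      ∫⁻ t in Icc 0 T, (‖q t - p t‖ₑ ^ 2 + negNorm (val (v' t) - val (w' t)) ^ 2
        + ‖grad (v t) - grad (w t)‖ₑ ^ 2) ≤ ENNReal.ofReal J →
      (⨆ t ∈ Icc 0 T, ‖val (v t) - val (vh t)‖ₑ ^ 2) + (⨆ t ∈ Icc 0 T, ‖k t - kh t‖ₑ ^ 2)
          + ENNReal.ofReal ν * ∫⁻ t in Icc 0 T, ‖grad (v t) - grad (vh t)‖ₑ ^ 2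
        ≤ ENNReal.ofReal (C * (‖val v₀ - val (vh 0)‖ ^ 2 + ‖k 0 - kh 0‖ ^ 2 + J)) := by
  -- The constant is built from the gradient bound and `∫‖v'‖²` of one reference solution with the
  -- given data. Uniqueness transfers these bounds to every other solution; if there is none, the
  -- claim is vacuous.
  by_cases hex : ∃ (v v' : ℝ → H10 Ω) (q : ℝ → L2 Ω ℝ) (k k' : ℝ → ℝ),
    IsModelSolution Ω ν τ μ T f v v' q k k' ∧ v 0 = v₀ ∧ k 0 = k₀
  swap
  · refine ⟨0, le_rfl, fun {v v' q k k'} h hv0 hk0 => ?_⟩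
    exact absurd ⟨v, v', q, k, k', h, hv0, hk0⟩ hex
  by_cases hR : 0 ≤ R
  swap
  · exact ⟨0, le_rfl, fun _ _ _ _ _ _ _ _ _ _ _ _ h _ _ =>
      absurd ((norm_nonneg _).trans h) hR⟩
  obtain ⟨vs, vs', qs, ks, ks', hs, hvs0, hks0⟩ := hex
  have hμmax : 0 ≤ μmax := by
    obtain ⟨x, hx⟩ := hΩn
    exact (hμ x hx).1.trans (hμ x hx).2
  have hcm : Measurable fun x => μ x * τ := hμm.mul_const τ
  have hcb : ∀ x ∈ Ω, 0 ≤ μ x * τ ∧ μ x * τ ≤ μmax * τ := fun x hx =>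
    ⟨mul_nonneg (hμ x hx).1 hτ.le, mul_le_mul_of_nonneg_right (hμ x hx).2 hτ.le⟩
  obtain ⟨𝓕, hval, hgrad, hvisc, hconv, hdiv⟩ :=
    exists_flowForms hd hΩo hΩb hcm hcb (mul_nonneg hμmax hτ.le)
  have hc : ∀ᵐ x ∂(volume.restrict Ω), 0 ≤ μ x * τ ∧ μ x * τ ≤ μmax * τ :=
    ae_restrict_of_forall_mem hΩo.measurableSet hcb
  have hrate : 0 ≤ √2 / 2 * τ⁻¹ := by positivity
  have hvol : 0 ≤ 1 / volume.real Ω := by positivity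
  have hss := hs.isSolution hcm hc hval hgrad hvisc hconv hdiv
  obtain ⟨B, hB⟩ := isCompact_Icc.exists_bound_of_continuousOn (hss.continuousOn_grad hT.le)
  have hB0 : 0 ≤ B := (norm_nonneg _).trans (hB 0 ⟨le_rfl, hT.le⟩)
  obtain ⟨C, hC0, hC⟩ := FlowForms.exists_galerkin_constant (𝓕 := 𝓕) hν hrate hvol hT hf hR hB0
    (∫ s in (0 : ℝ)..T, ‖vs' s‖ ^ 2)
  refine ⟨3 * C, by positivity, ?_⟩
  intro v v' q k k' h hv0 hk0 Wh Qh hWh vh vh' qh kh kh' hh hvh0 hkh0 hkhR w w' hw p hp J hJ hint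
  have hsol := h.isSolution hcm hc hval hgrad hvisc hconv hdiv
  have hhs := hh.isSolution hcm hc hval hgrad hvisc hconv hdiv
  -- The annihilator of the divergence-free fields contains the pressures of both solutions, and
  -- their velocities lie in its discrete kernel. This fits the abstract uniqueness statement.
  let Q₀ : Submodule ℝ (L2 Ω ℝ) :=
    { carrier := {p | ∀ u ∈ divFree Ω, 𝓕.div u p = 0}
      add_mem' := fun ha hb u hu => by rw [map_add, ha u hu, hb u hu, add_zero]
      zero_mem' := fun u _ => map_zero _
      smul_mem' := fun a p hp u hu => by rw [map_smul, hp u hu, smul_zero] }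
  have hQ₀ : ∀ {p : L2 Ω ℝ}, MeanZero p → p ∈ Q₀ := fun hp u hu => by rw [hdiv, hu _ hp]
  have heq : ∀ t ∈ Icc 0 T, v t = vs t := hsol.eqOn hss hν hrate hvol hT.le hf (Q := Q₀)
    (fun t ht => hQ₀ (h.meanZero_q t ht)) (fun t ht => hQ₀ (hs.meanZero_q t ht))
    (fun t ht => ⟨trivial, fun p hp => hp _ (h.divFree_v t ht)⟩)
    (fun t ht => ⟨trivial, fun p hp => hp _ (hs.divFree_v t ht)⟩)
    (hv0.trans hvs0.symm) (hk0.trans hks0.symm) (hks0 ▸ hk₀)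
  have hvB : ∀ t ∈ Icc 0 T, ‖𝓕.grad (v t)‖ ≤ B := fun t ht => by
    rw [heq t ht]
    exact hB t ht
  have hI : ∫ s in (0 : ℝ)..T, ‖v' s‖ ^ 2 ≤ ∫ s in (0 : ℝ)..T, ‖vs' s‖ ^ 2 := by
    refine le_of_eq ?_
    rw [intervalIntegral.integral_of_le hT.le, intervalIntegral.integral_of_le hT.le,
      ← integral_Icc_eq_integral_Ioc, ← integral_Icc_eq_integral_Ioc]
    refine integral_congr_ae ?_
    filter_upwards [h.hasDeriv_v.ae_eq hT.le hs.hasDeriv_v heq] with t ht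
    rw [ht]
  have hker : ∀ {u : H10 Ω}, u ∈ discDivFree Wh Qh → u ∈ 𝓕.discKer Wh Qh := fun hu =>
    ⟨hu.1, fun p hp => by rw [hdiv, hu.2 p hp]⟩
  have cg : ∀ {u u' : ℝ → H10 Ω}, HasTimeDeriv T u u' →
      ContinuousOn (fun t => grad (u t)) (Icc 0 T) := fun hu =>
    (gradCLM Ω).continuous.comp_continuousOn (hu.continuousOn hT.le)
  have mg : AEStronglyMeasurable (fun t => grad (v t) - grad (w t)) (volume.restrict (Icc 0 T)) :=
    ((cg h.hasDeriv_v).sub (cg hw.1)).aestronglyMeasurable measurableSet_Icc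
  have ig : IntegrableOn (fun t => ‖grad (v t) - grad (vh t)‖ ^ 2) (Icc 0 T) :=
    (((cg h.hasDeriv_v).sub (cg hh.path_vh.1)).norm.pow 2).integrableOn_Icc
  have mq : AEStronglyMeasurable (fun t => q t - p t) (volume.restrict (Icc 0 T)) :=
    h.memLp_q.1.sub hp.1
  have mw' : AEStronglyMeasurable w' (volume.restrict (Icc 0 T)) :=
    ((intervalIntegrable_iff_integrableOn_Icc_of_le hT.le).1 hw.1.1).1
  have mn : AEMeasurable (fun t => negNorm (val (v' t) - val (w' t)))
      (volume.restrict (Icc 0 T)) :=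
    aemeasurable_negNorm (((valCLM Ω).continuous.comp_aestronglyMeasurable h.memLp_v'.1).sub
      ((valCLM Ω).continuous.comp_aestronglyMeasurable mw'))
  obtain ⟨hN, iq, iN, hqJ, hzJ⟩ := integral_bounds_of_lintegral_le mq mn mg hJ hint
  set n : ℝ → ℝ := fun t => (negNorm (val (v' t) - val (w' t))).toReal
  rw [integral_Icc_eq_integral_Ioc, ← intervalIntegral.integral_of_le hT.le] at hqJ hzJ
  have hneg : ∀ᵐ t ∂(volume.restrict (Icc 0 T)), ∀ χ,
      |⟪𝓕.val (v' t) - 𝓕.val (w' t), 𝓕.val χ⟫_ℝ| ≤ n t * ‖𝓕.grad χ‖ := by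
    filter_upwards [hN] with t ht χ
    simp only [hval, hgrad]
    exact abs_inner_le_negNorm (fun u => by rw [← hval, ← hgrad]; exact 𝓕.norm_val_le u) ht χ
  -- The initial-value construction needs a window of positive length, while `J` may be zero. Hence
  -- `J + ε` is used and `ε` is sent to zero afterwards.
  have est := fun ε (hε : 0 < ε) => hC hsol h.memLp_v' hI hvB hhs hh.qh_mem
    (fun t ht => ⟨hh.path_vh.2 t ht, fun p hp => by rw [hdiv, hh.continuity t ht p hp]⟩)
    (by rwa [hval]) hkh0 hkhR hw.1 (fun t ht => hker (hw.2 t ht)) iN hneg hp.2 iq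
    (Δ := J + ε) (by linarith) (by simp only [hgrad]; linarith) (by linarith)
  simp only [hval, hgrad, hv0] at est
  set e := ‖val v₀ - val (vh 0)‖ ^ 2 + (k 0 - kh 0) ^ 2 with he
  have e1 : ∀ t ∈ Icc 0 T, ‖val (v t) - val (vh t)‖ ^ 2 ≤ C * (e + J) := fun t ht =>
    le_mul_add_of_forall_pos hC0 fun ε hε => (est ε hε).1 t ht
  have e2 : ∀ t ∈ Icc 0 T, ‖k t - kh t‖ ^ 2 ≤ C * (e + J) := fun t ht => by
    rw [Real.norm_eq_abs, sq_abs]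
    exact le_mul_add_of_forall_pos hC0 fun ε hε => (est ε hε).2.1 t ht
  have e3 : ν * ∫ s in (0 : ℝ)..T, ‖grad (v s) - grad (vh s)‖ ^ 2 ≤ C * (e + J) :=
    le_mul_add_of_forall_pos hC0 fun ε hε => (est ε hε).2.2
  have l3 : ENNReal.ofReal ν * ∫⁻ t in Icc 0 T, ‖grad (v t) - grad (vh t)‖ₑ ^ 2 ≤
      ENNReal.ofReal (C * (e + J)) := by
    simp only [enorm_sq_eq_ofReal]
    rw [← ofReal_integral_eq_lintegral_ofReal ig
      (Filter.Eventually.of_forall fun _ => sq_nonneg _), ← ENNReal.ofReal_mul hν.le]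
    rw [intervalIntegral.integral_of_le hT.le, ← integral_Icc_eq_integral_Ioc] at e3
    exact ENNReal.ofReal_le_ofReal e3
  have hX : 0 ≤ C * (e + J) := by positivity
  refine (add_le_add (add_le_add (iSup_enorm_sq_le e1) (iSup_enorm_sq_le e2)) l3).trans ?_
  rw [← ENNReal.ofReal_add hX hX, ← ENNReal.ofReal_add (by positivity) hX,
    Real.norm_eq_abs, sq_abs]
  refine ENNReal.ofReal_le_ofReal (le_of_eq ?_)
  ring

end HalfEq

/-! ### The main theorem. -/

open HalfEq

theorem theorem4p2 {d : ℕ} (hd : d = 2 ∨ d = 3)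
    (Ω : Set (Vec d)) (hΩo : IsOpen Ω) (hΩb : Bornology.IsBounded Ω) (hΩn : Ω.Nonempty)
    (ν τ T : ℝ) (hν : 0 < ν) (hτ : 0 < τ) (hT : 0 < T)
    (μ : Vec d → ℝ) (hμm : Measurable μ) (μmax : ℝ) (hμ : ∀ x ∈ Ω, 0 ≤ μ x ∧ μ x ≤ μmax)
    (f : ℝ → StrongDual ℝ (H10 Ω)) (hf : MemLp f 2 (volume.restrict (Icc 0 T)))
    (v₀ : H10 Ω) (k₀ : ℝ) (hk₀ : 0 ≤ k₀) (M R : ℝ) :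
    ∃ C : ℝ, 0 < C ∧
      ∀ (v v' : ℝ → H10 Ω) (q : ℝ → L2 Ω ℝ) (k k' : ℝ → ℝ),
        IsModelSolution Ω ν τ μ T f v v' q k k' → v 0 = v₀ → k 0 = k₀ →
        ∫⁻ t in Icc 0 T, ‖grad (v t)‖ₑ ^ 4 ≤ ENNReal.ofReal M →
      ∀ (Wh : Submodule ℝ (H10 Ω)) (Qh : Submodule ℝ (L2 Ω ℝ)),
        FiniteDimensional ℝ Wh → FiniteDimensional ℝ Qh → (∀ p ∈ Qh, MeanZero p) →
      ∀ (vh vh' : ℝ → H10 Ω) (qh : ℝ → L2 Ω ℝ) (kh kh' : ℝ → ℝ),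
        IsSemidiscreteSolution Ω ν τ μ T f Wh Qh vh vh' qh kh kh' →
        ‖val (vh 0)‖ ≤ R → 0 ≤ kh 0 → kh 0 ≤ R →
        (⨆ t ∈ Icc 0 T, ‖val (v t) - val (vh t)‖ₑ ^ 2) + (⨆ t ∈ Icc 0 T, ‖k t - kh t‖ₑ ^ 2)
            + ENNReal.ofReal ν * ∫⁻ t in Icc 0 T, ‖grad (v t) - grad (vh t)‖ₑ ^ 2
          ≤ ENNReal.ofReal C * (‖val v₀ - val (vh 0)‖ₑ ^ 2 + ‖k 0 - kh 0‖ₑ ^ 2)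
            + ENNReal.ofReal C * (⨅ (w : ℝ → H10 Ω) (w' : ℝ → H10 Ω) (_ : IsPath T Wh w w'),
                ∫⁻ t in Icc 0 T, ‖grad (v t) - grad (w t)‖ₑ ^ 2)
            + ENNReal.ofReal C * (⨅ (w : ℝ → H10 Ω) (w' : ℝ → H10 Ω) (_ : IsPath T Wh w w'),
                ⨆ t ∈ Icc 0 T, ‖val (v t) - val (w t)‖ₑ ^ 2)
            + ENNReal.ofReal C * (⨅ (w : ℝ → H10 Ω) (w' : ℝ → H10 Ω)
                (_ : IsPath T (discDivFree Wh Qh) w w')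
                (p : ℝ → L2 Ω ℝ) (_ : IsPressurePath T Qh p),
                ∫⁻ t in Icc 0 T, (‖q t - p t‖ₑ ^ 2 + negNorm (val (v' t) - val (w' t)) ^ 2
                  + ‖grad (v t) - grad (w t)‖ₑ ^ 2)) := by
  obtain ⟨C, hC0, hC⟩ := exists_estimate hd hΩo hΩb hΩn hν hτ hT hμm hμ hf v₀ hk₀ R
  -- Adding one makes the constant positive, as needed for the division below and for an infinite
  -- right-hand side to remain infinite.
  refine ⟨C + 1, by positivity, ?_⟩
  intro v v' q k k' h hv0 hk0 _ Wh Qh hWh _ _ vh vh' qh kh kh' hh hvh0 hkh0 hkhR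
  have hc0 : ENNReal.ofReal (C + 1) ≠ 0 := by
    rw [Ne, ENNReal.ofReal_eq_zero, not_le]
    positivity
  -- The initial errors and the last infimum already bound the left-hand side; the two middle terms
  -- are nonnegative.
  refine le_trans ?_ (add_le_add_left (le_self_add.trans le_self_add) _)
  -- Subtracting the initial errors and dividing by the constant isolates the infimum, so each pair
  -- of paths can be treated separately.
  rw [← tsub_le_iff_left, mul_comm (ENNReal.ofReal (C + 1)) (iInf _),
    ← ENNReal.div_le_iff hc0 ENNReal.ofReal_ne_top]
  refine le_iInf fun w => le_iInf fun w' => le_iInf fun hw => le_iInf fun p => le_iInf fun hp => ?_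
  rw [ENNReal.div_le_iff hc0 ENNReal.ofReal_ne_top, tsub_le_iff_left]
  set J := ∫⁻ t in Icc 0 T, (‖q t - p t‖ₑ ^ 2 + negNorm (val (v' t) - val (w' t)) ^ 2
    + ‖grad (v t) - grad (w t)‖ₑ ^ 2) with hJ
  rcases eq_or_ne J ⊤ with htop | htop
  · rw [htop, ENNReal.top_mul hc0, add_top]
    exact le_top
  · refine (hC h hv0 hk0 hWh hh hvh0 hkh0 hkhR hw hp (J := J.toReal) ENNReal.toReal_nonneg
      (by rw [ENNReal.ofReal_toReal htop])).trans ?_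
    rw [enorm_sq_eq_ofReal, enorm_sq_eq_ofReal, mul_comm J, ← mul_add,
      ← ENNReal.ofReal_add (by positivity) (by positivity), ENNReal.ofReal_mul hC0,
      ENNReal.ofReal_add (by positivity) (by positivity), ENNReal.ofReal_toReal htop]
    gcongr
    linarith
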